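/- **Setting.** Let $M$ be a smooth $n$-dimensional manifold (without boundary, Hausdorff, $\sigma$-compact) and let $\zeta:\mathbf Z\to M$ be a bundle of affine values (AV-bundle): a smooth bundle with an action $(r,z)\mapsto r+z$ of $(\mathbb R,+)$ on $\mathbf Z$ preserving the fibres, locally isomorphic to $M\times\mathbb R$ with the action by translations. Let $X_{\mathbf Z}$ be the fundamental vector field of the action, with the sign for which $X_{\mathbf Z}(F_\sigma)=1$, where for a section $\sigma$ of $\mathbf Z$ we write $F_\sigma(z)=\sigma(\zeta(z))-z$. *The Lie algebroids.* $\widetilde{\mathsf T}\mathbf Z$ is the Lie algebroid over $M$ whose sections are the smooth vector fields $X$ on $\mathbf Z$ with $[X_{\mathbf Z},X]=0$, with the bracket of vector fields, the anchor being the projection to $M$. $\widetilde{\mathsf L}\mathbf Z$ is the Lie algebroid over $M$ whose sections are the first-order differential operators $D=X+h$ on $\mathbf Z$ ($X$ a smooth vector field, $h\in C^\infty(\mathbf Z)$) with $X_{\mathbf Z}(h)=0$ and $[X,X_{\mathbf Z}]=hX_{\mathbf Z}$, with the commutator bracket, the anchor being the projection of $X$ to $M$; it carries the closed $1$-form $\phi^0(X+h)=h$.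 For a section $\sigma$ of $\mathbf Z$, the functions $X(F_\sigma)$ and $D(F_\sigma)=X(F_\sigma)+hF_\sigma$ are constant along the fibres, so they define functions on $M$; in this way $\sigma$ defines a section $\mathbf d\sigma$ of the dual of $\widetilde{\mathsf T}\mathbf Z$ and a section $\mathbf j\sigma$ of the dual of $\widetilde{\mathsf L}\mathbf Z$. *Brackets of multisections.* For a Lie algebroid $E$ let $\mathsf A(E)=\bigoplus_k\mathsf{Sec}(\bigwedge^kE)$. The Schouten bracket $[\![\cdot,\cdot]\!]_E$ is the $\mathbb R$-bilinear bracket on $\mathsf A(E)$ of degree $-1$ with $$[\![X,Y]\!]=[X,Y],\qquad [\![X,f]\!]=\rho(X)f,\qquad [\![f,g]\!]=0$$ for sections $X,Y$ and functions $f,g$ (here $\rho$ is the anchor), and, for $P\in\mathsf A^p$, $Q\in\mathsf A^q$, $$[\![P,Q]\!]=-(-1)^{(p-1)(q-1)}[\![Q,P]\!],\qquad [\![P,Q\wedge R]\!]=[\![P,Q]\!]\wedge R+(-1)^{(p-1)q}\,Q\wedge[\![P,R]\!].$$ For a closed $1$-form $\phi$ on $E$, the Schouten–Jacobi bracket is $$[\![P,Q]\!]^{\phi}=[\![P,Q]\!]+(p-1)\,P\wedge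 i_\phi Q-(-1)^{p-1}(q-1)\,i_\phi P\wedge Q .$$ *Aff-Poisson and aff-Jacobi structures.* A bracket $\{\cdot,\cdot\}:\mathsf{Sec}(\mathbf Z)\times\mathsf{Sec}(\mathbf Z)\to C^\infty(M)$ is an affine Lie bracket if it is skew-symmetric, affine in each argument, and satisfies the Jacobi identity $\{\sigma_1,\{\sigma_2,\sigma_3\}\}_{\mathsf v}+\text{cyclic}=0$, where $\{\sigma,\cdot\}_{\mathsf v}:C^\infty(M)\to C^\infty(M)$ is the linear part of $\{\sigma,\cdot\}$. It is aff-Poisson if every $\{\sigma,\cdot\}$ is an affine derivation (its value at $m$ depends affinely on the differential of the argument at $m$), and aff-Jacobi if every $\{\sigma,\cdot\}$ is an affine differential operator of order at most $1$ (its value at $m$ depends affinely on the first jet of the argument at $m$). An element $\Lambda\in\mathsf{Sec}(\bigwedge^2\widetilde{\mathsf T}\mathbf Z)$ *represents an aff-Poisson structure* if $\{\sigma,\sigma'\}=\Lambda(\mathbf d\sigma,\mathbf d\sigma')$ is an aff-Poisson bracket; $\mathcal J\in\mathsf{Sec}(\bigwedge^2\widetilde{\mathsf L}\mathbf Z)$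 *represents an aff-Jacobi structure* if $\{\sigma,\sigma'\}=\mathcal J(\mathbf j\sigma,\mathbf j\sigma')$ is an aff-Jacobi bracket. A graded operator of degree $1$ is a cohomology operator if its square is zero. **Theorem.** The Schouten brackets of $\widetilde{\mathsf T}\mathbf Z$ and of $\widetilde{\mathsf L}\mathbf Z$ exist and are unique, and: (a) $\Lambda\in\mathsf{Sec}(\bigwedge^2\widetilde{\mathsf T}\mathbf Z)$ represents an aff-Poisson structure on $\mathbf Z$ if and only if the operator $\partial_\Lambda(Y)=[\![\Lambda,Y]\!]_{\widetilde{\mathsf T}\mathbf Z}$ of degree $1$ on $\mathsf A(\widetilde{\mathsf T}\mathbf Z)$ is a cohomology operator, i.e. $(\partial_\Lambda)^2=0$. In that case the coboundaries of $\partial_\Lambda$ are cocycles, and cocycles modulo coboundaries form the *aff-Poisson cohomology*. (b) $\mathcal J\in\mathsf{Sec}(\bigwedge^2\widetilde{\mathsf L}\mathbf Z)$ represents an aff-Jacobi structure on $\mathbf Z$ if and only if, for all $t\in\mathbb R$, the operator $$\partial^t_{\mathcal J}(R)=[\![\mathcal J,R]\!]^{\phi^0}_{\widetilde{\mathsf L}\mathbf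 Z}+t\,i_{\phi^0}\mathcal J\wedge R$$ of degree $1$ on $\mathsf A(\widetilde{\mathsf L}\mathbf Z)$ is a cohomology operator, i.e. $(\partial^t_{\mathcal J})^2=0$. In that case, for every $t$, the coboundaries of $\partial^t_{\mathcal J}$ are cocycles; cocycles modulo coboundaries form, for $t=0$, the *aff-Jacobi cohomology* and, for $t=1$, the *aff-Lichnerowicz–Jacobi cohomology*. -/

import Mathlib

open scoped Manifold ContDiff Topology
open VectorField

/-- The model with corners of an `n`-dimensional (boundaryless) smooth manifold. -/
noncomputable abbrev modelM (n : ℕ) :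
    ModelWithCorners ℝ (EuclideanSpace ℝ (Fin n)) (EuclideanSpace ℝ (Fin n)) :=
  𝓘(ℝ, EuclideanSpace ℝ (Fin n))

/-- The model with corners of the total space of an AV-bundle over an `n`-dimensional manifold. -/
noncomputable abbrev modelZ (n : ℕ) :
    ModelWithCorners ℝ (EuclideanSpace ℝ (Fin n) × ℝ) (ModelProd (EuclideanSpace ℝ (Fin n)) ℝ) :=
  (modelM n).prod 𝓘(ℝ, ℝ)

namespace AVBundle

section fields

variable {n : ℕ} {Z : Type*} [TopologicalSpace Z]
    [ChartedSpace (ModelProd (EuclideanSpace ℝ (Fin n)) ℝ) Z]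

/-- `X(f)` for a vector field `X` and a function `f` on `Z`. -/
noncomputable def fieldApply (X : ∀ z : Z, TangentSpace (modelZ n) z) (f : Z → ℝ) (z : Z) : ℝ :=
  mvfderiv (modelZ n) f z (X z)

theorem fieldApply_smul (X : ∀ z : Z, TangentSpace (modelZ n) z) (f g : Z → ℝ) :
    fieldApply (f • X) g = f * fieldApply X g := by
  ext z; simp [fieldApply]

theorem fieldApply_add (X : ∀ z : Z, TangentSpace (modelZ n) z) {f g : Z → ℝ}
    (hf : ContMDiff (modelZ n) 𝓘(ℝ, ℝ) ∞ f) (hg : ContMDiff (modelZ n) 𝓘(ℝ, ℝ) ∞ g) :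
    fieldApply X (f + g) = fieldApply X f + fieldApply X g := by
  ext z
  have h := mvfderiv_add (I := modelZ n) (hf.mdifferentiableAt (x := z) (by simp))
    (hg.mdifferentiableAt (x := z) (by simp))
  simp only [fieldApply, h, Pi.add_apply]; rfl

theorem fieldApply_const (X : ∀ z : Z, TangentSpace (modelZ n) z) (c : ℝ) :
    fieldApply X (fun _ => c) = 0 := by
  ext z
  exact congrArg (fun L => L (X z)) (mvfderiv_const (I := modelZ n) (x := z) (c := c))

theorem fieldApply_mul (X : ∀ z : Z, TangentSpace (modelZ n) z) {f g : Z → ℝ}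
    (hf : ContMDiff (modelZ n) 𝓘(ℝ, ℝ) ∞ f) (hg : ContMDiff (modelZ n) 𝓘(ℝ, ℝ) ∞ g) :
    fieldApply X (f * g) = f * fieldApply X g + g * fieldApply X f := by
  ext z
  have h := mvfderiv_mul (I := modelZ n) (hf.mdifferentiableAt (x := z) (by simp))
    (hg.mdifferentiableAt (x := z) (by simp))
  simp only [fieldApply, h, Pi.add_apply, Pi.mul_apply]; rfl

theorem fieldApply_const_smul (X : ∀ z : Z, TangentSpace (modelZ n) z) {f : Z → ℝ}
    (hf : ContMDiff (modelZ n) 𝓘(ℝ, ℝ) ∞ f) (c : ℝ) :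
    fieldApply X (c • f) = c • fieldApply X f := by
  have h := fieldApply_mul X (f := fun _ => c) contMDiff_const hf
  rw [fieldApply_const, mul_zero, add_zero] at h
  exact h

variable [IsManifold (modelZ n) ∞ Z]

/-- Smoothness of a vector field on `Z`. -/
def SmoothField (X : ∀ z : Z, TangentSpace (modelZ n) z) : Prop :=
  ContMDiff (modelZ n) (modelZ n).tangent ∞ (fun z => (⟨z, X z⟩ : TangentBundle (modelZ n) Z))

theorem SmoothField.mdiff {X : ∀ z : Z, TangentSpace (modelZ n) z} (hX : SmoothField X) (z : Z) :
    MDifferentiableAt (modelZ n) (modelZ n).tangent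
      (fun z => (⟨z, X z⟩ : TangentBundle (modelZ n) Z)) z :=
  ContMDiff.mdifferentiableAt hX (by simp)

theorem SmoothField.zero : SmoothField (fun z : Z => (0 : TangentSpace (modelZ n) z)) :=
  Bundle.contMDiff_zeroSection ℝ (TangentSpace (modelZ n) : Z → Type _)

theorem SmoothField.add {X Y : ∀ z : Z, TangentSpace (modelZ n) z} (hX : SmoothField X)
    (hY : SmoothField Y) : SmoothField (X + Y) :=
  ContMDiff.add_section hX hY

theorem SmoothField.smul {X : ∀ z : Z, TangentSpace (modelZ n) z} (hX : SmoothField X)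
    {f : Z → ℝ} (hf : ContMDiff (modelZ n) 𝓘(ℝ, ℝ) ∞ f) : SmoothField (f • X) :=
  ContMDiff.smul_section hf hX

theorem SmoothField.const_smul {X : ∀ z : Z, TangentSpace (modelZ n) z} (hX : SmoothField X)
    (c : ℝ) : SmoothField (c • X) :=
  ContMDiff.const_smul_section hX

theorem SmoothField.fieldApply {X : ∀ z : Z, TangentSpace (modelZ n) z} (hX : SmoothField X)
    {f : Z → ℝ} (hf : ContMDiff (modelZ n) 𝓘(ℝ, ℝ) ∞ f) :
    ContMDiff (modelZ n) 𝓘(ℝ, ℝ) ∞ (fieldApply X f) := by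
  have h3 := ContMDiff.contMDiff_tangentMap (m := ∞) hf (by simp)
  exact (contMDiff_snd_tangentBundle_modelSpace ℝ 𝓘(ℝ, ℝ)).comp (h3.comp hX)

theorem SmoothField.bracket {X Y : ∀ z : Z, TangentSpace (modelZ n) z} (hX : SmoothField X)
    (hY : SmoothField Y) : SmoothField (mlieBracket (modelZ n) X Y) := by
  have h1 : IsManifold (modelZ n) ((⊤ : ℕ∞) + 1) Z := by
    simpa using ‹IsManifold (modelZ n) ∞ Z›
  have h2 : IsManifold (modelZ n) (minSmoothness ℝ 2) Z := by
    rw [minSmoothness_of_isRCLikeNormedField]; infer_instance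
  exact ContDiff.mlieBracket_vectorField (m := ⊤) (n := ⊤) hX hY
    (by rw [minSmoothness_of_isRCLikeNormedField]; simp)

theorem SmoothField.jacobi {X Y W : ∀ z : Z, TangentSpace (modelZ n) z} (hX : SmoothField X)
    (hY : SmoothField Y) (hW : SmoothField W) :
    mlieBracket (modelZ n) X (mlieBracket (modelZ n) Y W) =
      mlieBracket (modelZ n) (mlieBracket (modelZ n) X Y) W +
      mlieBracket (modelZ n) Y (mlieBracket (modelZ n) X W) := by
  have h2 : IsManifold (modelZ n) (minSmoothness ℝ 3) Z := by
    rw [minSmoothness_of_isRCLikeNormedField]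
    exact IsManifold.of_le (n := ∞) (by exact WithTop.coe_le_coe.2 le_top)
  have h : minSmoothness ℝ 2 ≤ ∞ := by
    rw [minSmoothness_of_isRCLikeNormedField]; exact WithTop.coe_le_coe.2 le_top
  exact leibniz_identity_mlieBracket (ContMDiff.of_le hX h) (ContMDiff.of_le hY h)
    (ContMDiff.of_le hW h)

theorem SmoothField.bracket_smul {X Y : ∀ z : Z, TangentSpace (modelZ n) z}
    (hY : SmoothField Y) {f : Z → ℝ} (hf : ContMDiff (modelZ n) 𝓘(ℝ, ℝ) ∞ f) :
    mlieBracket (modelZ n) X (f • Y) =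
      AVBundle.fieldApply X f • Y + f • mlieBracket (modelZ n) X Y := by
  ext1 z
  exact mlieBracket_smul_right (hf.mdifferentiableAt (by simp)) (hY.mdiff z)

theorem SmoothField.bracket_add {X Y W : ∀ z : Z, TangentSpace (modelZ n) z}
    (hY : SmoothField Y) (hW : SmoothField W) :
    mlieBracket (modelZ n) X (Y + W) =
      mlieBracket (modelZ n) X Y + mlieBracket (modelZ n) X W := by
  ext1 z
  exact mlieBracket_add_right (hY.mdiff z) (hW.mdiff z)

theorem SmoothField.bracket_const_smul {X Y : ∀ z : Z, TangentSpace (modelZ n) z}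
    (hY : SmoothField Y) (c : ℝ) :
    mlieBracket (modelZ n) X (c • Y) = c • mlieBracket (modelZ n) X Y := by
  ext1 z
  exact mlieBracket_const_smul_right (hY.mdiff z)

end fields

end AVBundle

/-- A bundle of affine values `proj : Z → M`: a smooth bundle whose fibres are one-dimensional
affine spaces over `ℝ`. The affine structure of the fibres is the action `(r, z) ↦ r +ᵥ z` of
`(ℝ, +)` on `Z`; local trivializations identify it with translation in `M × ℝ`
(so the action is free, and transitive on every fibre). -/
structure AVBundle (n : ℕ) (M Z : Type*) [TopologicalSpace M]
    [ChartedSpace (EuclideanSpace ℝ (Fin n)) M] [TopologicalSpace Z]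
    [ChartedSpace (ModelProd (EuclideanSpace ℝ (Fin n)) ℝ) Z] [AddAction ℝ Z] where
  proj : Z → M
  proj_vadd : ∀ (r : ℝ) (z : Z), proj (r +ᵥ z) = proj z
  contMDiff_vadd : ContMDiff (𝓘(ℝ, ℝ).prod (modelZ n)) (modelZ n) ∞ (fun p : ℝ × Z => p.1 +ᵥ p.2)
  exists_triv : ∀ m : M, ∃ (U : Set M) (e : OpenPartialHomeomorph Z (M × ℝ)),
    IsOpen U ∧ m ∈ U ∧ e.source = proj ⁻¹' U ∧ e.target = U ×ˢ Set.univ ∧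
    (∀ z ∈ e.source, (e z).1 = proj z) ∧
    (∀ (r : ℝ), ∀ z ∈ e.source, (e (r +ᵥ z)).2 = r + (e z).2) ∧
    ContMDiffOn (modelZ n) ((modelM n).prod 𝓘(ℝ, ℝ)) ∞ e e.source ∧
    ContMDiffOn ((modelM n).prod 𝓘(ℝ, ℝ)) (modelZ n) ∞ e.symm e.target

namespace AVBundle

section basic

variable {n : ℕ} {M Z : Type*} [TopologicalSpace M]
    [ChartedSpace (EuclideanSpace ℝ (Fin n)) M] [TopologicalSpace Z]
    [ChartedSpace (ModelProd (EuclideanSpace ℝ (Fin n)) ℝ) Z] [AddAction ℝ Z]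

/-- The fundamental vector field of the action, with the sign for which
`X_Z (F_σ) = 1` (in affine coordinates `(x, s)`, `X_Z = -∂_s`). -/
noncomputable def fundField (_ζ : AVBundle n M Z) (z : Z) : TangentSpace (modelZ n) z :=
  (mfderiv 𝓘(ℝ, ℝ) (modelZ n) (fun r : ℝ => r +ᵥ z) 0 (-1 : ℝ) :
    EuclideanSpace ℝ (Fin n) × ℝ)

theorem exists_over (ζ : AVBundle n M Z) (m : M) : ∃ z, ζ.proj z = m := by
  obtain ⟨U, e, -, hm, hs, ht, h1, -⟩ := ζ.exists_triv m
  have h : (m, (0 : ℝ)) ∈ e.target := by rw [ht]; exact ⟨hm, trivial⟩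
  refine ⟨e.symm (m, 0), ?_⟩
  rw [← h1 _ (e.map_target h), e.right_inv h]

theorem exists_vadd_eq (ζ : AVBundle n M Z) {z w : Z} (h : ζ.proj z = ζ.proj w) :
    ∃ r : ℝ, r +ᵥ z = w := by
  obtain ⟨U, e, -, hm, hs, ht, h1, h2, -⟩ := ζ.exists_triv (ζ.proj z)
  have hz : z ∈ e.source := by rw [hs]; exact hm
  have hw : w ∈ e.source := by rw [hs]; change ζ.proj w ∈ U; rw [← h]; exact hm
  refine ⟨(e w).2 - (e z).2, ?_⟩
  have hz' : ((e w).2 - (e z).2) +ᵥ z ∈ e.source := by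
    rw [hs]; change ζ.proj _ ∈ U; rw [ζ.proj_vadd]; exact hm
  apply e.injOn hz' hw
  refine Prod.ext ?_ ?_
  · rw [h1 _ hz', h1 _ hw, ζ.proj_vadd, h]
  · rw [h2 _ _ hz]; ring

/-- A smooth function on `Z` that is constant along the fibres descends to `M`. -/
theorem exists_descend (ζ : AVBundle n M Z) {g : Z → ℝ}
    (hg : ContMDiff (modelZ n) 𝓘(ℝ, ℝ) ∞ g) (hc : ∀ (r : ℝ) z, g (r +ᵥ z) = g z) :
    ∃ f : C^∞⟮modelM n, M; ℝ⟯, ∀ z, f (ζ.proj z) = g z := by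
  have key : ∀ z w, ζ.proj z = ζ.proj w → g z = g w := by
    intro z w h
    obtain ⟨r, rfl⟩ := ζ.exists_vadd_eq h
    exact (hc r z).symm
  choose s hs using ζ.exists_over
  refine ⟨⟨fun m => g (s m), ?_⟩, fun z => key _ _ (hs _)⟩
  intro m
  obtain ⟨U, e, hU, hm, hs', ht, h1, -, -, hd⟩ := ζ.exists_triv m
  have hmem : ∀ x ∈ U, (x, (0 : ℝ)) ∈ e.target := fun x hx => by rw [ht]; exact ⟨hx, trivial⟩
  have h2 : ContMDiffAt (modelM n) (modelZ n) ∞ (fun x : M => e.symm (x, (0 : ℝ))) m :=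
    ContMDiffAt.comp m
      ((hd _ (hmem m hm)).contMDiffAt (e.open_target.mem_nhds (hmem m hm)))
      (contMDiffAt_id.prodMk contMDiffAt_const)
  refine ((hg _).comp m h2).congr_of_eventuallyEq ?_
  filter_upwards [hU.mem_nhds hm] with x hx
  apply key
  rw [hs, ← h1 _ (e.map_target (hmem x hx)), e.right_inv (hmem x hx)]

theorem mdiff_orbit (ζ : AVBundle n M Z) (z : Z) (r : ℝ) :
    MDifferentiableAt 𝓘(ℝ, ℝ) (modelZ n) (fun r : ℝ => r +ᵥ z) r := by
  have h : ContMDiff 𝓘(ℝ, ℝ) (modelZ n) ∞ (fun r : ℝ => r +ᵥ z) :=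
    ζ.contMDiff_vadd.comp (contMDiff_id.prodMk contMDiff_const)
  exact h.mdifferentiableAt (by simp)

theorem hasDerivAt_orbit (ζ : AVBundle n M Z) {g : Z → ℝ} {z : Z}
    (hg : MDifferentiableAt (modelZ n) 𝓘(ℝ, ℝ) g z) :
    HasDerivAt (fun s : ℝ => g (s +ᵥ z)) (-fieldApply ζ.fundField g z) 0 := by
  have hgd : MDifferentiableAt (modelZ n) 𝓘(ℝ, ℝ) g ((0 : ℝ) +ᵥ z) := by rwa [zero_vadd]
  have h2 := hasMFDerivAt_iff_hasFDerivAt.1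
    (hgd.hasMFDerivAt.comp (0 : ℝ) (ζ.mdiff_orbit z 0).hasMFDerivAt)
  have h3 := HasFDerivAt.hasDerivAt (𝕜 := ℝ) (F := ℝ) (f := fun s : ℝ => g (s +ᵥ z)) h2
  have aux : ∀ (w : Z) (v : EuclideanSpace ℝ (Fin n) × ℝ), w = z →
      (mfderiv (modelZ n) 𝓘(ℝ, ℝ) g w v : ℝ) = (mfderiv (modelZ n) 𝓘(ℝ, ℝ) g z v : ℝ) := by
    rintro w v rfl; rfl
  convert h3 using 1
  have h4 : fieldApply ζ.fundField g z =
    (mfderiv (modelZ n) 𝓘(ℝ, ℝ) g z (-(mfderiv 𝓘(ℝ, ℝ) (modelZ n) (fun r : ℝ => r +ᵥ z) 0 (1 : ℝ) :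
      EuclideanSpace ℝ (Fin n) × ℝ) : EuclideanSpace ℝ (Fin n) × ℝ) : ℝ) := by
    have h5 := (mfderiv 𝓘(ℝ, ℝ) (modelZ n) (fun r : ℝ => r +ᵥ z) 0).map_neg (1 : ℝ)
    have h6 : ζ.fundField z = -(mfderiv 𝓘(ℝ, ℝ) (modelZ n) (fun r : ℝ => r +ᵥ z) 0 (1 : ℝ) :
      EuclideanSpace ℝ (Fin n) × ℝ) := h5
    unfold fieldApply
    rw [h6]; rfl
  rw [h4]
  refine (congrArg Neg.neg ((mfderiv (modelZ n) 𝓘(ℝ, ℝ) g z).map_neg _)).trans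
    ((neg_neg _).trans ?_)
  exact (aux _ _ (zero_vadd ℝ z)).symm

theorem const_along_fibres (ζ : AVBundle n M Z) {g : Z → ℝ}
    (hg : ContMDiff (modelZ n) 𝓘(ℝ, ℝ) ∞ g) (h0 : ∀ z, fieldApply ζ.fundField g z = 0)
    (r : ℝ) (z : Z) : g (r +ᵥ z) = g z := by
  have hd : ∀ r : ℝ, HasDerivAt (fun r : ℝ => g (r +ᵥ z)) 0 r := by
    intro r
    have h1 := ζ.hasDerivAt_orbit (hg.mdifferentiableAt (x := r +ᵥ z) (by simp))
    rw [h0, neg_zero] at h1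
    have h5 : HasDerivAt (fun s : ℝ => s - r) 1 r := (hasDerivAt_id r).sub_const r
    have h6 : HasDerivAt (fun s : ℝ => g (s +ᵥ (r +ᵥ z))) 0 (r - r) := by rwa [sub_self]
    have h7 := HasDerivAt.comp (h := fun s : ℝ => s - r) r h6 h5
    simpa [Function.comp_def, vadd_vadd] using h7
  have := is_const_of_deriv_eq_zero (fun r => (hd r).differentiableAt)
    (fun r => (hd r).deriv) r 0
  simpa using this

theorem fundField_ne_zero (ζ : AVBundle n M Z) (z : Z) : ζ.fundField z ≠ 0 := by
  intro h0
  obtain ⟨U, e, hU, hm, hs, ht, h1, h2, hc, -⟩ := ζ.exists_triv (ζ.proj z)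
  have hz : z ∈ e.source := by rw [hs]; exact hm
  have h3 : ContMDiffAt (modelZ n) 𝓘(ℝ, ℝ) ∞ (fun w => (e w).2) z :=
    contMDiffAt_snd.comp z ((hc z hz).contMDiffAt (e.open_source.mem_nhds hz))
  have h4 := ζ.hasDerivAt_orbit (h3.mdifferentiableAt (by simp))
  have h5 : fieldApply ζ.fundField (fun w => (e w).2) z = 0 := by
    unfold fieldApply; rw [h0]; exact map_zero _
  rw [h5, neg_zero] at h4
  have h6 : (fun s : ℝ => (e (s +ᵥ z)).2) = fun s => s + (e z).2 := by
    ext s; exact h2 s z hz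
  rw [h6] at h4
  have h7 : HasDerivAt (fun s : ℝ => s + (e z).2) 1 0 := (hasDerivAt_id (0 : ℝ)).add_const _
  exact one_ne_zero (h7.unique h4)

variable [IsManifold (modelZ n) ∞ Z]

theorem smooth_fundField (ζ : AVBundle n M Z) : SmoothField ζ.fundField := by
  have h0 : ContMDiff (modelZ n) (modelZ n).tangent ∞
      (fun z : Z => (⟨z, 0⟩ : TangentBundle (modelZ n) Z)) := Bundle.contMDiff_zeroSection _ _
  have h1 : ContMDiff (modelZ n) (𝓘(ℝ, ℝ)).tangent ∞
      (fun _ : Z => (⟨0, (-1 : ℝ)⟩ : TangentBundle 𝓘(ℝ, ℝ) ℝ)) := contMDiff_const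
  have h2 := contMDiff_equivTangentBundleProd_symm (I := 𝓘(ℝ, ℝ)) (M := ℝ) (I' := modelZ n)
    (M' := Z) (n := ∞)
  have h3 := ContMDiff.contMDiff_tangentMap (m := ∞) ζ.contMDiff_vadd (by simp)
  have h := (h3.comp h2).comp (h1.prodMk h0)
  unfold SmoothField
  refine h.congr fun z => ?_
  have hd : MDifferentiableAt (𝓘(ℝ, ℝ).prod (modelZ n)) (modelZ n)
        (fun p : ℝ × Z => p.1 +ᵥ p.2) (0, z) := ζ.contMDiff_vadd.mdifferentiableAt (by simp)
  have aux : ∀ (w : Z) (v v' : EuclideanSpace ℝ (Fin n) × ℝ), w = z → v' = v →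
      (⟨z, v⟩ : TangentBundle (modelZ n) Z) = ⟨w, v'⟩ := by
    rintro w v v' rfl rfl; rfl
  refine aux _ _ _ (zero_vadd ℝ z) ?_
  refine (mfderiv_prod_eq_add_apply hd).trans ?_
  refine Eq.trans (congrArg₂ (· + ·) rfl (map_zero _)) (add_zero _)

end basic
end AVBundle

namespace AVBundle

section operators

variable {n : ℕ} {M Z : Type*} [TopologicalSpace M]
    [ChartedSpace (EuclideanSpace ℝ (Fin n)) M] [TopologicalSpace Z]
    [ChartedSpace (ModelProd (EuclideanSpace ℝ (Fin n)) ℝ) Z] [AddAction ℝ Z]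
    [IsManifold (modelZ n) ∞ Z]

/-- The invariant vector fields on `Z`: smooth `X` with `[X_Z, X] = 0`. These are the sections of
the Atiyah bundle `T̃Z = TZ/ℝ` over `M`, i.e. the affine derivations of the sections of `Z`. -/
noncomputable def invariantFields (ζ : AVBundle n M Z) :
    Submodule ℝ (∀ z : Z, TangentSpace (modelZ n) z) where
  carrier := {X | SmoothField X ∧ mlieBracket (modelZ n) ζ.fundField X = 0}
  zero_mem' := ⟨SmoothField.zero, mlieBracket_zero_right⟩
  add_mem' := by
    rintro X Y ⟨hX, hX'⟩ ⟨hY, hY'⟩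
    exact ⟨hX.add hY, by rw [hX.bracket_add hY, hX', hY', add_zero]⟩
  smul_mem' := by
    rintro c X ⟨hX, hX'⟩
    exact ⟨hX.const_smul c, by rw [hX.bracket_const_smul, hX', smul_zero]⟩

theorem bracket_mem_invariantFields (ζ : AVBundle n M Z)
    {X Y : ∀ z : Z, TangentSpace (modelZ n) z} (hX : X ∈ ζ.invariantFields)
    (hY : Y ∈ ζ.invariantFields) : mlieBracket (modelZ n) X Y ∈ ζ.invariantFields := by
  refine ⟨hX.1.bracket hY.1, ?_⟩
  rw [ζ.smooth_fundField.jacobi hX.1 hY.1, hX.2, hY.2, mlieBracket_zero_left,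
    mlieBracket_zero_right, add_zero]

/-- The sections of the bundle `L̃Z` over `M`. Such a section is a first-order differential
operator `D = X + h` on `Z`, `D(F) = X(F) + h F`, encoded as the pair `(X, h)`, where the function
`h` is basic (`X_Z(h) = 0`) and `[X, X_Z] = h X_Z`. In affine coordinates,
`D = f_a(x) ∂_{x^a} - (α(x) s + β(x)) ∂_s + α(x)`. -/
noncomputable def affineOperators (ζ : AVBundle n M Z) :
    Submodule ℝ ((∀ z : Z, TangentSpace (modelZ n) z) × (Z → ℝ)) where
  carrier := {D | SmoothField D.1 ∧ ContMDiff (modelZ n) 𝓘(ℝ, ℝ) ∞ D.2 ∧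
    fieldApply ζ.fundField D.2 = 0 ∧
    mlieBracket (modelZ n) D.1 ζ.fundField = D.2 • ζ.fundField}
  zero_mem' := by
    refine ⟨SmoothField.zero, contMDiff_const, ?_, ?_⟩
    · exact fieldApply_const _ 0
    · refine mlieBracket_zero_left.trans ?_
      ext1 z; simp
  add_mem' := by
    rintro D D' ⟨h1, h2, h3, h4⟩ ⟨h1', h2', h3', h4'⟩
    refine ⟨h1.add h1', h2.add h2', ?_, ?_⟩
    · exact (fieldApply_add _ h2 h2').trans (by rw [h3, h3', add_zero])
    · change mlieBracket (modelZ n) (D.1 + D'.1) ζ.fundField = (D.2 + D'.2) • ζ.fundField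
      rw [mlieBracket_swap, h1.bracket_add h1', neg_add, ← mlieBracket_swap,
        ← mlieBracket_swap, h4, h4', add_smul]
  smul_mem' := by
    rintro c D ⟨h1, h2, h3, h4⟩
    refine ⟨h1.const_smul c, (contMDiff_const.mul h2 : ContMDiff (modelZ n) 𝓘(ℝ, ℝ) ∞ (fun z => c * D.2 z)), ?_, ?_⟩
    · exact (fieldApply_const_smul _ h2 c).trans (by rw [h3, smul_zero])
    · change mlieBracket (modelZ n) (c • D.1) ζ.fundField = (c • D.2) • ζ.fundField
      rw [mlieBracket_swap, h1.bracket_const_smul, ← smul_neg, ← mlieBracket_swap, h4, smul_assoc]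

/-- The commutator `[X + h, X' + h'] = [X, X'] + (X(h') - X'(h))` of first-order differential
operators on `Z`. -/
noncomputable def operatorBracket (D D' : (∀ z : Z, TangentSpace (modelZ n) z) × (Z → ℝ)) :
    (∀ z : Z, TangentSpace (modelZ n) z) × (Z → ℝ) :=
  (mlieBracket (modelZ n) D.1 D'.1, fieldApply D.1 D'.2 - fieldApply D'.1 D.2)

theorem fundField_apply_apply (ζ : AVBundle n M Z)
    {D : (∀ z : Z, TangentSpace (modelZ n) z) × (Z → ℝ)} (hD : D ∈ ζ.affineOperators)
    {f : Z → ℝ} (hf : ContMDiff (modelZ n) 𝓘(ℝ, ℝ) ∞ f)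
    (hf0 : fieldApply ζ.fundField f = 0) :
    fieldApply ζ.fundField (fieldApply D.1 f) = 0 := by
  obtain ⟨h1, h2, h3, h4⟩ := hD
  have hX := ζ.smooth_fundField
  have hs : mlieBracket (modelZ n) ζ.fundField ζ.fundField = 0 := mlieBracket_self
  have hj := hX.jacobi h1 (hX.smul hf)
  have e1 : mlieBracket (modelZ n) D.1 (f • ζ.fundField) =
      (fieldApply D.1 f + f * D.2) • ζ.fundField := by
    rw [hX.bracket_smul hf, h4, add_smul, mul_smul]
  have e2 : mlieBracket (modelZ n) ζ.fundField (f • ζ.fundField) = 0 := by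
    rw [hX.bracket_smul hf, hf0, hs, zero_smul, smul_zero, add_zero]
  have e3 : mlieBracket (modelZ n) ζ.fundField D.1 = (-D.2) • ζ.fundField := by
    rw [mlieBracket_swap, h4, neg_smul]
  have s1 := h1.fieldApply hf
  have hn : ContMDiff (modelZ n) 𝓘(ℝ, ℝ) ∞ (-D.2) := h2.neg
  have e4 : mlieBracket (modelZ n) ((-D.2) • ζ.fundField) (f • ζ.fundField) = 0 := by
    rw [hX.bracket_smul hf, mlieBracket_swap, hX.bracket_smul hn, hs, fieldApply_smul, hf0]
    have : fieldApply ζ.fundField (-D.2) = 0 := by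
      have := fieldApply_const_smul ζ.fundField h2 (-1)
      rw [h3] at this; simpa using this
    rw [this]; simp
  rw [e1, e2, e3, e4, mlieBracket_zero_right, add_zero,
    hX.bracket_smul (s1.add (hf.mul h2)), hs, smul_zero, add_zero] at hj
  have e5 : fieldApply ζ.fundField (fieldApply D.1 f + f * D.2) = 0 := by
    ext z
    have := congrFun hj z
    simpa [ζ.fundField_ne_zero z] using this
  have e6 : fieldApply ζ.fundField (f * D.2) = 0 := by
    rw [fieldApply_mul _ hf h2, h3, hf0]; simp
  rwa [fieldApply_add _ s1 (hf.mul h2), e6, add_zero] at e5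

theorem operatorBracket_mem (ζ : AVBundle n M Z)
    {D D' : (∀ z : Z, TangentSpace (modelZ n) z) × (Z → ℝ)} (hD : D ∈ ζ.affineOperators)
    (hD' : D' ∈ ζ.affineOperators) : operatorBracket D D' ∈ ζ.affineOperators := by
  have k := ζ.fundField_apply_apply hD hD'.2.1 hD'.2.2.1
  have k' := ζ.fundField_apply_apply hD' hD.2.1 hD.2.2.1
  obtain ⟨h1, h2, h3, h4⟩ := hD
  obtain ⟨h1', h2', h3', h4'⟩ := hD'
  have hX := ζ.smooth_fundField
  have s1 := h1.fieldApply h2'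
  have s2 := h1'.fieldApply h2
  refine ⟨h1.bracket h1', s1.sub s2, ?_, ?_⟩
  · have e : fieldApply D.1 D'.2 - fieldApply D'.1 D.2 =
        fieldApply D.1 D'.2 + (-1 : ℝ) • fieldApply D'.1 D.2 := by
      rw [neg_one_smul, sub_eq_add_neg]
    change fieldApply _ (fieldApply D.1 D'.2 - fieldApply D'.1 D.2) = 0
    have s3 : ContMDiff (modelZ n) 𝓘(ℝ, ℝ) ∞ ((-1 : ℝ) • fieldApply D'.1 D.2) :=
      (contMDiff_const.mul s2 :
        ContMDiff (modelZ n) 𝓘(ℝ, ℝ) ∞ (fun z => (-1 : ℝ) * fieldApply D'.1 D.2 z))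
    rw [e, fieldApply_add _ s1 s3, fieldApply_const_smul _ s2, k, k']
    simp
  · change mlieBracket (modelZ n) (mlieBracket (modelZ n) D.1 D'.1) ζ.fundField =
      (fieldApply D.1 D'.2 - fieldApply D'.1 D.2) • ζ.fundField
    have hj := h1.jacobi h1' hX
    rw [h4, h4', hX.bracket_smul h2', hX.bracket_smul h2, h4, h4'] at hj
    have hj' := sub_eq_of_eq_add hj
    rw [sub_smul]
    have hc : D'.2 • D.2 • ζ.fundField = D.2 • D'.2 • ζ.fundField := by
      rw [smul_smul, smul_smul, mul_comm]
    rw [hc] at hj'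
    rw [← hj']
    abel

end operators
end AVBundle

universe u v

/-- A Lie algebroid over `M`, presented by its fibres, its space of smooth sections with the
evaluation of sections at points, the bracket of sections, and the anchor, written as the
directional derivative `f ↦ ρ(v)(f)` along `ρ(v)`. -/
structure LieAlgebroidData (n : ℕ) (M : Type u) [TopologicalSpace M]
    [ChartedSpace (EuclideanSpace ℝ (Fin n)) M] where
  Fib : M → Type v
  [fibGroup : ∀ m, AddCommGroup (Fib m)]
  [fibModule : ∀ m, Module ℝ (Fib m)]
  Sec : Type v
  ev : ∀ m, Sec → Fib m
  bracket : Sec → Sec → Sec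
  anchor : ∀ m, Fib m → C^∞⟮modelM n, M; ℝ⟯ → ℝ

namespace LieAlgebroidData

attribute [instance] LieAlgebroidData.fibGroup LieAlgebroidData.fibModule

section

variable {n : ℕ} {M : Type*} [TopologicalSpace M] [ChartedSpace (EuclideanSpace ℝ (Fin n)) M]
  (E : LieAlgebroidData.{_, v} n M)

/-- Families `m ↦ P_m` with `P_m` in the exterior algebra of the fibre `E_m`. -/
abbrev Family := ∀ m, ExteriorAlgebra ℝ (E.Fib m)

/-- A function on `M` as a family of degree `0`. -/
noncomputable def funFamily (f : C^∞⟮modelM n, M; ℝ⟯) : E.Family := fun m => algebraMap ℝ _ (f m)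

/-- A section of `E` as a family of degree `1`. -/
def secFamily (X : E.Sec) : E.Family := fun m => ExteriorAlgebra.ι ℝ (E.ev m X)

/-- The families that are globally finite sums of wedge products of smooth functions and
sections. -/
def polyFamilies : Subalgebra ℝ E.Family :=
  Algebra.adjoin ℝ (Set.range E.funFamily ∪ Set.range E.secFamily)

/-- The Grassmann algebra `A(E) = ⨁ₙ Sec(⋀ⁿ E)`: a family is smooth if, near every point, it is a
finite sum of wedge products of smooth functions and smooth sections of `E`. -/
def grassmann : Subalgebra ℝ E.Family where
  carrier := {P | ∀ m, ∃ Q ∈ E.polyFamilies, ∀ᶠ x in 𝓝 m, P x = Q x}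
  mul_mem' := by
    intro P P' h h' m
    obtain ⟨Q, hQ, e⟩ := h m
    obtain ⟨Q', hQ', e'⟩ := h' m
    refine ⟨Q * Q', mul_mem hQ hQ', ?_⟩
    filter_upwards [e, e'] with x hx hx'
    rw [Pi.mul_apply, Pi.mul_apply, hx, hx']
  add_mem' := by
    intro P P' h h' m
    obtain ⟨Q, hQ, e⟩ := h m
    obtain ⟨Q', hQ', e'⟩ := h' m
    refine ⟨Q + Q', add_mem hQ hQ', ?_⟩
    filter_upwards [e, e'] with x hx hx'
    rw [Pi.add_apply, Pi.add_apply, hx, hx']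
  algebraMap_mem' r := fun _ => ⟨_, E.polyFamilies.algebraMap_mem r, Filter.Eventually.of_forall
    fun _ => rfl⟩

theorem mem_grassmann_of_mem_poly {P : E.Family} (h : P ∈ E.polyFamilies) : P ∈ E.grassmann :=
  fun _ => ⟨P, h, Filter.Eventually.of_forall fun _ => rfl⟩

/-- The type of smooth sections of the exterior algebra bundle `⋀ E`. -/
abbrev Multi : Type _ := ↥E.grassmann




/-- Smooth functions on `M` as elements of `A⁰(E)`. -/
noncomputable def ofFun (f : C^∞⟮modelM n, M; ℝ⟯) : E.Multi :=
  ⟨E.funFamily f, E.mem_grassmann_of_mem_poly (Algebra.subset_adjoin (Or.inl ⟨f, rfl⟩))⟩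

/-- Smooth sections of `E` as elements of `A¹(E)`. -/
def ofSec (X : E.Sec) : E.Multi :=
  ⟨E.secFamily X, E.mem_grassmann_of_mem_poly (Algebra.subset_adjoin (Or.inr ⟨X, rfl⟩))⟩

/-- `Aᵖ(E) = Sec(⋀ᵖ E)`. -/
def degree (p : ℕ) : Submodule ℝ E.Multi where
  carrier := {P | ∀ m, P.1 m ∈ ⋀[ℝ]^p (E.Fib m)}
  zero_mem' := fun m => Submodule.zero_mem (⋀[ℝ]^p (E.Fib m))
  add_mem' h h' := fun m => Submodule.add_mem (⋀[ℝ]^p (E.Fib m)) (h m) (h' m)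
  smul_mem' c _ h := fun m => Submodule.smul_mem (⋀[ℝ]^p (E.Fib m)) c (h m)

/-- The Schouten bracket of the Lie algebroid `E`: the graded (Gerstenhaber) bracket on `A(E)`
extending the Lie bracket of sections and the action of sections on functions through the
anchor. -/
structure IsSchoutenBracket (S : E.Multi →ₗ[ℝ] E.Multi →ₗ[ℝ] E.Multi) : Prop where
  fun_fun : ∀ f g, S (E.ofFun f) (E.ofFun g) = 0
  sec_fun : ∀ X f m, (S (E.ofSec X) (E.ofFun f)).1 m = algebraMap ℝ _ (E.anchor m (E.ev m X) f)
  sec_sec : ∀ X Y, S (E.ofSec X) (E.ofSec Y) = E.ofSec (E.bracket X Y)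
  degree : ∀ p q r P Q, P ∈ E.degree p → Q ∈ E.degree q → p + q = r + 1 → S P Q ∈ E.degree r
  antisymm : ∀ p q P Q, P ∈ E.degree p → Q ∈ E.degree q →
    S P Q = -((-1 : ℝ) ^ ((p + 1) * (q + 1)) • S Q P)
  leibniz : ∀ p q P Q R, P ∈ E.degree p → Q ∈ E.degree q →
    S P (Q * R) = S P Q * R + (-1 : ℝ) ^ ((p + 1) * q) • (Q * S P R)

/-- The Schouten bracket `⟦P, Q⟧_E` of `E`. -/
noncomputable def schouten : E.Multi →ₗ[ℝ] E.Multi →ₗ[ℝ] E.Multi :=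
  Classical.epsilon E.IsSchoutenBracket

/-- A smooth `1`-form on `E`, i.e. a smooth section of the dual bundle. -/
def OneForm := {φ : ∀ m, Module.Dual ℝ (E.Fib m) //
  ∀ X : E.Sec, ∃ f : C^∞⟮modelM n, M; ℝ⟯, ∀ m, φ m (E.ev m X) = f m}

/-- Contraction of a family with a family of covectors,
`i_φ (X ∧ Y) = φ(X) Y - X ∧ i_φ Y` for `X` of degree `1`. -/
noncomputable def contractFamily (φ : ∀ m, Module.Dual ℝ (E.Fib m)) : E.Family →ₗ[ℝ] E.Family where
  toFun P m := CliffordAlgebra.contractLeft (φ m) (P m)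
  map_add' P Q := by ext m; exact LinearMap.map_add _ _ _
  map_smul' c P := by ext m; exact LinearMap.map_smul _ _ _

theorem contractFamily_mem_poly (φ : E.OneForm) {P : E.Family} (hP : P ∈ E.polyFamilies) :
    E.contractFamily φ.1 P ∈ E.polyFamilies := by
  rw [polyFamilies, ← Subalgebra.mem_toSubmodule, Algebra.adjoin_eq_span] at hP
  induction hP using Submodule.span_induction with
  | zero => rw [map_zero]; exact zero_mem _
  | add x y _ _ hx hy => rw [map_add]; exact add_mem hx hy
  | smul c x _ hx => rw [map_smul]; exact Subalgebra.smul_mem _ hx c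
  | mem x hx =>
    have key : x ∈ E.polyFamilies ∧ E.contractFamily φ.1 x ∈ E.polyFamilies := by
      induction hx using Submonoid.closure_induction_left with
      | one =>
        refine ⟨one_mem _, ?_⟩
        have : E.contractFamily φ.1 1 = 0 := by
          ext m; exact CliffordAlgebra.contractLeft_one (d := φ.1 m) _
        rw [this]; exact zero_mem _
      | mul_left s hs y hy ih =>
        refine ⟨mul_mem (Algebra.subset_adjoin hs) ih.1, ?_⟩
        rcases hs with ⟨f, rfl⟩ | ⟨X, rfl⟩
        · have : E.contractFamily φ.1 (E.funFamily f * y) =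
              E.funFamily f * E.contractFamily φ.1 y := by
            ext m; exact CliffordAlgebra.contractLeft_algebraMap_mul (d := φ.1 m) _ _
          rw [this]
          exact mul_mem (Algebra.subset_adjoin (Or.inl ⟨f, rfl⟩)) ih.2
        · obtain ⟨f, hf⟩ := φ.2 X
          have : E.contractFamily φ.1 (E.secFamily X * y) =
              E.funFamily f * y - E.secFamily X * E.contractFamily φ.1 y := by
            ext m
            refine (CliffordAlgebra.contractLeft_ι_mul (d := φ.1 m) _ _).trans ?_
            rw [hf m, Algebra.smul_def]; rfl
          rw [this]
          exact sub_mem (mul_mem (Algebra.subset_adjoin (Or.inl ⟨f, rfl⟩)) ih.1)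
            (mul_mem (Algebra.subset_adjoin (Or.inr ⟨X, rfl⟩)) ih.2)
    exact key.2

theorem contractFamily_mem (φ : E.OneForm) {P : E.Family} (hP : P ∈ E.grassmann) :
    E.contractFamily φ.1 P ∈ E.grassmann := by
  intro m
  obtain ⟨Q, hQ, e⟩ := hP m
  refine ⟨E.contractFamily φ.1 Q, E.contractFamily_mem_poly φ hQ, ?_⟩
  filter_upwards [e] with x hx
  exact congrArg (CliffordAlgebra.contractLeft (φ.1 x)) hx

/-- The contraction `i_φ : A(E) → A(E)` with a `1`-form `φ`. -/
noncomputable def contract (φ : E.OneForm) : E.Multi →ₗ[ℝ] E.Multi where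
  toFun P := ⟨E.contractFamily φ.1 P.1, E.contractFamily_mem φ P.2⟩
  map_add' P Q := Subtype.ext ((E.contractFamily φ.1).map_add P.1 Q.1)
  map_smul' c P := Subtype.ext ((E.contractFamily φ.1).map_smul c P.1)

/-- The operator `Q ↦ P ∧ Q` on `A(E)`. -/
noncomputable def wedgeLeft (P : E.Multi) : E.Multi →ₗ[ℝ] E.Multi where
  toFun Q := P * Q
  map_add' := mul_add P
  map_smul' c Q := mul_smul_comm c P Q

/-- The Schouten–Jacobi bracket of the Jacobi algebroid `(E, φ)` on `Aᵖ(E) × A^q(E)`: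
`⟦P, Q⟧^φ = ⟦P, Q⟧ + (p - 1) P ∧ i_φ Q - (-1)^{p-1} (q - 1) i_φ P ∧ Q`. -/
noncomputable def schoutenJacobi (φ : E.OneForm) (p q : ℕ) (P : E.Multi) :
    E.Multi →ₗ[ℝ] E.Multi :=
  E.schouten P + ((p : ℝ) - 1) • (E.wedgeLeft P).comp (E.contract φ) -
    ((-1 : ℝ) ^ (p + 1) * ((q : ℝ) - 1)) • E.wedgeLeft (E.contract φ P)

/-- A graded operator on `A(E)`, given by its restriction `d n` to each `Aⁿ(E)`, is a cohomology
operator if it is of degree `1` and squares to zero. -/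
def IsCohomologyOperator (d : ℕ → E.Multi →ₗ[ℝ] E.Multi) : Prop :=
  ∀ k, ∀ P ∈ E.degree k, d k P ∈ E.degree (k + 1) ∧ d (k + 1) (d k P) = 0

/-- The `k`-cocycles of a graded operator of degree `1`. -/
noncomputable def cocycles (d : ℕ → E.Multi →ₗ[ℝ] E.Multi) (k : ℕ) : Submodule ℝ E.Multi :=
  E.degree k ⊓ LinearMap.ker (d k)

/-- The `k`-coboundaries of a graded operator of degree `1`. -/
noncomputable def coboundaries (d : ℕ → E.Multi →ₗ[ℝ] E.Multi) : ℕ → Submodule ℝ E.Multi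
  | 0 => ⊥
  | k + 1 => (E.degree k).map (d k)

/-- The cohomology of a graded operator of degree `1`: cocycles modulo coboundaries, realized as
the image of the cocycles in the quotient by the coboundaries. -/
abbrev Cohomology (d : ℕ → E.Multi →ₗ[ℝ] E.Multi) (k : ℕ) : Type _ :=
  ↥((E.cocycles d k).map (E.coboundaries d k).mkQ)

/-- The value `P(α, β)` of a bivector on two covectors: `(X ∧ Y)(α, β) = α(X) β(Y) - α(Y) β(X)`. -/
noncomputable def evalBivector {m : M} (P : ExteriorAlgebra ℝ (E.Fib m))
    (α β : Module.Dual ℝ (E.Fib m)) : ℝ :=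
  ExteriorAlgebra.algebraMapInv
    (CliffordAlgebra.contractLeft β (CliffordAlgebra.contractLeft α P) :
      ExteriorAlgebra ℝ (E.Fib m))

end

end LieAlgebroidData

namespace AVBundle

section calculus

variable {n : ℕ} {M : Type u} {Z : Type v} [TopologicalSpace M]
    [ChartedSpace (EuclideanSpace ℝ (Fin n)) M] [TopologicalSpace Z]
    [ChartedSpace (ModelProd (EuclideanSpace ℝ (Fin n)) ℝ) Z] [AddAction ℝ Z]
    (ζ : AVBundle n M Z)

/-- The fibre `Z_m`. -/
abbrev fibre (m : M) : Type v := {z : Z // ζ.proj z = m}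

/-- A chosen point of the fibre `Z_m`. -/
noncomputable def basePoint (m : M) : ζ.fibre m := ⟨(ζ.exists_over m).choose,
  (ζ.exists_over m).choose_spec⟩

/-- Restriction of vector fields on `Z` to the fibre `Z_m`. -/
noncomputable def restrictField (m : M) : (∀ z : Z, TangentSpace (modelZ n) z) →ₗ[ℝ]
    (∀ z : ζ.fibre m, TangentSpace (modelZ n) z.1) where
  toFun X z := X z.1
  map_add' _ _ := rfl
  map_smul' _ _ := rfl

/-- Restriction of first-order differential operators `X + h` on `Z` to the fibre `Z_m`. -/
noncomputable def restrictOperator (m : M) :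
    ((∀ z : Z, TangentSpace (modelZ n) z) × (Z → ℝ)) →ₗ[ℝ]
    ((∀ z : ζ.fibre m, TangentSpace (modelZ n) z.1) × (ζ.fibre m → ℝ)) where
  toFun D := (ζ.restrictField m D.1, fun z => D.2 z.1)
  map_add' _ _ := rfl
  map_smul' _ _ := rfl

/-- The Lie algebroid `T̃Z` over `M` (the Atiyah algebroid of `Z`). Its fibre at `m` consists of the
restrictions to `Z_m` of invariant vector fields; the bracket is the bracket of vector fields; the
anchor is the projection to `M`. -/
noncomputable def tangentAlgebroid [IsManifold (modelZ n) ∞ Z] : LieAlgebroidData.{u, v} n M where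
  Fib m := ↥(ζ.invariantFields.map (ζ.restrictField m))
  Sec := ↥ζ.invariantFields
  ev m X := ⟨ζ.restrictField m X.1, Submodule.mem_map_of_mem X.2⟩
  bracket X Y := ⟨mlieBracket (modelZ n) X.1 Y.1, ζ.bracket_mem_invariantFields X.2 Y.2⟩
  anchor m v f := mvfderiv (modelZ n) (fun z => f (ζ.proj z)) (ζ.basePoint m).1
    (v.1 (ζ.basePoint m))

/-- The Lie algebroid `L̃Z` over `M`. Its fibre at `m` consists of the restrictions to `Z_m` of the
operators in `affineOperators`; the bracket is the commutator of operators; the anchor is the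
projection of the vector field part to `M`. -/
noncomputable def operatorAlgebroid [IsManifold (modelZ n) ∞ Z] : LieAlgebroidData.{u, v} n M where
  Fib m := ↥(ζ.affineOperators.map (ζ.restrictOperator m))
  Sec := ↥ζ.affineOperators
  ev m D := ⟨ζ.restrictOperator m D.1, Submodule.mem_map_of_mem D.2⟩
  bracket D D' := ⟨operatorBracket D.1 D'.1, ζ.operatorBracket_mem D.2 D'.2⟩
  anchor m v f := mvfderiv (modelZ n) (fun z => f (ζ.proj z)) (ζ.basePoint m).1
    (v.1.1 (ζ.basePoint m))

/-- The canonical closed `1`-form `φ⁰` on `L̃Z`: `φ⁰(X + h) = h`, i.e. `[X, X_Z] = φ⁰ X_Z`. -/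
noncomputable def phiZero [IsManifold (modelZ n) ∞ Z] : ζ.operatorAlgebroid.OneForm :=
  ⟨fun m => ((LinearMap.proj (ζ.basePoint m)).comp
      (LinearMap.snd ℝ (∀ z : ζ.fibre m, TangentSpace (modelZ n) z.1) (ζ.fibre m → ℝ))).comp
      (ζ.affineOperators.map (ζ.restrictOperator m)).subtype, by
    rintro ⟨D, hD⟩
    have hc := ζ.const_along_fibres hD.2.1 (fun z => congrFun hD.2.2.1 z)
    obtain ⟨f, hf⟩ := ζ.exists_descend hD.2.1 hc
    refine ⟨f, fun m => ?_⟩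
    have h := hf (ζ.basePoint m).1
    rw [(ζ.basePoint m).2] at h
    exact h.symm⟩

/-- Smooth sections of `Z`. -/
structure Section where
  toFun : M → Z
  proj_toFun : ∀ m, ζ.proj (toFun m) = m
  smooth : ContMDiff (modelM n) (modelZ n) ∞ toFun

/-- Sections of `Z` can be translated by smooth functions on `M`. -/
noncomputable instance : VAdd C^∞⟮modelM n, M; ℝ⟯ ζ.Section where
  vadd f σ := ⟨fun m => f m +ᵥ σ.toFun m, fun m => by rw [ζ.proj_vadd, σ.proj_toFun],
    ζ.contMDiff_vadd.comp (f.contMDiff.prodMk σ.smooth)⟩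

/-- The difference `z - w` of two points of the same fibre: the real `r` with `r +ᵥ w = z`. -/
noncomputable def fibreSub (z w : Z) : ℝ := Classical.epsilon fun r : ℝ => r +ᵥ w = z

variable {ζ} in
/-- The affine function `F_σ(z) = σ - z` on `Z` defined by a section `σ`. -/
noncomputable def Section.F (σ : ζ.Section) (z : Z) : ℝ := fibreSub (σ.toFun (ζ.proj z)) z

variable {ζ} in
/-- The covector on `T̃Z_m` defined by a section `σ`: the action `X ↦ X(σ)(m)`, where
`X(σ) ∘ proj = X(F_σ)`. -/
noncomputable def Section.differential [IsManifold (modelZ n) ∞ Z] (σ : ζ.Section) (m : M) :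
    Module.Dual ℝ (ζ.tangentAlgebroid.Fib m) where
  toFun v := mvfderiv (modelZ n) σ.F (σ.toFun m) (v.1 ⟨σ.toFun m, σ.proj_toFun m⟩)
  map_add' _ _ := map_add (mvfderiv (modelZ n) σ.F (σ.toFun m)) _ _
  map_smul' c _ := map_smul (mvfderiv (modelZ n) σ.F (σ.toFun m)) c _

variable {ζ} in
/-- The covector on `L̃Z_m` defined by a section `σ`: the action `D ↦ D(σ)(m)`, where
`D(σ) ∘ proj = D(F_σ)`, `D(F_σ) = X(F_σ) + h F_σ` for `D = X + h`. -/
noncomputable def Section.jet [IsManifold (modelZ n) ∞ Z] (σ : ζ.Section) (m : M) :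
    Module.Dual ℝ (ζ.operatorAlgebroid.Fib m) where
  toFun v := mvfderiv (modelZ n) σ.F (σ.toFun m) (v.1.1 ⟨σ.toFun m, σ.proj_toFun m⟩) +
    v.1.2 ⟨σ.toFun m, σ.proj_toFun m⟩ * σ.F (σ.toFun m)
  map_add' _ _ := by
    refine Eq.trans (congrArg₂ (· + ·)
      (map_add (mvfderiv (modelZ n) σ.F (σ.toFun m)) _ _) (add_mul _ _ _)) (add_add_add_comm _ _ _ _)
  map_smul' c _ := by
    refine Eq.trans (congrArg₂ (· + ·)
      (map_smul (mvfderiv (modelZ n) σ.F (σ.toFun m)) c _) (mul_assoc c _ _)) (mul_add c _ _).symm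

/-- A map from sections of `Z` to functions on `M` is affine if it has a linear part. -/
def IsAffine (D : ζ.Section → C^∞⟮modelM n, M; ℝ⟯) : Prop :=
  ∃ L : C^∞⟮modelM n, M; ℝ⟯ →ₗ[ℝ] C^∞⟮modelM n, M; ℝ⟯, ∀ f σ, D (f +ᵥ σ) = D σ + L f

/-- Affine derivations: `D(σ)(m)` is an affine function of the differential of `σ` at `m`, that is
of the class of `σ` modulo `σ' ∼ σ ↔ d_m(σ' - σ) = 0`. -/
def IsAffineDerivation (D : ζ.Section → C^∞⟮modelM n, M; ℝ⟯) : Prop :=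
  ∃ v : ∀ m : M, TangentSpace (modelM n) m, ∀ (f : C^∞⟮modelM n, M; ℝ⟯) σ m,
    D (f +ᵥ σ) m = D σ m + mvfderiv (modelM n) f m (v m)

/-- Affine first-order differential operators: `D(σ)(m)` is an affine function of the first jet of
`σ` at `m`. -/
def IsAffineFirstOrder (D : ζ.Section → C^∞⟮modelM n, M; ℝ⟯) : Prop :=
  ∃ (v : ∀ m : M, TangentSpace (modelM n) m) (h : M → ℝ), ∀ (f : C^∞⟮modelM n, M; ℝ⟯) σ m,
    D (f +ᵥ σ) m = D σ m + (mvfderiv (modelM n) f m (v m) + h m * f m)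

/-- The linear part of `{σ, ·}`, for a bracket that is affine in the second argument. -/
noncomputable def linearPart (B : ζ.Section → ζ.Section → C^∞⟮modelM n, M; ℝ⟯) (σ : ζ.Section)
    (f : C^∞⟮modelM n, M; ℝ⟯) : C^∞⟮modelM n, M; ℝ⟯ := B σ (f +ᵥ σ) - B σ σ

/-- An affine Lie bracket on the sections of `Z` with values in `C^∞(M)`: a bi-affine
skew-symmetric map satisfying the Jacobi identity. -/
structure IsAffineLieBracket (B : ζ.Section → ζ.Section → C^∞⟮modelM n, M; ℝ⟯) : Prop where
  affine_left : ∀ σ', ζ.IsAffine fun σ => B σ σ'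
  affine_right : ∀ σ, ζ.IsAffine (B σ)
  skew : ∀ σ σ', B σ σ' = -B σ' σ
  jacobi : ∀ σ₁ σ₂ σ₃, ζ.linearPart B σ₁ (B σ₂ σ₃) + ζ.linearPart B σ₂ (B σ₃ σ₁) +
    ζ.linearPart B σ₃ (B σ₁ σ₂) = 0

/-- Aff-Poisson brackets. -/
def IsAffPoissonBracket (B : ζ.Section → ζ.Section → C^∞⟮modelM n, M; ℝ⟯) : Prop :=
  ζ.IsAffineLieBracket B ∧ ∀ σ, ζ.IsAffineDerivation (B σ)

/-- Aff-Jacobi brackets. -/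
def IsAffJacobiBracket (B : ζ.Section → ζ.Section → C^∞⟮modelM n, M; ℝ⟯) : Prop :=
  ζ.IsAffineLieBracket B ∧ ∀ σ, ζ.IsAffineFirstOrder (B σ)

variable [IsManifold (modelZ n) ∞ Z]

/-- `Λ ∈ Sec(⋀² T̃Z)` represents an aff-Poisson structure: the bracket
`{σ, σ'}_Λ = Λ(dσ, dσ')` of sections of `Z` is an aff-Poisson bracket. -/
def RepresentsAffPoisson (Λ : ζ.tangentAlgebroid.Multi) : Prop :=
  ∃ B : ζ.Section → ζ.Section → C^∞⟮modelM n, M; ℝ⟯,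
    (∀ σ σ' m, B σ σ' m =
      ζ.tangentAlgebroid.evalBivector (Λ.1 m) (σ.differential m) (σ'.differential m)) ∧
    ζ.IsAffPoissonBracket B

/-- `J ∈ Sec(⋀² L̃Z)` represents an aff-Jacobi structure: the bracket
`{σ, σ'}_J = J(jσ, jσ')` of sections of `Z` is an aff-Jacobi bracket. -/
def RepresentsAffJacobi (J : ζ.operatorAlgebroid.Multi) : Prop :=
  ∃ B : ζ.Section → ζ.Section → C^∞⟮modelM n, M; ℝ⟯,
    (∀ σ σ' m, B σ σ' m =
      ζ.operatorAlgebroid.evalBivector (J.1 m) (σ.jet m) (σ'.jet m)) ∧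
    ζ.IsAffJacobiBracket B

/-- `∂_Λ(Y) = ⟦Λ, Y⟧` on `A(T̃Z)`. -/
noncomputable def poissonDifferential (Λ : ζ.tangentAlgebroid.Multi) (_k : ℕ) :
    ζ.tangentAlgebroid.Multi →ₗ[ℝ] ζ.tangentAlgebroid.Multi :=
  ζ.tangentAlgebroid.schouten Λ

/-- `∂ᵗ_J(R) = ⟦J, R⟧^{φ⁰} + t i_{φ⁰}J ∧ R` for `J ∈ A²(L̃Z)` and `R ∈ Aᵏ(L̃Z)`. -/
noncomputable def jacobiDifferential (J : ζ.operatorAlgebroid.Multi) (t : ℝ) (k : ℕ) :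
    ζ.operatorAlgebroid.Multi →ₗ[ℝ] ζ.operatorAlgebroid.Multi :=
  ζ.operatorAlgebroid.schoutenJacobi ζ.phiZero 2 k J +
    t • ζ.operatorAlgebroid.wedgeLeft (ζ.operatorAlgebroid.contract ζ.phiZero J)

/-- The aff-Poisson cohomology of `Λ`. -/
abbrev AffPoissonCohomology (Λ : ζ.tangentAlgebroid.Multi) (k : ℕ) : Type _ :=
  ζ.tangentAlgebroid.Cohomology (ζ.poissonDifferential Λ) k

/-- The aff-Jacobi cohomology of `J`. -/
abbrev AffJacobiCohomology (J : ζ.operatorAlgebroid.Multi) (k : ℕ) : Type _ :=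
  ζ.operatorAlgebroid.Cohomology (ζ.jacobiDifferential J 0) k

/-- The aff-Lichnerowicz–Jacobi cohomology of `J`. -/
abbrev AffLichnerowiczJacobiCohomology (J : ζ.operatorAlgebroid.Multi) (k : ℕ) : Type _ :=
  ζ.operatorAlgebroid.Cohomology (ζ.jacobiDifferential J 1) k

end calculus

end AVBundle

/-! Both equivalences are instances of one statement about a Lie algebroid E with a closed 1-form φ,
on which every section σ of the AV-bundle acts as a 1-form ψ_σ that is closed for the differential
twisted by φ, with ψ_{f+σ} = ψ_σ + df + fφ (`IsAffineCalculus`). For the operator algebroid, φ = φ⁰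
and ψ_σ = jσ; for the tangent algebroid, φ = 0 and ψ_σ = dσ. For a bivector J everything is governed
by the trivector T = ⟦J,J⟧ + 2 J ∧ i_φJ (`jacobiSquare`).

T measures the failure of the Jacobi identity. A twisted closed form contracts a Schouten bracket by
a Leibniz rule with correction terms in φ (`contractRule`); applied three times, it shows that the
value of T on ψ_{σ₁}, ψ_{σ₂}, ψ_{σ₃} is twice the Jacobiator of {σ,σ'} = J(ψ_σ, ψ_{σ'})
(`contract_contract_contract_jacobiSquare`). The forms ψ_σ separate the vectors of each
finite-dimensional fibre, hence span its dual, so the Jacobi identity holds exactly when T = 0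
(`isAffineLieBracket_iff`). Affinity and the order condition hold for every bivector.

T also measures the failure of the differential to square to zero. With D_c(R) = ⟦J,R⟧ + J ∧ i_φR +
c i_φJ ∧ R one has 2 D_{c+1}D_c(R) = ⟦T,R⟧ + 2 T ∧ i_φR − c i_φT ∧ R (`twistedDifferential_sq`), and
the operator of the theorem is D_c in degree k with c = k − 1 + t. If T = 0, all squares vanish.
Conversely, in degree 0 with t = 1 the formula leaves ⟦T,f⟧ = 0 for all functions f. Then T is
killed by contraction with every df, so it lives on the kernel of the anchor; this kernel has rank
at most two, and there is no nonzero trivector on it (`eq_zero_of_bracket_fun`).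

The Schouten bracket is unique because derivations of the Grassmann algebra are determined by
functions and sections (`eq_of_derivation`); the same principle gives its graded Jacobi identity. It
exists because an explicit formula in a local frame has all the required properties at a point
(`exists_pointwiseSchouten`), and the result is smooth and global.

It remains to verify the calculus for the two algebroids. A global section σ, obtained by a
partition of unity, defines a flat connection. The horizontal lifts of coordinate fields, X_Z, and
−F_σX_Z + 1 then form a local frame of the operator algebroid dual to the coordinate differentials,
jσ and φ⁰ (`operator_frame`). The tangent algebroid is the kernel of φ⁰, and its axioms are pulled
back along the inclusion. -/

namespace ExteriorAlgebra

/-! ### Exterior algebra of a fibre: contractions, signs, degrees. -/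

section fibre

variable {V : Type*} [AddCommGroup V] [Module ℝ V]

/-- Contraction of a multivector with a covector. -/
noncomputable abbrev contr (d : Module.Dual ℝ V) : ExteriorAlgebra ℝ V →ₗ[ℝ] ExteriorAlgebra ℝ V :=
  CliffordAlgebra.contractLeft (Q := (0 : QuadraticForm ℝ V)) d

theorem contr_ι_mul (d : Module.Dual ℝ V) (v : V) (x : ExteriorAlgebra ℝ V) :
    contr d (ι ℝ v * x) = d v • x - ι ℝ v * contr d x :=
  CliffordAlgebra.contractLeft_ι_mul _ _ _

theorem contr_ι (d : Module.Dual ℝ V) (v : V) :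
    contr d (ι ℝ v) = algebraMap ℝ _ (d v) :=
  CliffordAlgebra.contractLeft_ι _ _ _

theorem contr_algebraMap (d : Module.Dual ℝ V) (r : ℝ) :
    contr d (algebraMap ℝ _ r) = 0 :=
  CliffordAlgebra.contractLeft_algebraMap _ _ _

theorem contr_comm (d d' : Module.Dual ℝ V) (x : ExteriorAlgebra ℝ V) :
    contr d (contr d' x) = -contr d' (contr d x) :=
  CliffordAlgebra.contractLeft_comm _ _ _

theorem contr_contr (d : Module.Dual ℝ V) (x : ExteriorAlgebra ℝ V) :
    contr d (contr d x) = 0 :=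
  CliffordAlgebra.contractLeft_contractLeft _ _

theorem ι_mem_one (v : V) : ι ℝ v ∈ ⋀[ℝ]^1 V := by
  simp [exteriorPower]

theorem mem_zero_iff {x : ExteriorAlgebra ℝ V} : x ∈ ⋀[ℝ]^0 V ↔ ∃ r : ℝ, algebraMap ℝ _ r = x := by
  rw [exteriorPower, pow_zero, Submodule.mem_one]

theorem mem_one_iff {x : ExteriorAlgebra ℝ V} : x ∈ ⋀[ℝ]^1 V ↔ ∃ v : V, ι ℝ v = x := by
  rw [exteriorPower, pow_one, LinearMap.mem_range]

theorem algebraMap_mem_zero (r : ℝ) : algebraMap ℝ (ExteriorAlgebra ℝ V) r ∈ ⋀[ℝ]^0 V :=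
  mem_zero_iff.2 ⟨r, rfl⟩

theorem mul_mem_pow {p q : ℕ} {x y : ExteriorAlgebra ℝ V} (hx : x ∈ ⋀[ℝ]^p V)
    (hy : y ∈ ⋀[ℝ]^q V) : x * y ∈ ⋀[ℝ]^(p + q) V := by
  rw [exteriorPower, pow_add]; exact Submodule.mul_mem_mul hx hy

theorem pow_induction {motive : ∀ p : ℕ, ∀ x : ExteriorAlgebra ℝ V, x ∈ ⋀[ℝ]^p V → Prop}
    (scalar : ∀ r, motive 0 (algebraMap ℝ _ r) (algebraMap_mem_zero r))
    (add : ∀ p x y hx hy, motive p x hx → motive p y hy → motive p (x + y) (add_mem hx hy))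
    (mul : ∀ p v x hx, motive p x hx → motive (p + 1) (ι ℝ v * x)
      (by rw [add_comm]; exact mul_mem_pow (ι_mem_one v) hx))
    {p : ℕ} {x : ExteriorAlgebra ℝ V} (hx : x ∈ ⋀[ℝ]^p V) : motive p x hx := by
  refine Submodule.pow_induction_on_left' (LinearMap.range (ι ℝ (M := V)))
    (C := fun n x h => motive n x h) scalar
    (fun x y i => add i x y) ?_ hx
  rintro _ ⟨v, rfl⟩ n x hx h
  exact mul n v x hx h

theorem ι_mul_comm_of_mem {p : ℕ} (v : V) {x : ExteriorAlgebra ℝ V} (hx : x ∈ ⋀[ℝ]^p V) :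
    ι ℝ v * x = (-1 : ℝ) ^ p • (x * ι ℝ v) := by
  induction hx using pow_induction with
  | scalar r => simp [Algebra.commutes]
  | add p x y hx hy ihx ihy => rw [mul_add, ihx, ihy, add_mul, smul_add]
  | mul p w x hx ih =>
    have h : ι ℝ v * ι ℝ w = -(ι ℝ w * ι ℝ v) := eq_neg_of_add_eq_zero_left (ι_add_mul_swap v w)
    rw [← mul_assoc, h, neg_mul, mul_assoc, ih, pow_succ, mul_smul_comm, mul_assoc]
    simp

/-- Graded commutativity of the exterior algebra. -/
theorem mul_comm_of_mem {p q : ℕ} {x y : ExteriorAlgebra ℝ V} (hx : x ∈ ⋀[ℝ]^p V)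
    (hy : y ∈ ⋀[ℝ]^q V) : x * y = (-1 : ℝ) ^ (p * q) • (y * x) := by
  induction hx using pow_induction with
  | scalar r => simp [Algebra.commutes]
  | add p x x' hx hx' ihx ihx' => rw [add_mul, ihx, ihx', mul_add, smul_add]
  | mul p w x hx ih =>
    rw [mul_assoc, ih, mul_smul_comm, ← mul_assoc, ι_mul_comm_of_mem w hy, smul_mul_assoc,
      smul_smul, ← pow_add, mul_assoc, add_mul, one_mul]

/-- The second conjunct repairs truncated subtraction: for p = 0 the bound p − 1 = 0 says nothing
about the vanishing of the contraction, which the induction needs when it passes from degree 0 to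
degree 1. -/
theorem contr_mem {p : ℕ} (d : Module.Dual ℝ V) {x : ExteriorAlgebra ℝ V} (hx : x ∈ ⋀[ℝ]^p V) :
    contr d x ∈ ⋀[ℝ]^(p - 1) V ∧ (p = 0 → contr d x = 0) := by
  induction hx using pow_induction with
  | scalar r => rw [contr_algebraMap]; exact ⟨zero_mem _, fun _ => rfl⟩
  | add p x y hx hy ihx ihy =>
    rw [map_add]
    exact ⟨add_mem ihx.1 ihy.1, fun h => by rw [ihx.2 h, ihy.2 h, add_zero]⟩
  | mul p w x hx ih =>
    rw [contr_ι_mul]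
    refine ⟨sub_mem (Submodule.smul_mem _ _ hx) ?_, fun h => by simp at h⟩
    rcases p with _ | p
    · rw [ih.2 rfl, mul_zero]; exact zero_mem _
    · have := mul_mem_pow (ι_mem_one w) ih.1
      simpa [add_comm] using this

theorem contr_mem_succ {p : ℕ} (d : Module.Dual ℝ V) {x : ExteriorAlgebra ℝ V}
    (hx : x ∈ ⋀[ℝ]^(p + 1) V) : contr d x ∈ ⋀[ℝ]^p V := (contr_mem d hx).1

theorem contr_mul {p : ℕ} (d : Module.Dual ℝ V) {x : ExteriorAlgebra ℝ V} (hx : x ∈ ⋀[ℝ]^p V)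
    (y : ExteriorAlgebra ℝ V) :
    contr d (x * y) = contr d x * y + (-1 : ℝ) ^ p • (x * contr d y) := by
  induction hx using pow_induction with
  | scalar r => simp [← Algebra.smul_def]
  | add p x x' hx hx' ihx ihx' =>
    rw [add_mul, map_add, ihx, ihx', map_add, add_mul, add_mul, smul_add]; abel
  | mul p w x hx ih =>
    rw [mul_assoc, contr_ι_mul, ih, contr_ι_mul, sub_mul, mul_add, mul_smul_comm, pow_succ,
      mul_assoc, mul_assoc, smul_mul_assoc]
    simp; abel

theorem involute_of_mem {p : ℕ} {x : ExteriorAlgebra ℝ V} (hx : x ∈ ⋀[ℝ]^p V) :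
    CliffordAlgebra.involute (Q := (0 : QuadraticForm ℝ V)) x = (-1 : ℝ) ^ p • x := by
  induction hx using pow_induction with
  | scalar r => rw [AlgHom.commutes]; simp
  | add p x x' hx hx' ihx ihx' => rw [map_add, ihx, ihx', smul_add]
  | mul p w x hx ih =>
    rw [map_mul, ih]
    have : CliffordAlgebra.involute (Q := (0 : QuadraticForm ℝ V)) (ι ℝ w) = -ι ℝ w :=
      CliffordAlgebra.involute_ι _
    rw [this, pow_succ]; simp

/-- The contraction has degree p − 1; the exponent p + 1 has the same parity and needs no case p =
0, where the contraction is zero. -/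
theorem involute_contr {p : ℕ} (d : Module.Dual ℝ V) {x : ExteriorAlgebra ℝ V}
    (hx : x ∈ ⋀[ℝ]^p V) :
    CliffordAlgebra.involute (Q := (0 : QuadraticForm ℝ V)) (contr d x) =
      (-1 : ℝ) ^ (p + 1) • contr d x := by
  rcases p with _ | p
  · rw [(contr_mem d hx).2 rfl]; simp
  · rw [involute_of_mem (contr_mem_succ d hx), pow_add, pow_add]; simp

/-- Euler's formula for the exterior algebra of a space with a dual generating system. -/
theorem sum_ι_mul_contr {κ : Type*} [Fintype κ] {e : κ → V} {θ : κ → Module.Dual ℝ V}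
    (h : ∀ v, v = ∑ i, θ i v • e i) {p : ℕ} {x : ExteriorAlgebra ℝ V} (hx : x ∈ ⋀[ℝ]^p V) :
    ∑ i, ι ℝ (e i) * contr (θ i) x = (p : ℝ) • x := by
  induction hx using pow_induction with
  | scalar r => simp
  | add p x x' hx hx' ihx ihx' =>
    simp only [map_add, mul_add, Finset.sum_add_distrib, ihx, ihx', smul_add]
  | mul p w x hx ih =>
    have h1 : ∀ i, ι ℝ (e i) * contr (θ i) (ι ℝ w * x) =
        ι ℝ (θ i w • e i) * x + ι ℝ w * (ι ℝ (e i) * contr (θ i) x) := by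
      intro i
      have h2 : ι ℝ (e i) * ι ℝ w = -(ι ℝ w * ι ℝ (e i)) :=
        eq_neg_of_add_eq_zero_left (ι_add_mul_swap _ _)
      rw [contr_ι_mul, mul_sub, ← mul_assoc, h2, map_smul, mul_smul_comm, smul_mul_assoc,
        neg_mul, mul_assoc, sub_neg_eq_add]
    simp only [h1, Finset.sum_add_distrib, ← Finset.sum_mul, ← Finset.mul_sum, ih, ← map_sum, ← h w]
    rw [mul_smul_comm, Nat.cast_succ, add_smul, one_smul, add_comm]

/-- The vectors e span, so dim V ≤ card κ < p and the dimension of the p-th exterior power is a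
vanishing binomial coefficient. -/
theorem pow_eq_zero_of_card_lt {κ : Type*} [Fintype κ] {e : κ → V} {θ : κ → Module.Dual ℝ V}
    (h : ∀ v, v = ∑ i, θ i v • e i) {p : ℕ} (hp : Fintype.card κ < p) {x : ExteriorAlgebra ℝ V}
    (hx : x ∈ ⋀[ℝ]^p V) : x = 0 := by
  have hs : Submodule.span ℝ (Set.range e) = ⊤ := by
    rw [eq_top_iff]
    intro v _
    rw [h v]
    exact Submodule.sum_mem _ fun i _ => Submodule.smul_mem _ _ (Submodule.subset_span ⟨i, rfl⟩)
  classical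
  have : Module.Finite ℝ V := ⟨⟨Finset.univ.image e, by simpa using hs⟩⟩
  have h1 : Module.finrank ℝ V ≤ Fintype.card κ := finrank_le_of_span_eq_top hs
  have h2 := exteriorPower.finrank_eq (R := ℝ) (M := V) p
  rw [Nat.choose_eq_zero_of_lt (by omega)] at h2
  have h3 : Subsingleton (⋀[ℝ]^p V) := Module.finrank_zero_iff.1 h2
  exact congrArg Subtype.val (Subsingleton.elim (⟨x, hx⟩ : ⋀[ℝ]^p V) 0)

theorem exteriorAlgebraMap_mem_pow {W : Type*} [AddCommGroup W] [Module ℝ W] (f : V →ₗ[ℝ] W)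
    {p : ℕ} {x : ExteriorAlgebra ℝ V} (hx : x ∈ ⋀[ℝ]^p V) : map f x ∈ ⋀[ℝ]^p W := by
  induction hx using pow_induction with
  | scalar r => rw [AlgHom.commutes]; exact algebraMap_mem_zero r
  | add p x x' hx hx' ihx ihx' => rw [map_add]; exact add_mem ihx ihx'
  | mul p w x hx ih =>
    rw [map_mul, map_apply_ι, add_comm]
    exact mul_mem_pow (ι_mem_one _) ih

/-- The component of degree `p` of a multivector. -/
noncomputable def component (p : ℕ) : ExteriorAlgebra ℝ V →ₗ[ℝ] ExteriorAlgebra ℝ V :=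
  GradedAlgebra.proj (fun i : ℕ => ⋀[ℝ]^i V) p

theorem component_mem (p : ℕ) (x : ExteriorAlgebra ℝ V) : component p x ∈ ⋀[ℝ]^p V :=
  SetLike.coe_mem _

theorem component_of_mem {p : ℕ} {x : ExteriorAlgebra ℝ V} (hx : x ∈ ⋀[ℝ]^p V) :
    component p x = x :=
  DirectSum.decompose_of_mem_same (fun i : ℕ => ⋀[ℝ]^i V) hx

theorem component_of_mem_ne {p q : ℕ} (hpq : p ≠ q) {x : ExteriorAlgebra ℝ V}
    (hx : x ∈ ⋀[ℝ]^p V) : component q x = 0 :=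
  DirectSum.decompose_of_mem_ne (fun i : ℕ => ⋀[ℝ]^i V) hx hpq

theorem eq_sum_component {N : ℕ} (hN : ∀ p, N ≤ p → ∀ x ∈ ⋀[ℝ]^p V, x = 0)
    (x : ExteriorAlgebra ℝ V) : x = ∑ p ∈ Finset.range N, component p x := by
  classical
  conv_lhs => rw [← DirectSum.sum_support_decompose (fun i : ℕ => ⋀[ℝ]^i V) x]
  refine Finset.sum_subset_zero_on_sdiff (fun i hi => ?_) (fun i hi => ?_) (fun _ _ => rfl)
  · by_contra hc
    rw [Finset.mem_range, not_lt] at hc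
    rw [DFinsupp.mem_support_toFun] at hi
    exact hi (Subtype.ext (hN i hc _ (SetLike.coe_mem _)))
  · rw [Finset.mem_sdiff, DFinsupp.mem_support_toFun, not_not] at hi
    exact congrArg Subtype.val hi.2

end fibre

end ExteriorAlgebra

/-! ### Lie algebroid axioms, derivations of the Grassmann algebra, homogeneous components. -/

namespace LieAlgebroidData

section

variable {n : ℕ} {M : Type*} [TopologicalSpace M] [ChartedSpace (EuclideanSpace ℝ (Fin n)) M]
  (E : LieAlgebroidData.{_, v} n M)

/-- The axioms of a Lie algebroid, for a base manifold with smooth bump functions. The local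
frames consist of coordinate sections and of at most two sections in the kernel of the anchor. -/
structure IsLieAlgebroid : Prop where
  bump : ∀ (m : M), ∀ U ∈ 𝓝 m, ∃ χ : C^∞⟮modelM n, M; ℝ⟯,
    (∀ᶠ x in 𝓝 m, χ x = 1) ∧ ∀ x ∉ U, χ x = 0
  exists_add_smul : ∀ (X Y : E.Sec) (f : C^∞⟮modelM n, M; ℝ⟯), ∃ W, ∀ m,
    E.ev m W = E.ev m X + f m • E.ev m Y
  anchor_add : ∀ m v w f, E.anchor m (v + w) f = E.anchor m v f + E.anchor m w f
  anchor_smul : ∀ m (c : ℝ) v f, E.anchor m (c • v) f = c * E.anchor m v f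
  anchor_fun_add : ∀ m v f g, E.anchor m v (f + g) = E.anchor m v f + E.anchor m v g
  anchor_fun_smul : ∀ m v (c : ℝ) f, E.anchor m v (c • f) = c * E.anchor m v f
  anchor_fun_mul : ∀ m v f g, E.anchor m v (f * g) = f m * E.anchor m v g + g m * E.anchor m v f
  anchor_smooth : ∀ (X : E.Sec) f, ∃ g : C^∞⟮modelM n, M; ℝ⟯, ∀ m, E.anchor m (E.ev m X) f = g m
  bracket_swap : ∀ X Y m, E.ev m (E.bracket X Y) = -E.ev m (E.bracket Y X)
  bracket_leibniz : ∀ (X Y W V : E.Sec) (f : C^∞⟮modelM n, M; ℝ⟯),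
    (∀ m, E.ev m V = E.ev m Y + f m • E.ev m W) → ∀ m,
    E.ev m (E.bracket X V) = E.ev m (E.bracket X Y) + f m • E.ev m (E.bracket X W) +
      E.anchor m (E.ev m X) f • E.ev m W
  jacobi : ∀ X Y W m, E.ev m (E.bracket X (E.bracket Y W)) =
    E.ev m (E.bracket (E.bracket X Y) W) + E.ev m (E.bracket Y (E.bracket X W))
  anchor_bracket : ∀ (X Y : E.Sec) (f g h : C^∞⟮modelM n, M; ℝ⟯),
    (∀ m, E.anchor m (E.ev m X) f = g m) → (∀ m, E.anchor m (E.ev m Y) f = h m) → ∀ m,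
    E.anchor m (E.ev m (E.bracket X Y)) f =
      E.anchor m (E.ev m X) h - E.anchor m (E.ev m Y) g
  frame : ∀ m₀ : M, ∃ (κ : Type) (_ : Fintype κ) (e : Fin n ⊕ κ → E.Sec)
    (θ : Fin n ⊕ κ → E.OneForm) (x : Fin n → C^∞⟮modelM n, M; ℝ⟯), Fintype.card κ ≤ 2 ∧
    (∀ i m v, (θ (Sum.inl i)).1 m v = E.anchor m v (x i)) ∧
    ∀ᶠ m in 𝓝 m₀, ∀ v : E.Fib m, v = ∑ i, (θ i).1 m v • E.ev m (e i)

variable {E}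

theorem multi_ext {P Q : E.Multi} (h : ∀ m, P.1 m = Q.1 m) : P = Q := Subtype.ext (funext h)

theorem mul_apply (P Q : E.Multi) (m : M) : (P * Q).1 m = P.1 m * Q.1 m := rfl
theorem add_apply (P Q : E.Multi) (m : M) : (P + Q).1 m = P.1 m + Q.1 m := rfl
theorem neg_apply (P : E.Multi) (m : M) : (-P).1 m = -P.1 m := rfl
theorem smul_apply (c : ℝ) (P : E.Multi) (m : M) : (c • P).1 m = c • P.1 m := rfl
theorem zero_apply (m : M) : (0 : E.Multi).1 m = 0 := rfl
theorem one_apply (m : M) : (1 : E.Multi).1 m = 1 := rfl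
theorem ofFun_apply (f : C^∞⟮modelM n, M; ℝ⟯) (m : M) :
    (E.ofFun f).1 m = algebraMap ℝ _ (f m) := rfl
theorem ofSec_apply (X : E.Sec) (m : M) : (E.ofSec X).1 m = ExteriorAlgebra.ι ℝ (E.ev m X) := rfl

theorem ofFun_one : E.ofFun 1 = 1 := multi_ext fun _ => (algebraMap ℝ _).map_one

theorem ofFun_add (f g : C^∞⟮modelM n, M; ℝ⟯) : E.ofFun (f + g) = E.ofFun f + E.ofFun g :=
  multi_ext fun m => (algebraMap ℝ (ExteriorAlgebra ℝ (E.Fib m))).map_add _ _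

theorem ofFun_smul (c : ℝ) (f : C^∞⟮modelM n, M; ℝ⟯) : E.ofFun (c • f) = c • E.ofFun f :=
  multi_ext fun m => by
    rw [smul_apply, ofFun_apply, ofFun_apply, ContMDiffMap.coe_smul, Pi.smul_apply, smul_eq_mul,
      map_mul, Algebra.smul_def]

theorem ofFun_injective {f g : C^∞⟮modelM n, M; ℝ⟯} (h : E.ofFun f = E.ofFun g) : f = g := by
  ext m
  have := congrArg (fun P : E.Multi => ExteriorAlgebra.algebraMapInv (P.1 m)) h
  simpa [ofFun_apply, ExteriorAlgebra.algebraMap_leftInverse _ _] using this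

theorem ofFun_mem (f : C^∞⟮modelM n, M; ℝ⟯) : E.ofFun f ∈ E.degree 0 :=
  fun _ => ExteriorAlgebra.algebraMap_mem_zero _

theorem ofSec_mem (X : E.Sec) : E.ofSec X ∈ E.degree 1 := fun _ => ExteriorAlgebra.ι_mem_one _

theorem mul_mem_degree {p q : ℕ} {P Q : E.Multi} (hP : P ∈ E.degree p) (hQ : Q ∈ E.degree q) :
    P * Q ∈ E.degree (p + q) := fun m => ExteriorAlgebra.mul_mem_pow (hP m) (hQ m)

theorem one_mem_degree : (1 : E.Multi) ∈ E.degree 0 := ofFun_one (E := E) ▸ ofFun_mem 1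

theorem graded_comm {p q : ℕ} {P Q : E.Multi} (hP : P ∈ E.degree p) (hQ : Q ∈ E.degree q) :
    P * Q = (-1 : ℝ) ^ (p * q) • (Q * P) :=
  multi_ext fun m => ExteriorAlgebra.mul_comm_of_mem (hP m) (hQ m)

theorem ofFun_comm (f : C^∞⟮modelM n, M; ℝ⟯) (P : E.Multi) : E.ofFun f * P = P * E.ofFun f :=
  multi_ext fun m => Algebra.commutes (f m) (P.1 m)

theorem poly_induction {motive : E.Multi → Prop} (one : motive 1)
    (add : ∀ P Q, motive P → motive Q → motive (P + Q))
    (fun_mul : ∀ f P, motive P → motive (E.ofFun f * P))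
    (sec_mul : ∀ X P, motive P → motive (E.ofSec X * P))
    {P : E.Multi} (hP : P.1 ∈ E.polyFamilies) : motive P := by
  have smul : ∀ (c : ℝ) P, motive P → motive (c • P) := by
    intro c P h
    -- Scalars are absorbed into constant functions, so the induction principle needs no separate
    -- case for them.
    have h1 : c • P = E.ofFun (c • 1) * P := by
      rw [ofFun_smul, ofFun_one, smul_mul_assoc, one_mul]
    rw [h1]; exact fun_mul _ _ h
  have key : ∀ P ∈ E.polyFamilies, ∃ h : P ∈ E.grassmann, motive ⟨P, h⟩ := by
    intro P hP
    rw [polyFamilies, ← Subalgebra.mem_toSubmodule, Algebra.adjoin_eq_span] at hP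
    induction hP using Submodule.span_induction with
    | zero =>
      refine ⟨zero_mem _, ?_⟩
      have := smul 0 1 one
      rwa [zero_smul] at this
    | add x y _ _ hx hy =>
      exact ⟨add_mem hx.1 hy.1, add _ _ hx.2 hy.2⟩
    | smul c x _ hx =>
      exact ⟨Subalgebra.smul_mem _ hx.1 c, smul c _ hx.2⟩
    | mem x hx =>
      induction hx using Submonoid.closure_induction_left with
      | one => exact ⟨one_mem _, one⟩
      | mul_left s hs y hy ih =>
        obtain ⟨h, ih⟩ := ih
        rcases hs with ⟨f, rfl⟩ | ⟨X, rfl⟩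
        · exact ⟨mul_mem (E.ofFun f).2 h, fun_mul f _ ih⟩
        · exact ⟨mul_mem (E.ofSec X).2 h, sec_mul X _ ih⟩
  exact (key _ hP).2

/-- A bump function turns the local agreement of a smooth multisection with a polynomial one into a
global identity, to which linear operators on multisections can be applied. -/
theorem IsLieAlgebroid.exists_poly (hE : E.IsLieAlgebroid) (P : E.Multi) (m : M) :
    ∃ (χ : C^∞⟮modelM n, M; ℝ⟯) (Q : E.Multi), χ m = 1 ∧ Q.1 ∈ E.polyFamilies ∧
      E.ofFun χ * P = E.ofFun χ * Q := by
  obtain ⟨Q, hQ, e⟩ := P.2 m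
  obtain ⟨χ, h1, h0⟩ := hE.bump m _ e
  refine ⟨χ, ⟨Q, E.mem_grassmann_of_mem_poly hQ⟩, h1.self_of_nhds, hQ, multi_ext fun x => ?_⟩
  rw [mul_apply, mul_apply, ofFun_apply]
  by_cases hx : P.1 x = Q x
  · rw [hx]
  · rw [h0 x hx, map_zero, zero_mul, zero_mul]

/-- Graded derivations of `A(E)`, for the sign `s = ±1`. -/
def IsGradedDerivation (s : ℝ) (K : E.Multi →ₗ[ℝ] E.Multi) : Prop :=
  ∀ (a : ℕ) (A B : E.Multi), A ∈ E.degree a → K (A * B) = K A * B + s ^ a • (A * K B)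

/-- A derivation killing functions is linear over functions, and killing sections as well it kills
every polynomial family. Linearity over functions lets a bump function localize an arbitrary
multisection to a polynomial one. -/
theorem IsLieAlgebroid.eq_zero_of_derivation (hE : E.IsLieAlgebroid) {s : ℝ}
    {K : E.Multi →ₗ[ℝ] E.Multi} (hK : IsGradedDerivation s K) (hf : ∀ f, K (E.ofFun f) = 0)
    (hX : ∀ X, K (E.ofSec X) = 0) (P : E.Multi) : K P = 0 := by
  have h1 : ∀ f P, K (E.ofFun f * P) = E.ofFun f * K P := by
    intro f P
    rw [hK 0 _ _ (ofFun_mem f), hf, zero_mul, zero_add, pow_zero, one_smul]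
  have h2 : ∀ P : E.Multi, P.1 ∈ E.polyFamilies → K P = 0 := by
    intro P hP
    refine poly_induction (motive := fun P => K P = 0) ?_ ?_ ?_ ?_ hP
    · rw [← ofFun_one]; exact hf 1
    · intro P Q hP hQ; rw [map_add, hP, hQ, add_zero]
    · intro f P hP; rw [h1, hP, mul_zero]
    · intro X P hP; rw [hK 1 _ _ (ofSec_mem X), hX, hP, zero_mul, mul_zero, smul_zero, add_zero]
  refine multi_ext fun m => ?_
  obtain ⟨χ, Q, hχ, hQ, e⟩ := hE.exists_poly P m
  have h3 := congrArg (fun R : E.Multi => R.1 m) (congrArg K e)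
  simp only [h1, h2 Q hQ, mul_apply, ofFun_apply, hχ, map_one, one_mul] at h3
  exact h3

theorem IsLieAlgebroid.eq_of_derivation (hE : E.IsLieAlgebroid) {s : ℝ}
    {K L : E.Multi →ₗ[ℝ] E.Multi} (hK : IsGradedDerivation s K) (hL : IsGradedDerivation s L)
    (hf : ∀ f, K (E.ofFun f) = L (E.ofFun f))
    (hX : ∀ X, K (E.ofSec X) = L (E.ofSec X)) (P : E.Multi) : K P = L P := by
  have h : IsGradedDerivation s (K - L) := by
    intro a A B hA
    simp only [LinearMap.sub_apply, hK a A B hA, hL a A B hA, sub_mul, mul_sub, smul_sub]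
    abel
  have := hE.eq_zero_of_derivation h (fun f => by simp [hf]) (fun X => by simp [hX]) P
  rwa [LinearMap.sub_apply, sub_eq_zero] at this

theorem exists_component (p : ℕ) (P : E.Multi) :
    ∃ Q ∈ E.degree p, ∀ m, Q.1 m = ExteriorAlgebra.component p (P.1 m) := by
  have h : ∀ P : E.Multi, P.1 ∈ E.polyFamilies →
      (fun m => ExteriorAlgebra.component p (P.1 m)) ∈ E.polyFamilies := by
    intro P hP
    -- A polynomial family is a finite sum of homogeneous polynomial families; its component of
    -- degree p is then one of the summands or zero, hence polynomial too.
    have key : ∃ s : Finset ℕ, ∃ F : ℕ → E.Family, (∀ i, F i ∈ E.polyFamilies) ∧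
        (∀ i m, F i m ∈ ⋀[ℝ]^i (E.Fib m)) ∧ P.1 = ∑ i ∈ s, F i := by
      refine poly_induction (motive := fun P : E.Multi => ∃ s : Finset ℕ, ∃ F : ℕ → E.Family,
        (∀ i, F i ∈ E.polyFamilies) ∧ (∀ i m, F i m ∈ ⋀[ℝ]^i (E.Fib m)) ∧
        P.1 = ∑ i ∈ s, F i) ?_ ?_ ?_ ?_ hP
      · refine ⟨{0}, fun i => if i = 0 then 1 else 0, fun i => ?_, fun i m => ?_, ?_⟩
        · dsimp only
          split_ifs; exacts [one_mem _, zero_mem _]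
        · dsimp only
          split_ifs with hi
          · subst hi; exact one_mem_degree m
          · exact zero_mem _
        · rw [Finset.sum_singleton, if_pos rfl]; rfl
      · rintro P Q ⟨s, F, h1, h2, h3⟩ ⟨t, G, h1', h2', h3'⟩
        refine ⟨s ∪ t, fun i => (if i ∈ s then F i else 0) + (if i ∈ t then G i else 0),
          fun i => ?_, fun i m => ?_, ?_⟩
        · refine add_mem ?_ ?_
          · split_ifs; exacts [h1 i, zero_mem _]
          · split_ifs; exacts [h1' i, zero_mem _]
        · refine add_mem ?_ ?_
          · split_ifs; exacts [h2 i m, zero_mem _]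
          · split_ifs; exacts [h2' i m, zero_mem _]
        · rw [Finset.sum_add_distrib, Finset.sum_ite_mem, Finset.sum_ite_mem,
            Finset.union_inter_cancel_left, Finset.union_inter_cancel_right, ← h3, ← h3']; rfl
      · rintro f P ⟨s, F, h1, h2, h3⟩
        refine ⟨s, fun i => E.funFamily f * F i,
          fun i => mul_mem (Algebra.subset_adjoin (Or.inl ⟨f, rfl⟩)) (h1 i), fun i m => ?_, ?_⟩
        · have := ExteriorAlgebra.mul_mem_pow (ofFun_mem (E := E) f m) (h2 i m)
          rwa [zero_add] at this
        · rw [← Finset.mul_sum, ← h3]; rfl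
      · rintro X P ⟨s, F, h1, h2, h3⟩
        -- Multiplication by a section shifts degrees by one; the degree-0 piece is set to zero, so
        -- i − 1 is never truncated.
        refine ⟨s.image (· + 1), fun i => if i = 0 then 0 else E.secFamily X * F (i - 1),
          fun i => ?_, fun i m => ?_, ?_⟩
        · dsimp only
          split_ifs
          exacts [zero_mem _, mul_mem (Algebra.subset_adjoin (Or.inr ⟨X, rfl⟩)) (h1 _)]
        · rcases i with _ | i
          · exact zero_mem _
          · have := ExteriorAlgebra.mul_mem_pow (ofSec_mem (E := E) X m) (h2 i m)
            rwa [add_comm] at this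
        · rw [Finset.sum_image (by simp)]
          simp only [Nat.add_eq_zero_iff, one_ne_zero, and_false, if_false, Nat.add_sub_cancel]
          rw [← Finset.mul_sum, ← h3]; rfl
    obtain ⟨s, F, h1, h2, h3⟩ := key
    have h4 : (fun m => ExteriorAlgebra.component p (P.1 m)) =
        ∑ i ∈ s, if i = p then F i else 0 := by
      ext m
      rw [h3, Finset.sum_apply, Finset.sum_apply, map_sum]
      refine Finset.sum_congr rfl fun i _ => ?_
      split_ifs with hi
      · subst hi; exact ExteriorAlgebra.component_of_mem (h2 i m)
      · exact ExteriorAlgebra.component_of_mem_ne hi (h2 i m)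
    rw [h4]
    refine sum_mem fun i _ => ?_
    split_ifs; exacts [h1 i, zero_mem _]
  refine ⟨⟨fun m => ExteriorAlgebra.component p (P.1 m), fun m => ?_⟩,
    fun m => ExteriorAlgebra.component_mem p _, fun m => rfl⟩
  obtain ⟨Q, hQ, e⟩ := P.2 m
  refine ⟨_, h ⟨Q, E.mem_grassmann_of_mem_poly hQ⟩ hQ, ?_⟩
  filter_upwards [e] with x hx
  rw [hx]

/-- A local frame has at most n + 2 members. -/
theorem IsLieAlgebroid.pow_eq_zero (hE : E.IsLieAlgebroid) {p : ℕ} (hp : n + 3 ≤ p) {m : M}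
    {x : ExteriorAlgebra ℝ (E.Fib m)} (hx : x ∈ ⋀[ℝ]^p (E.Fib m)) : x = 0 := by
  obtain ⟨κ, _, e, θ, -, hκ, -, h⟩ := hE.frame m
  refine ExteriorAlgebra.pow_eq_zero_of_card_lt h.self_of_nhds ?_ hx
  rw [Fintype.card_sum, Fintype.card_fin]
  omega

/-- The rank bound is uniform over M, so one finite sum of smooth homogeneous components represents
a multisection globally. -/
theorem IsLieAlgebroid.homogeneous_induction (hE : E.IsLieAlgebroid) {motive : E.Multi → Prop}
    (add : ∀ P Q, motive P → motive Q → motive (P + Q))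
    (hom : ∀ p P, P ∈ E.degree p → motive P) (P : E.Multi) : motive P := by
  choose C hC hC' using fun p => exists_component (E := E) p P
  have h : P = ∑ p ∈ Finset.range (n + 3), C p := by
    refine multi_ext fun m => ?_
    have h1 : (∑ p ∈ Finset.range (n + 3), C p).1 m = ∑ p ∈ Finset.range (n + 3), (C p).1 m := by
      rw [AddSubmonoidClass.coe_finsetSum, Finset.sum_apply]
    rw [h1]
    simp only [hC']
    exact ExteriorAlgebra.eq_sum_component (fun p hp x hx => hE.pow_eq_zero hp hx) _
  rw [h]
  refine Finset.sum_induction _ motive add ?_ fun p _ => hom p _ (hC p)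
  exact hom 0 0 (zero_mem _)

end

end LieAlgebroidData

/-! ### Uniqueness and graded Jacobi identity of the Schouten bracket. -/

namespace LieAlgebroidData

section

variable {n : ℕ} {M : Type*} [TopologicalSpace M] [ChartedSpace (EuclideanSpace ℝ (Fin n)) M]
  {E : LieAlgebroidData.{_, v} n M}

/-- The scalar part of a polynomial family is a smooth function, as sections contribute nothing to
it; since smoothness is local, this suffices. -/
theorem exists_eq_ofFun {P : E.Multi} (hP : P ∈ E.degree 0) : ∃ f, P = E.ofFun f := by
  have h : ∀ P : E.Multi, P.1 ∈ E.polyFamilies → ∃ f : C^∞⟮modelM n, M; ℝ⟯,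
      ∀ m, ExteriorAlgebra.algebraMapInv (P.1 m) = f m := by
    intro P hP
    refine poly_induction (motive := fun P : E.Multi => ∃ f : C^∞⟮modelM n, M; ℝ⟯,
      ∀ m, ExteriorAlgebra.algebraMapInv (P.1 m) = f m) ⟨1, fun m => ?_⟩ ?_ ?_ ?_ hP
    · rw [one_apply, map_one]; rfl
    · rintro P Q ⟨f, hf⟩ ⟨g, hg⟩
      exact ⟨f + g, fun m => by rw [add_apply, map_add, hf, hg]; rfl⟩
    · rintro f P ⟨g, hg⟩
      exact ⟨f * g, fun m => by
        rw [mul_apply, map_mul, hg, ofFun_apply, ExteriorAlgebra.algebraMap_leftInverse]; rfl⟩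
    · rintro X P -
      exact ⟨0, fun m => by
        rw [mul_apply, map_mul, ofSec_apply, ExteriorAlgebra.algebraMapInv,
          ExteriorAlgebra.lift_ι_apply]
        simp⟩
  have hval : ∀ m, P.1 m = algebraMap ℝ _ (ExteriorAlgebra.algebraMapInv (P.1 m)) := by
    intro m
    obtain ⟨r, hr⟩ := ExteriorAlgebra.mem_zero_iff.1 (hP m)
    rw [← hr, ExteriorAlgebra.algebraMap_leftInverse]
  refine ⟨⟨fun m => ExteriorAlgebra.algebraMapInv (P.1 m), fun m => ?_⟩, multi_ext hval⟩
  obtain ⟨Q, hQ, e⟩ := P.2 m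
  obtain ⟨f, hf⟩ := h ⟨Q, E.mem_grassmann_of_mem_poly hQ⟩ hQ
  refine (f.contMDiff m).congr_of_eventuallyEq ?_
  filter_upwards [e] with x hx
  rw [hx, ← hf]

variable {S : E.Multi →ₗ[ℝ] E.Multi →ₗ[ℝ] E.Multi}

namespace IsSchoutenBracket

theorem derivation (hS : E.IsSchoutenBracket S) {p : ℕ} {P : E.Multi} (hP : P ∈ E.degree p) :
    IsGradedDerivation ((-1) ^ (p + 1)) (S P) := by
  intro a A B hA
  rw [hS.leibniz p a P A B hP hA, pow_mul]

theorem fun_sec (hS : E.IsSchoutenBracket S) (f : C^∞⟮modelM n, M; ℝ⟯) (X : E.Sec) :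
    S (E.ofFun f) (E.ofSec X) = -S (E.ofSec X) (E.ofFun f) := by
  rw [hS.antisymm 0 1 _ _ (ofFun_mem f) (ofSec_mem X)]; norm_num

theorem sec_fun_eq (hS : E.IsSchoutenBracket S) {X : E.Sec} {f g : C^∞⟮modelM n, M; ℝ⟯}
    (h : ∀ m, E.anchor m (E.ev m X) f = g m) : S (E.ofSec X) (E.ofFun f) = E.ofFun g :=
  multi_ext fun m => by rw [hS.sec_fun, h, ofFun_apply]

/-- The degree axiom, stated with p + q = r + 1, is silent for p = q = 0; this fills the gap and
settles that exceptional case in the sign lemmas below. -/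
theorem zero_zero (hS : E.IsSchoutenBracket S) {P Q : E.Multi} (hP : P ∈ E.degree 0)
    (hQ : Q ∈ E.degree 0) : S P Q = 0 := by
  obtain ⟨f, rfl⟩ := exists_eq_ofFun hP
  obtain ⟨g, rfl⟩ := exists_eq_ofFun hQ
  exact hS.fun_fun f g

/-- With the first argument fixed, both brackets are derivations of the second. Functions and
sections are treated as first arguments; antisymmetry then supplies the values on generators needed
for an arbitrary homogeneous first argument. -/
theorem eq_of_generators (hE : E.IsLieAlgebroid) (hS : E.IsSchoutenBracket S) {S'}
    (hS' : E.IsSchoutenBracket S') : S = S' := by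
  have h1 : ∀ f Q, S (E.ofFun f) Q = S' (E.ofFun f) Q := fun f =>
    hE.eq_of_derivation (hS.derivation (ofFun_mem f)) (hS'.derivation (ofFun_mem f))
      (fun g => by rw [hS.fun_fun, hS'.fun_fun])
      (fun X => by
        rw [hS.fun_sec, hS'.fun_sec]
        congr 1
        exact multi_ext fun m => by rw [hS.sec_fun, hS'.sec_fun])
  have h2 : ∀ X Q, S (E.ofSec X) Q = S' (E.ofSec X) Q := fun X =>
    hE.eq_of_derivation (hS.derivation (ofSec_mem X)) (hS'.derivation (ofSec_mem X))
      (fun g => multi_ext fun m => by rw [hS.sec_fun, hS'.sec_fun])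
      (fun X => by rw [hS.sec_sec, hS'.sec_sec])
  have h3 : ∀ p P, P ∈ E.degree p → ∀ Q, S P Q = S' P Q := fun p P hP =>
    hE.eq_of_derivation (hS.derivation hP) (hS'.derivation hP)
      (fun g => by
        rw [hS.antisymm p 0 _ _ hP (ofFun_mem g), hS'.antisymm p 0 _ _ hP (ofFun_mem g), h1])
      (fun X => by
        rw [hS.antisymm p 1 _ _ hP (ofSec_mem X), hS'.antisymm p 1 _ _ hP (ofSec_mem X), h2])
  ext1 P
  refine hE.homogeneous_induction (motive := fun P => S P = S' P)
    (fun P Q hP hQ => by rw [map_add, map_add, hP, hQ]) (fun p P hP => ?_) P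
  ext1 Q
  exact h3 p P hP Q

/-- The graded Jacobi identity for three given elements. -/
def Jacobi (S : E.Multi →ₗ[ℝ] E.Multi →ₗ[ℝ] E.Multi) (p q : ℕ) (P Q R : E.Multi) : Prop :=
  S P (S Q R) = S (S P Q) R + (-1 : ℝ) ^ ((p + 1) * (q + 1)) • S Q (S P R)

/-- The bracket of P and A has degree p + a − 1. Since t² = 1, the exponent a + p + 1 gives the same
sign without subtraction. -/
theorem derivation_apply (hS : E.IsSchoutenBracket S) {t : ℝ} (ht : t * t = 1)
    {L : E.Multi →ₗ[ℝ] E.Multi} (hL : IsGradedDerivation t L) {p a : ℕ} {P A : E.Multi}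
    (hP : P ∈ E.degree p) (hA : A ∈ E.degree a) (B : E.Multi) :
    L (S P A * B) = L (S P A) * B + (t ^ (a + p + 1)) • (S P A * L B) := by
  rcases Nat.eq_zero_or_pos (p + a) with h | h
  · obtain ⟨rfl, rfl⟩ : p = 0 ∧ a = 0 := by omega
    rw [hS.zero_zero hP hA]; simp
  · obtain ⟨r, hr⟩ : ∃ r, p + a = r + 1 := ⟨p + a - 1, by omega⟩
    rw [hL r _ _ (hS.degree p a r P A hP hA hr)]
    have : a + p + 1 = r + 2 := by omega
    rw [this, pow_add, pow_two, ht, mul_one]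

theorem antisymm_apply (hS : E.IsSchoutenBracket S) {p a r : ℕ} {P A R : E.Multi}
    (hP : P ∈ E.degree p) (hA : A ∈ E.degree a) (hR : R ∈ E.degree r) :
    S (S P A) R = -((-1 : ℝ) ^ ((p + a) * (r + 1)) • S R (S P A)) := by
  rcases Nat.eq_zero_or_pos (p + a) with h | h
  · obtain ⟨rfl, rfl⟩ : p = 0 ∧ a = 0 := by omega
    rw [hS.zero_zero hP hA]; simp
  · obtain ⟨k, hk⟩ : ∃ k, p + a = k + 1 := ⟨p + a - 1, by omega⟩
    rw [hS.antisymm k r _ _ (hS.degree p a k P A hP hA hk) hR, hk]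

theorem neg_one_pow_sq (p : ℕ) : (-1 : ℝ) ^ p * (-1) ^ p = 1 := by
  rw [← pow_add, ← two_mul, pow_mul]; simp

theorem bracket_derivation (hS : E.IsSchoutenBracket S) {p q : ℕ} {P Q : E.Multi}
    (hP : P ∈ E.degree p) (hQ : Q ∈ E.degree q) :
    IsGradedDerivation ((-1) ^ (p + q)) (S (S P Q)) := by
  rcases Nat.eq_zero_or_pos (p + q) with h | h
  · obtain ⟨rfl, rfl⟩ : p = 0 ∧ q = 0 := by omega
    rw [hS.zero_zero hP hQ]; intro a A B _; simp
  · obtain ⟨k, hk⟩ : ∃ k, p + q = k + 1 := ⟨p + q - 1, by omega⟩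
    rw [hk]
    exact hS.derivation (hS.degree p q k P Q hP hQ hk)

/-- The graded commutator of two graded derivations is a graded derivation: the mixed terms cancel.
All signs depend only on the parities of p, q and a, which leaves eight cases. -/
theorem commutator_derivation (hS : E.IsSchoutenBracket S) {p q : ℕ} {P Q : E.Multi}
    (hP : P ∈ E.degree p) (hQ : Q ∈ E.degree q) :
    IsGradedDerivation ((-1) ^ (p + q)) ((S P).comp (S Q) -
      (-1 : ℝ) ^ ((p + 1) * (q + 1)) • (S Q).comp (S P)) := by
  intro a A B hA
  have h1 := hS.derivation hP
  have h2 := hS.derivation hQ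
  simp only [LinearMap.sub_apply, LinearMap.comp_apply, LinearMap.smul_apply, h2 a A B hA,
    h1 a A B hA, map_add, map_smul, hS.derivation_apply (neg_one_pow_sq _) h1 hQ hA,
    hS.derivation_apply (neg_one_pow_sq _) h2 hP hA, h2 a A _ hA, h1 a A _ hA]
  simp only [sub_mul, mul_sub, smul_sub, smul_add, smul_mul_assoc, mul_smul_comm, smul_smul]
  rcases neg_one_pow_eq_or ℝ p with hp | hp <;> rcases neg_one_pow_eq_or ℝ q with hq | hq <;>
    rcases neg_one_pow_eq_or ℝ a with ha | ha <;>
    simp [pow_add, pow_mul, hp, hq, ha] <;> abel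

/-- As functions of R, the graded commutator of the brackets with P and Q and the bracket with ⟦P,Q⟧
are derivations of the same sign, so they are compared on generators. -/
theorem jacobi_of_generators (hE : E.IsLieAlgebroid) (hS : E.IsSchoutenBracket S) {p q : ℕ}
    {P Q : E.Multi} (hP : P ∈ E.degree p) (hQ : Q ∈ E.degree q)
    (hf : ∀ f, Jacobi S p q P Q (E.ofFun f)) (hX : ∀ X, Jacobi S p q P Q (E.ofSec X))
    (R : E.Multi) : Jacobi S p q P Q R := by
  have := hE.eq_of_derivation (hS.commutator_derivation hP hQ) (hS.bracket_derivation hP hQ)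
    (fun f => by
      have := hf f
      unfold Jacobi at this
      simp [this])
    (fun X => by
      have := hX X
      unfold Jacobi at this
      simp [this]) R
  rw [LinearMap.sub_apply, sub_eq_iff_eq_add] at this
  exact this

/-- Together with `Jacobi.swap_right`, this makes the graded Jacobi identity invariant under
permutations of its three arguments, so that reduction to generators in the last slot becomes
reduction in every slot. -/
theorem Jacobi.swap_left (hS : E.IsSchoutenBracket S) {p q : ℕ} {P Q R : E.Multi}
    (hP : P ∈ E.degree p) (hQ : Q ∈ E.degree q) (h : Jacobi S p q P Q R) :
    Jacobi S q p Q P R := by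
  unfold Jacobi at h ⊢
  rw [h, hS.antisymm q p Q P hQ hP, mul_comm (q + 1) (p + 1)]
  rcases neg_one_pow_eq_or ℝ ((p + 1) * (q + 1)) with hp | hp <;> simp [hp] 

theorem Jacobi.swap_right (hS : E.IsSchoutenBracket S) {p q r : ℕ} {P Q R : E.Multi}
    (hP : P ∈ E.degree p) (hQ : Q ∈ E.degree q) (hR : R ∈ E.degree r)
    (h : Jacobi S p q P Q R) : Jacobi S p r P R Q := by
  unfold Jacobi at h ⊢
  rw [hS.antisymm r q R Q hR hQ, map_neg, map_smul, h, hS.antisymm_apply hP hR hQ,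
    hS.antisymm_apply hP hQ hR]
  simp only [smul_add, smul_neg, smul_smul]
  rcases neg_one_pow_eq_or ℝ p with hp | hp <;> rcases neg_one_pow_eq_or ℝ q with hq | hq <;>
    rcases neg_one_pow_eq_or ℝ r with hr | hr <;>
    simp [pow_add, pow_mul, hp, hq, hr]

/-- The graded Jacobi identity for generators. -/
theorem jacobi_fun_fun_fun (hS : E.IsSchoutenBracket S) (f g h) :
    Jacobi S 0 0 (E.ofFun f) (E.ofFun g) (E.ofFun h) := by
  unfold Jacobi; simp [hS.fun_fun]

theorem jacobi_sec_fun_fun (hE : E.IsLieAlgebroid) (hS : E.IsSchoutenBracket S) (X f g) :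
    Jacobi S 1 0 (E.ofSec X) (E.ofFun f) (E.ofFun g) := by
  obtain ⟨f', hf⟩ := hE.anchor_smooth X f
  obtain ⟨g', hg⟩ := hE.anchor_smooth X g
  unfold Jacobi
  simp [hS.fun_fun, hS.sec_fun_eq hf, hS.sec_fun_eq hg]

theorem jacobi_sec_sec_fun (hE : E.IsLieAlgebroid) (hS : E.IsSchoutenBracket S) (X Y f) :
    Jacobi S 1 1 (E.ofSec X) (E.ofSec Y) (E.ofFun f) := by
  obtain ⟨g, hg⟩ := hE.anchor_smooth X f
  obtain ⟨h, hh⟩ := hE.anchor_smooth Y f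
  unfold Jacobi
  rw [hS.sec_fun_eq hg, hS.sec_fun_eq hh, hS.sec_sec]
  refine multi_ext fun m => ?_
  rw [add_apply, smul_apply, hS.sec_fun, hS.sec_fun, hS.sec_fun, hE.anchor_bracket X Y f g h hg hh,
    map_sub]
  norm_num

theorem jacobi_sec_sec_sec (hE : E.IsLieAlgebroid) (hS : E.IsSchoutenBracket S) (X Y W) :
    Jacobi S 1 1 (E.ofSec X) (E.ofSec Y) (E.ofSec W) := by
  unfold Jacobi
  refine multi_ext fun m => ?_
  simp only [hS.sec_sec, add_apply, smul_apply, ofSec_apply]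
  rw [hE.jacobi, map_add]
  norm_num

/-- Homogeneous generators of the Grassmann algebra. -/
def Gen (p : ℕ) (P : E.Multi) : Prop :=
  (p = 0 ∧ ∃ f, P = E.ofFun f) ∨ (p = 1 ∧ ∃ X, P = E.ofSec X)

theorem Gen.mem {p : ℕ} {P : E.Multi} (h : Gen p P) : P ∈ E.degree p := by
  rcases h with ⟨rfl, f, rfl⟩ | ⟨rfl, X, rfl⟩
  exacts [ofFun_mem f, ofSec_mem X]

/-- Up to permutation only the number of sections among the generators matters, so the eight cases
come from four identities. -/
theorem jacobi_gen (hE : E.IsLieAlgebroid) (hS : E.IsSchoutenBracket S) {p q r : ℕ}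
    {P Q R : E.Multi} (hP : Gen p P) (hQ : Gen q Q) (hR : Gen r R) : Jacobi S p q P Q R := by
  have mP := hP.mem
  have mQ := hQ.mem
  have mR := hR.mem
  rcases hP with ⟨rfl, f, rfl⟩ | ⟨rfl, X, rfl⟩ <;> rcases hQ with ⟨rfl, g, rfl⟩ | ⟨rfl, Y, rfl⟩ <;>
    rcases hR with ⟨rfl, h, rfl⟩ | ⟨rfl, W, rfl⟩
  · exact hS.jacobi_fun_fun_fun f g h
  · exact ((hS.jacobi_sec_fun_fun hE W f g).swap_left hS mR mP).swap_right hS mP mR mQ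
  · exact (hS.jacobi_sec_fun_fun hE Y f h).swap_left hS mQ mP
  · exact ((hS.jacobi_sec_sec_fun hE Y W f).swap_right hS mQ mR mP).swap_left hS mQ mP
  · exact hS.jacobi_sec_fun_fun hE X g h
  · exact (hS.jacobi_sec_sec_fun hE X W g).swap_right hS mP mR mQ
  · exact hS.jacobi_sec_sec_fun hE X Y h
  · exact hS.jacobi_sec_sec_sec hE X Y W

theorem jacobi_gen_gen (hE : E.IsLieAlgebroid) (hS : E.IsSchoutenBracket S) {p q : ℕ}
    {P Q : E.Multi} (hP : Gen p P) (hQ : Gen q Q) (R : E.Multi) : Jacobi S p q P Q R :=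
  hS.jacobi_of_generators hE hP.mem hQ.mem
    (fun f => hS.jacobi_gen hE hP hQ (Or.inl ⟨rfl, f, rfl⟩))
    (fun X => hS.jacobi_gen hE hP hQ (Or.inr ⟨rfl, X, rfl⟩)) R

theorem jacobi_gen_left (hE : E.IsLieAlgebroid) (hS : E.IsSchoutenBracket S) {p q : ℕ}
    {P Q : E.Multi} (hP : Gen p P) (hQ : Q ∈ E.degree q) (R : E.Multi) : Jacobi S p q P Q R := by
  have key : ∀ {r : ℕ} {R : E.Multi}, Gen r R → Jacobi S p q P Q R := fun hR =>
    (hS.jacobi_gen_gen hE hP hR Q).swap_right hS hP.mem hR.mem hQ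
  exact hS.jacobi_of_generators hE hP.mem hQ (fun f => key (Or.inl ⟨rfl, f, rfl⟩))
    (fun X => key (Or.inr ⟨rfl, X, rfl⟩)) R

/-- The graded Jacobi identity of the Schouten bracket. -/
theorem jacobi (hE : E.IsLieAlgebroid) (hS : E.IsSchoutenBracket S) {p q : ℕ}
    {P Q : E.Multi} (hP : P ∈ E.degree p) (hQ : Q ∈ E.degree q) (R : E.Multi) :
    Jacobi S p q P Q R := by
  -- The identity is known with a generator in the first slot; two transpositions move the generator
  -- to the last.
  have key : ∀ {r : ℕ} {R : E.Multi}, Gen r R → Jacobi S p q P Q R := fun hR =>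
    ((hS.jacobi_gen_left hE hR hP Q).swap_left hS hR.mem hP).swap_right hS hP hR.mem hQ
  exact hS.jacobi_of_generators hE hP hQ (fun f => key (Or.inl ⟨rfl, f, rfl⟩))
    (fun X => key (Or.inr ⟨rfl, X, rfl⟩)) R

/-- In degree 2 the sign in the Jacobi identity is (−1)⁹ = −1, so the two double brackets add up
instead of cancelling. This links the square of the differential to ⟦J,J⟧. -/
theorem apply_apply (hE : E.IsLieAlgebroid) (hS : E.IsSchoutenBracket S) {J : E.Multi}
    (hJ : J ∈ E.degree 2) (R : E.Multi) : S (S J J) R = (2 : ℝ) • S J (S J R) := by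
  have h := hS.jacobi hE hJ hJ R
  unfold Jacobi at h
  norm_num at h
  rw [two_smul]
  nth_rw 1 [h]
  abel

end IsSchoutenBracket

end

end LieAlgebroidData

/-! ### Vector-valued functions as tensors; locality of anchor and bracket. -/

namespace LieAlgebroidData

section

variable {n : ℕ} {M : Type*} [TopologicalSpace M] [ChartedSpace (EuclideanSpace ℝ (Fin n)) M]
  {E : LieAlgebroidData.{_, v} n M}

open scoped TensorProduct

section tensor

variable (W : Type*) [Ring W] [Algebra ℝ W]

/-- Evaluation at a point of a `W`-valued function, given as an element of `C^∞(M) ⊗ W`. -/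
noncomputable def tensorEval (m : M) : C^∞⟮modelM n, M; ℝ⟯ ⊗[ℝ] W →ₗ[ℝ] W :=
  TensorProduct.lift
    { toFun := fun f => f m • LinearMap.id
      map_add' := fun f g => by rw [← add_smul]; rfl
      map_smul' := fun c f => by rw [RingHom.id_apply, smul_smul]; rfl }

variable {W}

theorem tensorEval_tmul (m : M) (f : C^∞⟮modelM n, M; ℝ⟯) (w : W) :
    tensorEval W m (f ⊗ₜ w) = f m • w := rfl

theorem tensorEval_mul (m : M) (s t : C^∞⟮modelM n, M; ℝ⟯ ⊗[ℝ] W) :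
    tensorEval W m (s * t) = tensorEval W m s * tensorEval W m t := by
  induction s using TensorProduct.induction_on with
  | zero => simp
  | add s s' hs hs' => rw [add_mul, map_add, hs, hs', map_add, add_mul]
  | tmul f w =>
    induction t using TensorProduct.induction_on with
    | zero => simp
    | add t t' ht ht' => rw [mul_add, map_add, ht, ht', map_add, mul_add]
    | tmul g x =>
      rw [Algebra.TensorProduct.tmul_mul_tmul, tensorEval_tmul, tensorEval_tmul, tensorEval_tmul,
        smul_mul_smul_comm]
      rfl

/-- The derivative of a `W`-valued function along a linear functional on functions. -/
noncomputable def tensorDeriv (D : C^∞⟮modelM n, M; ℝ⟯ →ₗ[ℝ] ℝ) :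
    C^∞⟮modelM n, M; ℝ⟯ ⊗[ℝ] W →ₗ[ℝ] W :=
  TensorProduct.lift ((LinearMap.lsmul ℝ W).comp D)

theorem tensorDeriv_tmul (D : C^∞⟮modelM n, M; ℝ⟯ →ₗ[ℝ] ℝ) (f : C^∞⟮modelM n, M; ℝ⟯) (w : W) :
    tensorDeriv D (f ⊗ₜ w) = D f • w := rfl

theorem tensorDeriv_mul {m : M} {D : C^∞⟮modelM n, M; ℝ⟯ →ₗ[ℝ] ℝ}
    (hD : ∀ f g, D (f * g) = f m * D g + g m * D f) (s t : C^∞⟮modelM n, M; ℝ⟯ ⊗[ℝ] W) :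
    tensorDeriv D (s * t) =
      tensorDeriv D s * tensorEval W m t + tensorEval W m s * tensorDeriv D t := by
  induction s using TensorProduct.induction_on with
  | zero => simp
  | add s s' hs hs' => rw [add_mul, map_add, hs, hs', map_add, map_add, add_mul, add_mul]; abel
  | tmul f w =>
    induction t using TensorProduct.induction_on with
    | zero => simp
    | add t t' ht ht' => rw [mul_add, map_add, ht, ht', map_add, map_add, mul_add, mul_add]; abel
    | tmul g x =>
      simp only [Algebra.TensorProduct.tmul_mul_tmul, tensorEval_tmul, tensorDeriv_tmul, hD,
        smul_mul_smul_comm, ← add_smul]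
      congr 1; ring

theorem tensorEval_map (m : M) (L : W →ₗ[ℝ] W) (t : C^∞⟮modelM n, M; ℝ⟯ ⊗[ℝ] W) :
    tensorEval W m (L.lTensor _ t) = L (tensorEval W m t) := by
  induction t using TensorProduct.induction_on with
  | zero => simp
  | add t t' ht ht' => simp only [map_add, ht, ht']
  | tmul f w => rw [LinearMap.lTensor_tmul, tensorEval_tmul, tensorEval_tmul, map_smul]

theorem tensorDeriv_map (D : C^∞⟮modelM n, M; ℝ⟯ →ₗ[ℝ] ℝ) (L : W →ₗ[ℝ] W)
    (t : C^∞⟮modelM n, M; ℝ⟯ ⊗[ℝ] W) :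
    tensorDeriv D (L.lTensor _ t) = L (tensorDeriv D t) := by
  induction t using TensorProduct.induction_on with
  | zero => simp
  | add t t' ht ht' => simp only [map_add, ht, ht']
  | tmul f w => rw [LinearMap.lTensor_tmul, tensorDeriv_tmul, tensorDeriv_tmul, map_smul]

/-- Composition with a linear functional of W reduces the claim to scalar functions, for which it is
the hypothesis on D; functionals separate the points of W. Hence the derivative depends only on the
germ of the function that the tensor represents. -/
theorem tensorDeriv_eq_zero {m : M} {D : C^∞⟮modelM n, M; ℝ⟯ →ₗ[ℝ] ℝ}
    (hD : ∀ f : C^∞⟮modelM n, M; ℝ⟯, (∀ᶠ x in 𝓝 m, f x = 0) → D f = 0)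
    {t : C^∞⟮modelM n, M; ℝ⟯ ⊗[ℝ] W} (ht : ∀ᶠ x in 𝓝 m, tensorEval W x t = 0) :
    tensorDeriv D t = 0 := by
  rw [← Module.forall_dual_apply_eq_zero_iff ℝ]
  intro φ
  have h : ∃ f : C^∞⟮modelM n, M; ℝ⟯, (∀ x, f x = φ (tensorEval W x t)) ∧
      D f = φ (tensorDeriv D t) := by
    clear ht
    induction t using TensorProduct.induction_on with
    | zero => exact ⟨0, by simp, by simp⟩
    | add t t' ht ht' =>
      obtain ⟨f, h1, h2⟩ := ht
      obtain ⟨g, h3, h4⟩ := ht'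
      exact ⟨f + g, fun x => by rw [map_add, map_add, ← h1, ← h3]; rfl,
        by rw [map_add, map_add, map_add, h2, h4]⟩
    | tmul f w =>
      refine ⟨φ w • f, fun x => ?_, ?_⟩
      · rw [tensorEval_tmul, map_smul, ContMDiffMap.coe_smul, Pi.smul_apply, smul_eq_mul,
          smul_eq_mul, mul_comm]
      · rw [tensorDeriv_tmul, map_smul, map_smul, smul_eq_mul, smul_eq_mul, mul_comm]
  obtain ⟨f, h1, h2⟩ := h
  rw [← h2]
  refine hD f ?_
  filter_upwards [ht] with x hx
  rw [h1, hx, map_zero]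

end tensor

namespace IsLieAlgebroid

/-- The derivation of functions along a vector of a Lie algebroid. -/
noncomputable def anchorDeriv (hE : E.IsLieAlgebroid) (m : M) (v : E.Fib m) :
    C^∞⟮modelM n, M; ℝ⟯ →ₗ[ℝ] ℝ where
  toFun := E.anchor m v
  map_add' := hE.anchor_fun_add m v
  map_smul' := hE.anchor_fun_smul m v

theorem anchor_one (hE : E.IsLieAlgebroid) (m : M) (v : E.Fib m) : E.anchor m v 1 = 0 := by
  have h := hE.anchor_fun_mul m v 1 1
  rw [mul_one] at h
  have h1 : (1 : C^∞⟮modelM n, M; ℝ⟯) m = 1 := rfl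
  rw [h1] at h
  linarith

theorem anchor_zero (hE : E.IsLieAlgebroid) (m : M) (v : E.Fib m) : E.anchor m v 0 = 0 :=
  (hE.anchorDeriv m v).map_zero

/-- A bump function χ equal to 1 near m and vanishing wherever f does not satisfies χf = 0; the
Leibniz rule at m then leaves the derivative of f alone. -/
theorem anchor_eq_zero (hE : E.IsLieAlgebroid) {m : M} (v : E.Fib m)
    {f : C^∞⟮modelM n, M; ℝ⟯} (hf : ∀ᶠ x in 𝓝 m, f x = 0) : E.anchor m v f = 0 := by
  obtain ⟨χ, h1, h0⟩ := hE.bump m _ hf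
  have h : χ * f = 0 := by
    ext x
    by_cases hx : f x = 0
    · rw [ContMDiffMap.coe_mul, Pi.mul_apply, hx, mul_zero]; rfl
    · rw [ContMDiffMap.coe_mul, Pi.mul_apply, h0 x hx, zero_mul]; rfl
  have h2 := hE.anchor_fun_mul m v χ f
  rw [h, hE.anchor_zero, hf.self_of_nhds, h1.self_of_nhds] at h2
  linarith

theorem anchor_sum (hE : E.IsLieAlgebroid) (m : M) {κ : Type*} (s : Finset κ) (c : κ → ℝ)
    (v : κ → E.Fib m) (f : C^∞⟮modelM n, M; ℝ⟯) :
    E.anchor m (∑ i ∈ s, c i • v i) f = ∑ i ∈ s, c i * E.anchor m (v i) f := by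
  let L : E.Fib m →ₗ[ℝ] ℝ :=
    { toFun := fun v => E.anchor m v f
      map_add' := fun v w => hE.anchor_add m v w f
      map_smul' := fun c v => hE.anchor_smul m c v f }
  change L _ = ∑ i ∈ s, c i * L (v i)
  simp

theorem exists_zero (hE : E.IsLieAlgebroid) (X : E.Sec) : ∃ O : E.Sec, ∀ m, E.ev m O = 0 := by
  -- Sections carry no linear structure in the axioms; a zero section is produced as X + (−1)X.
  obtain ⟨O, hO⟩ := hE.exists_add_smul X X (-1)
  refine ⟨O, fun m => ?_⟩
  rw [hO]
  change E.ev m X + (-1 : ℝ) • E.ev m X = 0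
  simp

theorem bracket_zero (hE : E.IsLieAlgebroid) (X : E.Sec) {O : E.Sec} (hO : ∀ m, E.ev m O = 0)
    (m : M) : E.ev m (E.bracket X O) = 0 := by
  -- The zero section is O + 1·O, so its bracket with X equals twice itself.
  have h := hE.bracket_leibniz X O O O 1 (fun m => by simp [hO]) m
  rw [hO, smul_zero, add_zero] at h
  have h1 : (1 : C^∞⟮modelM n, M; ℝ⟯) m = 1 := rfl
  rw [h1, one_smul] at h
  exact left_eq_add.1 h

/-- The difference D of the two sections vanishes near m. With a bump function χ supported where D =
0, the section χD is identically zero, and the Leibniz rule at m gives [X,D] = 0 there because χ = 1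
and D = 0 at m. -/
theorem bracket_congr (hE : E.IsLieAlgebroid) (X : E.Sec) {Y Y' : E.Sec} {m : M}
    (h : ∀ᶠ x in 𝓝 m, E.ev x Y = E.ev x Y') :
    E.ev m (E.bracket X Y) = E.ev m (E.bracket X Y') := by
  obtain ⟨O, hO⟩ := hE.exists_zero X
  obtain ⟨D, hD⟩ := hE.exists_add_smul Y Y' (-1)
  have hD' : ∀ m, E.ev m D = E.ev m Y - E.ev m Y' := by
    intro m
    rw [hD, sub_eq_add_neg]
    change _ + (-1 : ℝ) • _ = _
    rw [neg_one_smul]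
  obtain ⟨χ, h1, h0⟩ := hE.bump m _ h
  have h2 := hE.bracket_leibniz X O D O χ (fun x => by
    rw [hO, hD', zero_add]
    by_cases hx : E.ev x Y = E.ev x Y'
    · rw [hx, sub_self, smul_zero]
    · rw [h0 x hx, zero_smul]) m
  have h3 := hE.bracket_leibniz X Y' D Y 1 (fun x => by
    rw [hD']; change _ = _ + (1 : ℝ) • _; rw [one_smul]; abel) m
  rw [hD', h.self_of_nhds, sub_self, smul_zero, add_zero] at h2 h3
  rw [h1.self_of_nhds, one_smul] at h2
  have h4 : E.ev m (E.bracket X D) = 0 := left_eq_add.1 h2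
  rw [h3, h4, smul_zero, add_zero]

/-- Linear combinations of sections, and their brackets. -/
theorem exists_sum (hE : E.IsLieAlgebroid) (X₀ : E.Sec) {κ : Type*} (s : Finset κ)
    (f : κ → C^∞⟮modelM n, M; ℝ⟯) (e : κ → E.Sec) :
    ∃ Y : E.Sec, (∀ m, E.ev m Y = ∑ i ∈ s, f i m • E.ev m (e i)) ∧
      ∀ X m, E.ev m (E.bracket X Y) = ∑ i ∈ s, (f i m • E.ev m (E.bracket X (e i)) +
        E.anchor m (E.ev m X) (f i) • E.ev m (e i)) := by
  classical
  induction s using Finset.induction_on with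
  | empty =>
    obtain ⟨O, hO⟩ := hE.exists_zero X₀
    exact ⟨O, by simpa using hO, fun X m => by simpa using hE.bracket_zero X hO m⟩
  | insert a s ha ih =>
    obtain ⟨Y, h1, h2⟩ := ih
    obtain ⟨V, hV⟩ := hE.exists_add_smul Y (e a) (f a)
    refine ⟨V, fun m => ?_, fun X m => ?_⟩
    · rw [hV, h1, Finset.sum_insert ha, add_comm]
    · rw [hE.bracket_leibniz X Y (e a) V (f a) hV, h2, Finset.sum_insert ha, add_comm _ (∑ i ∈ s, _),
        add_assoc, add_comm]

theorem bracket_eq_sum (hE : E.IsLieAlgebroid) {κ : Type*} [Fintype κ] {m : M} {e : κ → E.Sec}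
    {X Y : E.Sec} {f : κ → C^∞⟮modelM n, M; ℝ⟯}
    (hY : ∀ᶠ x in 𝓝 m, E.ev x Y = ∑ i, f i x • E.ev x (e i)) :
    E.ev m (E.bracket X Y) = ∑ i, (f i m • E.ev m (E.bracket X (e i)) +
        E.anchor m (E.ev m X) (f i) • E.ev m (e i)) := by
  obtain ⟨Y', h1, h2⟩ := hE.exists_sum X Finset.univ f e
  rw [hE.bracket_congr X (Y' := Y'), h2]
  filter_upwards [hY] with x hx
  rw [hx, h1]

theorem bracket_eq_sum_sum (hE : E.IsLieAlgebroid) {κ : Type*} [Fintype κ] {m : M}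
    {e : κ → E.Sec} {X Y : E.Sec} {f g : κ → C^∞⟮modelM n, M; ℝ⟯}
    (hX : ∀ᶠ x in 𝓝 m, E.ev x X = ∑ i, f i x • E.ev x (e i))
    (hY : ∀ᶠ x in 𝓝 m, E.ev x Y = ∑ i, g i x • E.ev x (e i)) :
    E.ev m (E.bracket X Y) = ∑ i, f i m • (∑ j, E.anchor m (E.ev m (e i)) (g j) • E.ev m (e j)) -
      ∑ i, g i m • (∑ j, E.anchor m (E.ev m (e i)) (f j) • E.ev m (e j)) +
      ∑ i, ∑ j, (f i m * g j m) • E.ev m (E.bracket (e i) (e j)) := by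
  rw [hE.bracket_eq_sum hY, Finset.sum_add_distrib]
  -- The Leibniz rule is available only in the second slot; antisymmetry brings the expansion of X
  -- there.
  have h1 : ∀ j, E.ev m (E.bracket X (e j)) =
      -∑ i, (f i m • E.ev m (E.bracket (e j) (e i)) +
        E.anchor m (E.ev m (e j)) (f i) • E.ev m (e i)) := by
    intro j
    rw [hE.bracket_swap, hE.bracket_eq_sum hX]
  have h2 : ∀ j, E.anchor m (E.ev m X) (g j) = ∑ i, f i m * E.anchor m (E.ev m (e i)) (g j) := by
    intro j
    rw [hX.self_of_nhds, hE.anchor_sum]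
  have h3 : ∀ i j, E.ev m (E.bracket (e j) (e i)) = -E.ev m (E.bracket (e i) (e j)) :=
    fun i j => hE.bracket_swap _ _ m
  simp only [h1, h2, Finset.sum_add_distrib, neg_add, smul_add, smul_neg, Finset.smul_sum,
    Finset.sum_smul, Finset.sum_neg_distrib, smul_smul]
  rw [Finset.sum_comm (f := fun j i => (f i m * E.anchor m (E.ev m (e i)) (g j)) • E.ev m (e j))]
  have h4 : ∑ j, ∑ i, (g j m * f i m) • E.ev m (E.bracket (e j) (e i)) =
      -∑ i, ∑ j, (f i m * g j m) • E.ev m (E.bracket (e i) (e j)) := by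
    rw [Finset.sum_comm, ← Finset.sum_neg_distrib]
    refine Finset.sum_congr rfl fun i _ => ?_
    rw [← Finset.sum_neg_distrib]
    refine Finset.sum_congr rfl fun j _ => ?_
    rw [h3 i j, smul_neg, mul_comm]
  rw [h4]
  abel

end IsLieAlgebroid

end

end LieAlgebroidData

/-! ### Differentiation in a local frame and the Schouten bracket at one point. -/

namespace LieAlgebroidData

section

variable {n : ℕ} {M : Type*} [TopologicalSpace M] [ChartedSpace (EuclideanSpace ℝ (Fin n)) M]
  {E : LieAlgebroidData.{_, v} n M}

open scoped TensorProduct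

/-- The identification of nearby fibres defined by a local frame. -/
noncomputable def transport {κ : Type*} [Fintype κ] (e : κ → E.Sec) (θ : κ → E.OneForm) (m x : M) :
    E.Fib x →ₗ[ℝ] E.Fib m :=
  ∑ i, ((θ i).1 x).smulRight (E.ev m (e i))

theorem transport_apply {κ : Type*} [Fintype κ] (e : κ → E.Sec) (θ : κ → E.OneForm) (m x : M)
    (v : E.Fib x) : transport e θ m x v = ∑ i, (θ i).1 x v • E.ev m (e i) := by
  simp [transport]

/-- A tensor representing a multisection near a point, in the trivialization of a local frame. -/
def Represents {κ : Type*} [Fintype κ] (e : κ → E.Sec) (θ : κ → E.OneForm) (m : M)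
    (t : C^∞⟮modelM n, M; ℝ⟯ ⊗[ℝ] ExteriorAlgebra ℝ (E.Fib m)) (P : E.Multi) : Prop :=
  ∀ᶠ x in 𝓝 m, tensorEval _ x t = ExteriorAlgebra.map (transport e θ m x) (P.1 x)

section

variable {κ : Type*} [Fintype κ] {e : κ → E.Sec} {θ : κ → E.OneForm} {m : M}
  {s t : C^∞⟮modelM n, M; ℝ⟯ ⊗[ℝ] ExteriorAlgebra ℝ (E.Fib m)} {P Q : E.Multi}

theorem Represents.add (hs : Represents e θ m s P) (ht : Represents e θ m t Q) :
    Represents e θ m (s + t) (P + Q) := by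
  filter_upwards [hs, ht] with x h1 h2
  rw [map_add, h1, h2, add_apply, map_add]

theorem Represents.smul (hs : Represents e θ m s P) (c : ℝ) :
    Represents e θ m (c • s) (c • P) := by
  filter_upwards [hs] with x h1
  rw [map_smul, h1, smul_apply, map_smul]

theorem Represents.mul (hs : Represents e θ m s P) (ht : Represents e θ m t Q) :
    Represents e θ m (s * t) (P * Q) := by
  filter_upwards [hs, ht] with x h1 h2
  rw [tensorEval_mul, h1, h2, mul_apply, map_mul]

theorem represents_ofFun (f : C^∞⟮modelM n, M; ℝ⟯) :
    Represents e θ m (f ⊗ₜ 1) (E.ofFun f) :=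
  Filter.Eventually.of_forall fun x => by
    rw [tensorEval_tmul, ofFun_apply, AlgHom.commutes, Algebra.algebraMap_eq_smul_one]

theorem represents_ofSec {X : E.Sec} {g : κ → C^∞⟮modelM n, M; ℝ⟯}
    (h : ∀ j x, (θ j).1 x (E.ev x X) = g j x) :
    Represents e θ m (∑ j, g j ⊗ₜ ExteriorAlgebra.ι ℝ (E.ev m (e j))) (E.ofSec X) :=
  Filter.Eventually.of_forall fun x => by
    simp only [map_sum, tensorEval_tmul, ofSec_apply, ExteriorAlgebra.map_apply_ι, transport_apply,
      h, map_smul]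

theorem exists_represents (e : κ → E.Sec) (θ : κ → E.OneForm) (m : M) (P : E.Multi) :
    ∃ t, Represents e θ m t P := by
  have h : ∀ Q : E.Multi, Q.1 ∈ E.polyFamilies → ∃ t, Represents e θ m t Q := by
    intro Q hQ
    refine poly_induction (motive := fun Q => ∃ t, Represents e θ m t Q) ?_ ?_ ?_ ?_ hQ
    · rw [← ofFun_one]; exact ⟨_, represents_ofFun 1⟩
    · rintro P Q ⟨s, hs⟩ ⟨t, ht⟩; exact ⟨_, hs.add ht⟩
    · rintro f P ⟨s, hs⟩; exact ⟨_, (represents_ofFun f).mul hs⟩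
    · rintro X P ⟨s, hs⟩
      choose g hg using fun j => (θ j).2 X
      exact ⟨_, (represents_ofSec hg).mul hs⟩
  obtain ⟨Q, hQ, he⟩ := P.2 m
  obtain ⟨t, ht⟩ := h ⟨Q, E.mem_grassmann_of_mem_poly hQ⟩ hQ
  refine ⟨t, ?_⟩
  filter_upwards [he, ht] with x h1 h2
  rw [h2, h1]

/-- Two tensors representing the same multisection define the same germ of functions at m, so the
arbitrary choice in `frameDeriv` is harmless. -/
theorem Represents.deriv_unique (hE : E.IsLieAlgebroid) (hs : Represents e θ m s P)
    (ht : Represents e θ m t P) (v : E.Fib m) :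
    tensorDeriv (hE.anchorDeriv m v) s = tensorDeriv (hE.anchorDeriv m v) t := by
  rw [← sub_eq_zero, ← map_sub]
  refine tensorDeriv_eq_zero (m := m) (fun f hf => hE.anchor_eq_zero v hf) ?_
  filter_upwards [hs, ht] with x h1 h2
  rw [map_sub, h1, h2, sub_self]

/-- At the centre m the identification of fibres is the identity, since e and θ are dual there. -/
theorem Represents.eval (h : ∀ v : E.Fib m, v = ∑ i, (θ i).1 m v • E.ev m (e i))
    (hs : Represents e θ m s P) : tensorEval _ m s = P.1 m := by
  rw [hs.self_of_nhds]
  have : transport e θ m m = LinearMap.id := by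
    ext1 v; rw [transport_apply, ← h v]; rfl
  rw [this, ExteriorAlgebra.map_id]; rfl

/-- The derivative of multisections at a point, in the trivialization of a local frame. -/
noncomputable def frameDeriv (hE : E.IsLieAlgebroid) (e : κ → E.Sec) (θ : κ → E.OneForm) (m : M)
    (v : E.Fib m) : E.Multi →ₗ[ℝ] ExteriorAlgebra ℝ (E.Fib m) where
  toFun P := tensorDeriv (hE.anchorDeriv m v) (exists_represents e θ m P).choose
  map_add' P Q := by
    rw [(exists_represents e θ m (P + Q)).choose_spec.deriv_unique hE
      ((exists_represents e θ m P).choose_spec.add (exists_represents e θ m Q).choose_spec), map_add]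
  map_smul' c P := by
    rw [(exists_represents e θ m (c • P)).choose_spec.deriv_unique hE
      ((exists_represents e θ m P).choose_spec.smul c), map_smul]; rfl

theorem frameDeriv_eq (hE : E.IsLieAlgebroid) (v : E.Fib m) (ht : Represents e θ m t P) :
    frameDeriv hE e θ m v P = tensorDeriv (hE.anchorDeriv m v) t :=
  (exists_represents e θ m P).choose_spec.deriv_unique hE ht v

theorem frameDeriv_mul (hE : E.IsLieAlgebroid)
    (h : ∀ v : E.Fib m, v = ∑ i, (θ i).1 m v • E.ev m (e i)) (v : E.Fib m) (P Q : E.Multi) :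
    frameDeriv hE e θ m v (P * Q) =
      frameDeriv hE e θ m v P * Q.1 m + P.1 m * frameDeriv hE e θ m v Q := by
  obtain ⟨s, hs⟩ := exists_represents e θ m P
  obtain ⟨t, ht⟩ := exists_represents e θ m Q
  rw [frameDeriv_eq hE v hs, frameDeriv_eq hE v ht, frameDeriv_eq hE v (hs.mul ht),
    tensorDeriv_mul (m := m) (hE.anchor_fun_mul m v), hs.eval h, ht.eval h]

theorem frameDeriv_ofFun (hE : E.IsLieAlgebroid) (v : E.Fib m) (f : C^∞⟮modelM n, M; ℝ⟯) :
    frameDeriv hE e θ m v (E.ofFun f) = algebraMap ℝ _ (E.anchor m v f) := by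
  rw [frameDeriv_eq hE v (represents_ofFun f), tensorDeriv_tmul, Algebra.algebraMap_eq_smul_one]
  rfl

theorem frameDeriv_ofSec (hE : E.IsLieAlgebroid) (v : E.Fib m) {X : E.Sec}
    {g : κ → C^∞⟮modelM n, M; ℝ⟯} (h : ∀ j x, (θ j).1 x (E.ev x X) = g j x) :
    frameDeriv hE e θ m v (E.ofSec X) =
      ExteriorAlgebra.ι ℝ (∑ j, E.anchor m v (g j) • E.ev m (e j)) := by
  rw [frameDeriv_eq hE v (represents_ofSec h), map_sum, map_sum]
  refine Finset.sum_congr rfl fun j _ => ?_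
  rw [tensorDeriv_tmul, map_smul]; rfl

theorem frameDeriv_mem (hE : E.IsLieAlgebroid) (v : E.Fib m) {p : ℕ} (hP : P ∈ E.degree p) :
    frameDeriv hE e θ m v P ∈ ⋀[ℝ]^p (E.Fib m) := by
  obtain ⟨t, ht⟩ := exists_represents e θ m P
  -- Identifications of fibres preserve degree, so projecting the representing tensor to degree p
  -- still represents P, and differentiation commutes with the projection.
  have h1 : Represents e θ m ((ExteriorAlgebra.component p).lTensor _ t) P := by
    filter_upwards [ht] with x hx
    rw [tensorEval_map, hx,
      ExteriorAlgebra.component_of_mem (ExteriorAlgebra.exteriorAlgebraMap_mem_pow _ (hP x))]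
  rw [frameDeriv_eq hE v h1, tensorDeriv_map]
  exact ExteriorAlgebra.component_mem _ _

end

open ExteriorAlgebra

section

variable {κ : Type*} [Fintype κ] {m : M}

/-- The Schouten bracket at a point in terms of a local frame `e`, with derivatives `δ i` along
`e i`, dual covectors `θ i` and structure vectors `t i j`. -/
noncomputable def frameBracket (δ : κ → E.Multi →ₗ[ℝ] ExteriorAlgebra ℝ (E.Fib m))
    (θ : κ → Module.Dual ℝ (E.Fib m)) (t : κ → κ → E.Fib m) (P Q : E.Multi) :
    ExteriorAlgebra ℝ (E.Fib m) :=
  ∑ i, CliffordAlgebra.involute (contr (θ i) (P.1 m)) * δ i Q -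
    ∑ i, δ i P * contr (θ i) (Q.1 m) +
    ∑ i, ∑ j, CliffordAlgebra.involute (contr (θ i) (P.1 m)) * ι ℝ (t i j) * contr (θ j) (Q.1 m)

variable {δ : κ → E.Multi →ₗ[ℝ] ExteriorAlgebra ℝ (E.Fib m)}
    {θ : κ → Module.Dual ℝ (E.Fib m)} {t : κ → κ → E.Fib m}

theorem frameBracket_add_left (P P' Q : E.Multi) :
    frameBracket δ θ t (P + P') Q = frameBracket δ θ t P Q + frameBracket δ θ t P' Q := by
  simp only [frameBracket, add_apply, map_add, add_mul, Finset.sum_add_distrib]; abel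

theorem frameBracket_smul_left (c : ℝ) (P Q : E.Multi) :
    frameBracket δ θ t (c • P) Q = c • frameBracket δ θ t P Q := by
  simp only [frameBracket, smul_apply, map_smul, smul_mul_assoc, ← Finset.smul_sum, smul_add,
    smul_sub]

theorem frameBracket_add_right (P Q Q' : E.Multi) :
    frameBracket δ θ t P (Q + Q') = frameBracket δ θ t P Q + frameBracket δ θ t P Q' := by
  simp only [frameBracket, add_apply, map_add, mul_add, Finset.sum_add_distrib]; abel

theorem frameBracket_smul_right (c : ℝ) (P Q : E.Multi) :
    frameBracket δ θ t P (c • Q) = c • frameBracket δ θ t P Q := by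
  simp only [frameBracket, smul_apply, map_smul, mul_smul_comm, ← Finset.smul_sum, smul_add,
    smul_sub]

theorem frameBracket_mem (hδ : ∀ i p P, P ∈ E.degree p → δ i P ∈ ⋀[ℝ]^p (E.Fib m)) {p q r : ℕ}
    {P Q : E.Multi} (hP : P ∈ E.degree p) (hQ : Q ∈ E.degree q) (h : p + q = r + 1) :
    frameBracket δ θ t P Q ∈ ⋀[ℝ]^r (E.Fib m) := by
  have h1 : ∀ i, ∀ y ∈ ⋀[ℝ]^q (E.Fib m),
      CliffordAlgebra.involute (contr (θ i) (P.1 m)) * y ∈ ⋀[ℝ]^r (E.Fib m) := by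
    intro i y hy
    rw [involute_contr (θ i) (hP m), smul_mul_assoc]
    refine Submodule.smul_mem _ _ ?_
    rcases p with _ | p
    · rw [(contr_mem (θ i) (hP m)).2 rfl, zero_mul]; exact zero_mem _
    · have := mul_mem_pow (contr_mem_succ (θ i) (hP m)) hy
      rwa [show p + q = r by omega] at this
  have h2 : ∀ i, ∀ y ∈ ⋀[ℝ]^p (E.Fib m), y * contr (θ i) (Q.1 m) ∈ ⋀[ℝ]^r (E.Fib m) := by
    intro i y hy
    rcases q with _ | q
    · rw [(contr_mem (θ i) (hQ m)).2 rfl, mul_zero]; exact zero_mem _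
    · have := mul_mem_pow hy (contr_mem_succ (θ i) (hQ m))
      rwa [show p + q = r by omega] at this
  refine add_mem (sub_mem ?_ ?_) ?_
  · exact sum_mem fun i _ => h1 i _ (hδ i q Q hQ)
  · exact sum_mem fun i _ => h2 i _ (hδ i p P hP)
  · refine sum_mem fun i _ => sum_mem fun j _ => ?_
    rw [mul_assoc]
    rcases q with _ | q
    · rw [(contr_mem (θ j) (hQ m)).2 rfl, mul_zero, mul_zero]; exact zero_mem _
    · refine h1 i _ ?_
      have := mul_mem_pow (ι_mem_one (t i j)) (contr_mem_succ (θ j) (hQ m))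
      rwa [add_comm] at this

/-- Each δ i is a derivation and each contraction an antiderivation. The common sign comes from
moving Q past a factor of degree p − 1 in the first sum, and in the other two past a factor of
degree p together with the sign (−1)^q of the contraction. -/
theorem frameBracket_leibniz (hδ : ∀ i p P, P ∈ E.degree p → δ i P ∈ ⋀[ℝ]^p (E.Fib m))
    (hm : ∀ i P Q, δ i (P * Q) = δ i P * Q.1 m + P.1 m * δ i Q) {p q : ℕ}
    {P Q : E.Multi} (hP : P ∈ E.degree p) (hQ : Q ∈ E.degree q) (R : E.Multi) :
    frameBracket δ θ t P (Q * R) = frameBracket δ θ t P Q * R.1 m +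
      (-1 : ℝ) ^ ((p + 1) * q) • (Q.1 m * frameBracket δ θ t P R) := by
  have h1 : ∀ i, CliffordAlgebra.involute (contr (θ i) (P.1 m)) * Q.1 m =
      (-1 : ℝ) ^ ((p + 1) * q) • (Q.1 m * CliffordAlgebra.involute (contr (θ i) (P.1 m))) := by
    intro i
    rw [involute_contr (θ i) (hP m)]
    rcases p with _ | p
    · rw [(contr_mem (θ i) (hP m)).2 rfl]; simp
    · rw [smul_mul_assoc, mul_comm_of_mem (contr_mem_succ (θ i) (hP m)) (hQ m), mul_smul_comm,
        smul_smul, smul_smul]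
      rcases neg_one_pow_eq_or ℝ p with hp | hp <;> rcases neg_one_pow_eq_or ℝ q with hq | hq <;>
        simp [pow_add, pow_mul, hp, hq]
  have h2 : ∀ y ∈ ⋀[ℝ]^p (E.Fib m), (-1 : ℝ) ^ q • (y * Q.1 m) =
      (-1 : ℝ) ^ ((p + 1) * q) • (Q.1 m * y) := by
    intro y hy
    rw [mul_comm_of_mem hy (hQ m), smul_smul]
    rcases neg_one_pow_eq_or ℝ p with hp | hp <;> rcases neg_one_pow_eq_or ℝ q with hq | hq <;>
        simp [pow_add, pow_mul, hp, hq]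
  have h3 : ∀ i j, (-1 : ℝ) ^ q • (CliffordAlgebra.involute (contr (θ i) (P.1 m)) *
      ι ℝ (t i j) * Q.1 m) = (-1 : ℝ) ^ ((p + 1) * q) •
      (Q.1 m * (CliffordAlgebra.involute (contr (θ i) (P.1 m)) * ι ℝ (t i j))) := by
    intro i j
    rcases p with _ | p
    · rw [(contr_mem (θ i) (hP m)).2 rfl]; simp
    · apply h2
      rw [involute_contr (θ i) (hP m), smul_mul_assoc]
      exact Submodule.smul_mem _ _ (mul_mem_pow (contr_mem_succ (θ i) (hP m)) (ι_mem_one _))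
  have e1 : ∀ i, CliffordAlgebra.involute (contr (θ i) (P.1 m)) * δ i (Q * R) =
      CliffordAlgebra.involute (contr (θ i) (P.1 m)) * δ i Q * R.1 m +
      (-1 : ℝ) ^ ((p + 1) * q) •
        (Q.1 m * (CliffordAlgebra.involute (contr (θ i) (P.1 m)) * δ i R)) := by
    intro i
    rw [hm, mul_add, ← mul_assoc, ← mul_assoc, h1, smul_mul_assoc, mul_assoc (Q.1 m)]
  have e2 : ∀ i, δ i P * contr (θ i) ((Q * R).1 m) = δ i P * contr (θ i) (Q.1 m) * R.1 m +
      (-1 : ℝ) ^ ((p + 1) * q) • (Q.1 m * (δ i P * contr (θ i) (R.1 m))) := by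
    intro i
    rw [mul_apply, contr_mul _ (hQ m), mul_add, ← mul_assoc, mul_smul_comm, ← mul_assoc,
      ← smul_mul_assoc, h2 _ (hδ i p P hP), smul_mul_assoc, mul_assoc (Q.1 m)]
  have e3 : ∀ i j, CliffordAlgebra.involute (contr (θ i) (P.1 m)) * ι ℝ (t i j) *
      contr (θ j) ((Q * R).1 m) =
      CliffordAlgebra.involute (contr (θ i) (P.1 m)) * ι ℝ (t i j) * contr (θ j) (Q.1 m) * R.1 m +
      (-1 : ℝ) ^ ((p + 1) * q) • (Q.1 m * (CliffordAlgebra.involute (contr (θ i) (P.1 m)) *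
        ι ℝ (t i j) * contr (θ j) (R.1 m))) := by
    intro i j
    rw [mul_apply, contr_mul _ (hQ m), mul_add, ← mul_assoc, mul_smul_comm,
      ← mul_assoc _ (Q.1 m), ← smul_mul_assoc, h3, smul_mul_assoc, mul_assoc (Q.1 m)]
  simp only [frameBracket, e1, e2, e3, Finset.sum_add_distrib, add_mul, sub_mul, mul_add, mul_sub,
    smul_add, smul_sub, Finset.sum_mul, Finset.mul_sum, Finset.smul_sum]
  abel

/-- Graded commutativity exchanges the first two sums; the third returns to itself after exchanging
i and j, by the skew-symmetry of the structure vectors. -/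
theorem frameBracket_antisymm (hδ : ∀ i p P, P ∈ E.degree p → δ i P ∈ ⋀[ℝ]^p (E.Fib m))
    (ht : ∀ i j, t i j = -t j i) {p q : ℕ} {P Q : E.Multi} (hP : P ∈ E.degree p)
    (hQ : Q ∈ E.degree q) :
    frameBracket δ θ t P Q = -((-1 : ℝ) ^ ((p + 1) * (q + 1)) • frameBracket δ θ t Q P) := by
  have key : ∀ {p q : ℕ} {P Q : E.Multi}, P ∈ E.degree p → Q ∈ E.degree q → ∀ i,
      CliffordAlgebra.involute (contr (θ i) (P.1 m)) * δ i Q =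
      (-1 : ℝ) ^ ((p + 1) * (q + 1)) • (δ i Q * contr (θ i) (P.1 m)) := by
    intro p q P Q hP hQ i
    rw [involute_contr (θ i) (hP m)]
    rcases p with _ | p
    · rw [(contr_mem (θ i) (hP m)).2 rfl]; simp
    · rw [smul_mul_assoc, mul_comm_of_mem (contr_mem_succ (θ i) (hP m)) (hδ i q Q hQ), smul_smul]
      rcases neg_one_pow_eq_or ℝ p with hp | hp <;> rcases neg_one_pow_eq_or ℝ q with hq | hq <;>
        simp [pow_add, pow_mul, hp, hq]
  have key3 : ∀ i j, CliffordAlgebra.involute (contr (θ i) (P.1 m)) * ι ℝ (t i j) *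
      contr (θ j) (Q.1 m) = -((-1 : ℝ) ^ ((p + 1) * (q + 1)) •
      (CliffordAlgebra.involute (contr (θ j) (Q.1 m)) * ι ℝ (t j i) * contr (θ i) (P.1 m))) := by
    intro i j
    rw [involute_contr (θ i) (hP m), involute_contr (θ j) (hQ m), ht i j]
    rcases p with _ | p
    · rw [(contr_mem (θ i) (hP m)).2 rfl]; simp
    rcases q with _ | q
    · rw [(contr_mem (θ j) (hQ m)).2 rfl]; simp
    have c1 := contr_mem_succ (θ i) (hP m)
    have c2 := contr_mem_succ (θ j) (hQ m)
    simp only [smul_mul_assoc, map_neg, mul_neg, neg_mul]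
    rw [mul_comm_of_mem (mul_mem_pow c1 (ι_mem_one (t j i))) c2, ← mul_assoc,
      mul_assoc (contr (θ j) (Q.1 m)) (contr (θ i) (P.1 m)), mul_comm_of_mem c1 (ι_mem_one (t j i))]
    simp only [mul_smul_comm, smul_smul, ← mul_assoc]
    rcases neg_one_pow_eq_or ℝ p with hp | hp <;> rcases neg_one_pow_eq_or ℝ q with hq | hq <;>
      simp [pow_add, pow_mul, hp, hq]
  have s1 : ∑ i, CliffordAlgebra.involute (contr (θ i) (P.1 m)) * δ i Q =
      (-1 : ℝ) ^ ((p + 1) * (q + 1)) • ∑ i, δ i Q * contr (θ i) (P.1 m) := by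
    rw [Finset.smul_sum]; exact Finset.sum_congr rfl fun i _ => key hP hQ i
  have s2 : (-1 : ℝ) ^ ((p + 1) * (q + 1)) •
      ∑ i, CliffordAlgebra.involute (contr (θ i) (Q.1 m)) * δ i P =
      ∑ i, δ i P * contr (θ i) (Q.1 m) := by
    rw [Finset.smul_sum]
    refine Finset.sum_congr rfl fun i _ => ?_
    rw [key hQ hP i, smul_smul, mul_comm (q + 1), IsSchoutenBracket.neg_one_pow_sq, one_smul]
  have s3 : ∑ i, ∑ j, CliffordAlgebra.involute (contr (θ i) (P.1 m)) * ι ℝ (t i j) *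
      contr (θ j) (Q.1 m) = -((-1 : ℝ) ^ ((p + 1) * (q + 1)) •
      ∑ i, ∑ j, CliffordAlgebra.involute (contr (θ i) (Q.1 m)) * ι ℝ (t i j) *
        contr (θ j) (P.1 m)) := by
    rw [Finset.sum_comm]
    simp only [key3, Finset.sum_neg_distrib, ← Finset.smul_sum]
  rw [frameBracket, frameBracket, s1, s3, smul_add, smul_sub, s2]
  abel

end

end

end LieAlgebroidData

/-! ### Existence of the Schouten bracket: from pointwise formulas to smooth multisections. -/

namespace LieAlgebroidData

section

variable {n : ℕ} {M : Type*} [TopologicalSpace M] [ChartedSpace (EuclideanSpace ℝ (Fin n)) M]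
  {E : LieAlgebroidData.{_, v} n M}

open ExteriorAlgebra

theorem frameDeriv_congr {κ : Type*} [Fintype κ] {e : κ → E.Sec} {θ : κ → E.OneForm} {m : M}
    (hE : E.IsLieAlgebroid) (v : E.Fib m) {P P' : E.Multi} (h : ∀ᶠ x in 𝓝 m, P.1 x = P'.1 x) :
    frameDeriv hE e θ m v P = frameDeriv hE e θ m v P' := by
  obtain ⟨t, ht⟩ := exists_represents e θ m P
  have ht' : Represents e θ m t P' := by
    filter_upwards [h, ht] with x h1 h2
    rw [h2, h1]
  rw [frameDeriv_eq hE v ht, frameDeriv_eq hE v ht']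

/-- The properties of the Schouten bracket at a point. -/
structure IsPointwiseSchouten {m : M} (s : E.Multi → E.Multi → ExteriorAlgebra ℝ (E.Fib m)) :
    Prop where
  add_left : ∀ P P' Q, s (P + P') Q = s P Q + s P' Q
  smul_left : ∀ (c : ℝ) P Q, s (c • P) Q = c • s P Q
  add_right : ∀ P Q Q', s P (Q + Q') = s P Q + s P Q'
  smul_right : ∀ (c : ℝ) P Q, s P (c • Q) = c • s P Q
  congr : ∀ {P P' Q Q' : E.Multi}, (∀ᶠ x in 𝓝 m, P.1 x = P'.1 x) →
    (∀ᶠ x in 𝓝 m, Q.1 x = Q'.1 x) → s P Q = s P' Q'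
  fun_fun : ∀ f g, s (E.ofFun f) (E.ofFun g) = 0
  sec_fun : ∀ X f, s (E.ofSec X) (E.ofFun f) = algebraMap ℝ _ (E.anchor m (E.ev m X) f)
  sec_sec : ∀ X Y, s (E.ofSec X) (E.ofSec Y) = ι ℝ (E.ev m (E.bracket X Y))
  degree : ∀ p q r P Q, P ∈ E.degree p → Q ∈ E.degree q → p + q = r + 1 →
    s P Q ∈ ⋀[ℝ]^r (E.Fib m)
  antisymm : ∀ p q P Q, P ∈ E.degree p → Q ∈ E.degree q →
    s P Q = -((-1 : ℝ) ^ ((p + 1) * (q + 1)) • s Q P)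
  leibniz : ∀ p q P Q R, P ∈ E.degree p → Q ∈ E.degree q →
    s P (Q * R) = s P Q * R.1 m + (-1 : ℝ) ^ ((p + 1) * q) • (Q.1 m * s P R)

/-- The frame formula is used only at the centre m of its frame. No comparison between frames is
needed: smoothness in m will follow from the algebraic properties alone. -/
theorem IsLieAlgebroid.exists_pointwiseSchouten (hE : E.IsLieAlgebroid) (m : M) :
    ∃ s : E.Multi → E.Multi → ExteriorAlgebra ℝ (E.Fib m), IsPointwiseSchouten s := by
  obtain ⟨κ, _, e, θ, -, -, -, hF⟩ := hE.frame m
  have h0 := hF.self_of_nhds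
  have hδ := fun i p (P : E.Multi) (hP : P ∈ E.degree p) =>
    frameDeriv_mem (e := e) (θ := θ) hE (E.ev m (e i)) hP
  refine ⟨frameBracket (fun i => frameDeriv hE e θ m (E.ev m (e i))) (fun i => (θ i).1 m)
    (fun i j => E.ev m (E.bracket (e i) (e j))), ?_⟩
  refine ⟨frameBracket_add_left, frameBracket_smul_left, frameBracket_add_right,
    frameBracket_smul_right, ?_, ?_, ?_, ?_, ?_, ?_, ?_⟩
  · intro P P' Q Q' h h'
    simp only [frameBracket, h.self_of_nhds, h'.self_of_nhds, frameDeriv_congr hE _ h,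
      frameDeriv_congr hE _ h']
  · intro f g
    simp [frameBracket, ofFun_apply]
  · intro X f
    have h1 : E.anchor m (E.ev m X) f =
        ∑ i, (θ i).1 m (E.ev m X) * E.anchor m (E.ev m (e i)) f := by
      conv_lhs => rw [h0 (E.ev m X)]
      exact hE.anchor_sum m _ _ _ f
    simp only [frameBracket, ofFun_apply, contr_algebraMap, mul_zero, Finset.sum_const_zero,
      sub_zero, add_zero, ofSec_apply, contr_ι, AlgHom.commutes, frameDeriv_ofFun, h1, map_sum,
      map_mul]
  · intro X Y
    choose f hf using fun j => (θ j).2 X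
    choose g hg using fun j => (θ j).2 Y
    have hX : ∀ᶠ x in 𝓝 m, E.ev x X = ∑ i, f i x • E.ev x (e i) := by
      filter_upwards [hF] with x hx
      rw [hx (E.ev x X)]
      exact Finset.sum_congr rfl fun i _ => by rw [hf]
    have hY : ∀ᶠ x in 𝓝 m, E.ev x Y = ∑ i, g i x • E.ev x (e i) := by
      filter_upwards [hF] with x hx
      rw [hx (E.ev x Y)]
      exact Finset.sum_congr rfl fun i _ => by rw [hg]
    -- On two sections the three sums of the frame formula are the three sums in the expansion of
    -- the bracket of sections in the frame.
    rw [hE.bracket_eq_sum_sum hX hY]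
    simp only [frameBracket, ofSec_apply, contr_ι, AlgHom.commutes, hf, hg,
      frameDeriv_ofSec hE _ hf, frameDeriv_ofSec hE _ hg]
    rw [map_add, map_sub, map_sum, map_sum, map_sum]
    congr 1
    · congr 1
      · refine Finset.sum_congr rfl fun i _ => ?_
        rw [map_smul (ι ℝ), Algebra.smul_def]
      · refine Finset.sum_congr rfl fun i _ => ?_
        rw [map_smul (ι ℝ), ← Algebra.commutes, Algebra.smul_def]
    · refine Finset.sum_congr rfl fun i _ => ?_
      rw [map_sum]
      refine Finset.sum_congr rfl fun j _ => ?_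
      rw [map_smul, ← Algebra.commutes, ← mul_assoc, ← map_mul, Algebra.smul_def, mul_comm (g j m)]
  · intro p q r P Q hP hQ h
    exact frameBracket_mem hδ hP hQ h
  · intro p q P Q hP hQ
    exact frameBracket_antisymm hδ (fun i j => hE.bracket_swap _ _ m) hP hQ
  · intro p q P Q R hP hQ
    exact frameBracket_leibniz hδ (fun i P Q => frameDeriv_mul hE h0 _ P Q) hP hQ R

/-- The antisymmetry and Leibniz rules apply only to homogeneous first arguments; linearity extends
their consequences to all polynomial families. -/
theorem mem_span_homogeneous {P : E.Multi} (hP : P.1 ∈ E.polyFamilies) :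
    P ∈ Submodule.span ℝ {Q : E.Multi | Q.1 ∈ E.polyFamilies ∧ ∃ p, Q ∈ E.degree p} := by
  have key : ∀ {p : ℕ} {A : E.Multi}, A.1 ∈ E.polyFamilies → A ∈ E.degree p → ∀ {P : E.Multi},
      P ∈ Submodule.span ℝ {Q : E.Multi | Q.1 ∈ E.polyFamilies ∧ ∃ p, Q ∈ E.degree p} →
      A * P ∈ Submodule.span ℝ {Q : E.Multi | Q.1 ∈ E.polyFamilies ∧ ∃ p, Q ∈ E.degree p} := by
    intro p A hA hAp P hP
    induction hP using Submodule.span_induction with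
    | zero => rw [mul_zero]; exact zero_mem _
    | add x y _ _ hx hy => rw [mul_add]; exact add_mem hx hy
    | smul c x _ hx => rw [mul_smul_comm]; exact Submodule.smul_mem _ _ hx
    | mem x hx =>
      obtain ⟨h1, q, hq⟩ := hx
      exact Submodule.subset_span ⟨mul_mem hA h1, _, mul_mem_degree hAp hq⟩
  refine poly_induction (motive := fun P => P ∈ Submodule.span ℝ _) ?_ ?_ ?_ ?_ hP
  · exact Submodule.subset_span ⟨one_mem _, 0, one_mem_degree⟩
  · intro P Q hP hQ; exact add_mem hP hQ
  · intro f P hP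
    exact key (Algebra.subset_adjoin (Or.inl ⟨f, rfl⟩)) (ofFun_mem f) hP
  · intro X P hP
    exact key (Algebra.subset_adjoin (Or.inr ⟨X, rfl⟩)) (ofSec_mem X) hP

theorem mem_poly_of_mem_span {P : E.Multi}
    (hP : P ∈ Submodule.span ℝ {Q : E.Multi | Q.1 ∈ E.polyFamilies ∧ ∃ p, Q ∈ E.degree p}) :
    P.1 ∈ E.polyFamilies := by
  have : Submodule.span ℝ {Q : E.Multi | Q.1 ∈ E.polyFamilies ∧ ∃ p, Q ∈ E.degree p} ≤
      (Subalgebra.toSubmodule E.polyFamilies).comap E.grassmann.val.toLinearMap :=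
    Submodule.span_le.2 fun Q hQ => hQ.1
  exact this hP

theorem ofFun_mem_poly (f : C^∞⟮modelM n, M; ℝ⟯) : (E.ofFun f).1 ∈ E.polyFamilies :=
  Algebra.subset_adjoin (Or.inl ⟨f, rfl⟩)

theorem ofSec_mem_poly (X : E.Sec) : (E.ofSec X).1 ∈ E.polyFamilies :=
  Algebra.subset_adjoin (Or.inr ⟨X, rfl⟩)

section

variable {s : ∀ m, E.Multi → E.Multi → ExteriorAlgebra ℝ (E.Fib m)}

theorem pointwise_mem_poly_right (hs : ∀ m, IsPointwiseSchouten (s m)) {p : ℕ} {P : E.Multi}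
    (hP : P ∈ E.degree p) (hf : ∀ f, (fun m => s m P (E.ofFun f)) ∈ E.polyFamilies)
    (hX : ∀ X, (fun m => s m P (E.ofSec X)) ∈ E.polyFamilies) {Q : E.Multi}
    (hQ : Q.1 ∈ E.polyFamilies) : (fun m => s m P Q) ∈ E.polyFamilies := by
  have key : ∀ {q : ℕ} {A R : E.Multi}, A.1 ∈ E.polyFamilies → A ∈ E.degree q →
      (fun m => s m P A) ∈ E.polyFamilies → R.1 ∈ E.polyFamilies →
      (fun m => s m P R) ∈ E.polyFamilies → (fun m => s m P (A * R)) ∈ E.polyFamilies := by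
    intro q A R hA hAq h1 hR h2
    have : (fun m => s m P (A * R)) = (fun m => s m P A) * R.1 +
        (-1 : ℝ) ^ ((p + 1) * q) • (A.1 * fun m => s m P R) := by
      ext1 m
      exact (hs m).leibniz p q P A R hP hAq
    rw [this]
    exact add_mem (mul_mem h1 hR) (Subalgebra.smul_mem _ (mul_mem hA h2) _)
  refine (poly_induction (motive := fun Q => Q.1 ∈ E.polyFamilies ∧
    (fun m => s m P Q) ∈ E.polyFamilies) ?_ ?_ ?_ ?_ hQ).2
  · refine ⟨one_mem _, ?_⟩
    rw [← ofFun_one]; exact hf 1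
  · rintro Q R ⟨h1, h2⟩ ⟨h3, h4⟩
    refine ⟨add_mem h1 h3, ?_⟩
    have : (fun m => s m P (Q + R)) = (fun m => s m P Q) + fun m => s m P R := by
      ext1 m; exact (hs m).add_right P Q R
    rw [this]; exact add_mem h2 h4
  · rintro f Q ⟨h1, h2⟩
    exact ⟨mul_mem (ofFun_mem_poly f) h1, key (ofFun_mem_poly f) (ofFun_mem f) (hf f) h1 h2⟩
  · rintro X Q ⟨h1, h2⟩
    exact ⟨mul_mem (ofSec_mem_poly X) h1, key (ofSec_mem_poly X) (ofSec_mem X) (hX X) h1 h2⟩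

theorem pointwise_swap_mem_poly (hs : ∀ m, IsPointwiseSchouten (s m)) {p q : ℕ} {P Q : E.Multi}
    (hP : P ∈ E.degree p) (hQ : Q ∈ E.degree q) (h : (fun m => s m P Q) ∈ E.polyFamilies) :
    (fun m => s m Q P) ∈ E.polyFamilies := by
  have : (fun m => s m Q P) = -((-1 : ℝ) ^ ((q + 1) * (p + 1)) • fun m => s m P Q) := by
    ext1 m; exact (hs m).antisymm q p Q P hQ hP
  rw [this]
  exact neg_mem (Subalgebra.smul_mem _ h _)

/-- Smoothness is propagated by the same scheme as uniqueness: brackets of generators are smooth,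
the Leibniz rule handles the second argument, and antisymmetry transfers this to the first. -/
theorem pointwise_mem_poly (hE : E.IsLieAlgebroid) (hs : ∀ m, IsPointwiseSchouten (s m))
    {P Q : E.Multi} (hP : P.1 ∈ E.polyFamilies) (hQ : Q.1 ∈ E.polyFamilies) :
    (fun m => s m P Q) ∈ E.polyFamilies := by
  have hXf : ∀ X f, (fun m => s m (E.ofSec X) (E.ofFun f)) ∈ E.polyFamilies := by
    intro X f
    obtain ⟨g, hg⟩ := hE.anchor_smooth X f
    have : (fun m => s m (E.ofSec X) (E.ofFun f)) = (E.ofFun g).1 := by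
      ext1 m; rw [(hs m).sec_fun, hg]; rfl
    rw [this]; exact ofFun_mem_poly g
  have h1 : ∀ f, ∀ Q : E.Multi, Q.1 ∈ E.polyFamilies →
      (fun m => s m (E.ofFun f) Q) ∈ E.polyFamilies := by
    intro f Q hQ
    refine pointwise_mem_poly_right hs (ofFun_mem f) (fun g => ?_) (fun X => ?_) hQ
    · simp only [(hs _).fun_fun]; exact zero_mem _
    · exact pointwise_swap_mem_poly hs (ofSec_mem X) (ofFun_mem f) (hXf X f)
  have h2 : ∀ X, ∀ Q : E.Multi, Q.1 ∈ E.polyFamilies →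
      (fun m => s m (E.ofSec X) Q) ∈ E.polyFamilies := by
    intro X Q hQ
    refine pointwise_mem_poly_right hs (ofSec_mem X) (hXf X) (fun Y => ?_) hQ
    simp only [(hs _).sec_sec]
    exact ofSec_mem_poly (E.bracket X Y)
  have h3 := mem_span_homogeneous hP
  induction h3 using Submodule.span_induction with
  | zero =>
    have : (fun m => s m 0 Q) = 0 := by
      ext1 m
      have := (hs m).smul_left 0 0 Q
      rw [zero_smul, zero_smul] at this
      exact this
    rw [this]; exact zero_mem _
  | add x y hx' hy' hx hy =>
    have : (fun m => s m (x + y) Q) = (fun m => s m x Q) + fun m => s m y Q := by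
      ext1 m; exact (hs m).add_left x y Q
    rw [this]; exact add_mem (hx (mem_poly_of_mem_span hx')) (hy (mem_poly_of_mem_span hy'))
  | smul c x hx' hx =>
    have : (fun m => s m (c • x) Q) = c • fun m => s m x Q := by
      ext1 m; exact (hs m).smul_left c x Q
    rw [this]; exact Subalgebra.smul_mem _ (hx (mem_poly_of_mem_span hx')) _
  | mem x hx =>
    obtain ⟨hx1, p, hp⟩ := hx
    exact pointwise_mem_poly_right hs hp
      (fun f => pointwise_swap_mem_poly hs (ofFun_mem f) hp (h1 f x hx1))
      (fun X => pointwise_swap_mem_poly hs (ofSec_mem X) hp (h2 X x hx1)) hQ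

theorem pointwise_mem_grassmann (hE : E.IsLieAlgebroid) (hs : ∀ m, IsPointwiseSchouten (s m))
    (P Q : E.Multi) : (fun m => s m P Q) ∈ E.grassmann := by
  intro m
  obtain ⟨P', hP', eP⟩ := P.2 m
  obtain ⟨Q', hQ', eQ⟩ := Q.2 m
  refine ⟨_, pointwise_mem_poly hE hs (P := ⟨P', E.mem_grassmann_of_mem_poly hP'⟩)
    (Q := ⟨Q', E.mem_grassmann_of_mem_poly hQ'⟩) hP' hQ', ?_⟩
  -- The pointwise brackets depend on germs, so agreement is needed in a neighbourhood of each
  -- nearby point, not merely at the point.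
  filter_upwards [eventually_eventually_nhds.2 eP, eventually_eventually_nhds.2 eQ] with x h1 h2
  exact (hs x).congr h1 h2

end

/-- Existence of the Schouten bracket. -/
theorem IsLieAlgebroid.exists_schouten (hE : E.IsLieAlgebroid) :
    ∃ S, E.IsSchoutenBracket S := by
  choose s hs using hE.exists_pointwiseSchouten
  refine ⟨LinearMap.mk₂ ℝ (fun P Q => ⟨fun m => s m P Q, pointwise_mem_grassmann hE hs P Q⟩)
    (fun P P' Q => multi_ext fun m => (hs m).add_left P P' Q)
    (fun c P Q => multi_ext fun m => (hs m).smul_left c P Q)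
    (fun P Q Q' => multi_ext fun m => (hs m).add_right P Q Q')
    (fun c P Q => multi_ext fun m => (hs m).smul_right c P Q), ?_⟩
  constructor
  · exact fun f g => multi_ext fun m => (hs m).fun_fun f g
  · exact fun X f m => (hs m).sec_fun X f
  · exact fun X Y => multi_ext fun m => (hs m).sec_sec X Y
  · exact fun p q r P Q hP hQ h m => (hs m).degree p q r P Q hP hQ h
  · exact fun p q P Q hP hQ => multi_ext fun m => (hs m).antisymm p q P Q hP hQ
  · exact fun p q P Q R hP hQ => multi_ext fun m => (hs m).leibniz p q P Q R hP hQ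

theorem IsLieAlgebroid.existsUnique_schouten (hE : E.IsLieAlgebroid) :
    ∃! S, E.IsSchoutenBracket S := by
  obtain ⟨S, hS⟩ := hE.exists_schouten
  exact ⟨S, hS, fun S' hS' => hS'.eq_of_generators hE hS⟩

theorem IsLieAlgebroid.isSchoutenBracket_schouten (hE : E.IsLieAlgebroid) :
    E.IsSchoutenBracket E.schouten :=
  Classical.epsilon_spec hE.exists_schouten

end

end LieAlgebroidData

/-! ### Contraction with twisted closed forms and the square of the differential. -/

namespace LieAlgebroidData

section

variable {n : ℕ} {M : Type*} [TopologicalSpace M] [ChartedSpace (EuclideanSpace ℝ (Fin n)) M]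
  {E : LieAlgebroidData.{_, v} n M}

open ExteriorAlgebra

theorem contract_apply (φ : E.OneForm) (P : E.Multi) (m : M) :
    (E.contract φ P).1 m = contr (φ.1 m) (P.1 m) := rfl

theorem contract_mem (φ : E.OneForm) {p : ℕ} {P : E.Multi} (hP : P ∈ E.degree (p + 1)) :
    E.contract φ P ∈ E.degree p := fun m => contr_mem_succ (φ.1 m) (hP m)

theorem contract_zero (φ : E.OneForm) {P : E.Multi} (hP : P ∈ E.degree 0) :
    E.contract φ P = 0 := multi_ext fun m => (contr_mem (φ.1 m) (hP m)).2 rfl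

theorem contract_ofFun (φ : E.OneForm) (f : C^∞⟮modelM n, M; ℝ⟯) :
    E.contract φ (E.ofFun f) = 0 := contract_zero φ (ofFun_mem f)

theorem contract_ofSec {φ : E.OneForm} {X : E.Sec} {g : C^∞⟮modelM n, M; ℝ⟯}
    (h : ∀ m, φ.1 m (E.ev m X) = g m) : E.contract φ (E.ofSec X) = E.ofFun g :=
  multi_ext fun m => by rw [contract_apply, ofSec_apply, contr_ι, h, ofFun_apply]

theorem contract_comm (φ ψ : E.OneForm) (P : E.Multi) :
    E.contract φ (E.contract ψ P) = -E.contract ψ (E.contract φ P) :=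
  multi_ext fun m => contr_comm (φ.1 m) (ψ.1 m) (P.1 m)

theorem contract_self (φ : E.OneForm) (P : E.Multi) :
    E.contract φ (E.contract φ P) = 0 :=
  multi_ext fun m => contr_contr (φ.1 m) (P.1 m)

theorem contract_derivation (φ : E.OneForm) : IsGradedDerivation (-1) (E.contract φ) :=
  fun _ _ B hA => multi_ext fun m => contr_mul (φ.1 m) (hA m) (B.1 m)

theorem IsGradedDerivation.contract_mul {t : ℝ} {L : E.Multi →ₗ[ℝ] E.Multi} (ht : t * t = 1)
    (hL : IsGradedDerivation t L) (φ : E.OneForm) {a : ℕ} {A : E.Multi} (hA : A ∈ E.degree a)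
    (B : E.Multi) : L (E.contract φ A * B) =
      L (E.contract φ A) * B + t ^ (a + 1) • (E.contract φ A * L B) := by
  rcases a with _ | a
  · rw [contract_zero φ hA]; simp
  · rw [hL a _ _ (contract_mem φ hA), pow_add, pow_add, mul_assoc, pow_one, ht, mul_one]

theorem mul_contract_derivation (φ ψ : E.OneForm) {p : ℕ} {P : E.Multi} (hP : P ∈ E.degree p) :
    IsGradedDerivation ((-1) ^ p) (E.wedgeLeft (E.contract ψ P) ∘ₗ E.contract φ) := by
  intro a A B hA
  change E.contract ψ P * E.contract φ (A * B) = E.contract ψ P * E.contract φ A * B +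
    ((-1 : ℝ) ^ p) ^ a • (A * (E.contract ψ P * E.contract φ B))
  rcases p with _ | p
  · rw [contract_zero ψ hP]; simp
  · rw [contract_derivation φ a A B hA, mul_add, mul_assoc, mul_smul_comm, ← mul_assoc _ A,
      graded_comm (contract_mem ψ hP) hA, smul_mul_assoc, smul_smul, mul_assoc A]
    congr 2
    rcases neg_one_pow_eq_or ℝ p with hp | hp <;> rcases neg_one_pow_eq_or ℝ a with ha | ha <;>
      simp [pow_add, pow_mul, hp, ha]

/-- Closedness of the `1`-form `ψ` for the differential twisted by the `1`-form `φ`. -/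
def TwistedClosed (φ ψ : E.OneForm) : Prop :=
  ∀ (X Y : E.Sec) (f g : C^∞⟮modelM n, M; ℝ⟯), (∀ m, ψ.1 m (E.ev m X) = f m) →
    (∀ m, ψ.1 m (E.ev m Y) = g m) → ∀ m, ψ.1 m (E.ev m (E.bracket X Y)) =
      E.anchor m (E.ev m X) g + φ.1 m (E.ev m X) * g m -
        (E.anchor m (E.ev m Y) f + φ.1 m (E.ev m Y) * f m)

theorem sub_apply (P Q : E.Multi) (m : M) : (P - Q).1 m = P.1 m - Q.1 m := rfl

theorem multi_neg_mul (P Q : E.Multi) : -P * Q = -(P * Q) :=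
  multi_ext fun m => neg_mul (P.1 m) (Q.1 m)

theorem multi_mul_neg (P Q : E.Multi) : P * -Q = -(P * Q) :=
  multi_ext fun m => mul_neg (P.1 m) (Q.1 m)

namespace IsSchoutenBracket

variable {S : E.Multi →ₗ[ℝ] E.Multi →ₗ[ℝ] E.Multi}

/-- The contraction with a twisted closed form acts on the Schouten bracket as a derivation, up to
twisting terms. -/
def ContractRule (S : E.Multi →ₗ[ℝ] E.Multi →ₗ[ℝ] E.Multi) (φ ψ : E.OneForm) (p : ℕ)
    (P Q : E.Multi) : Prop :=
  E.contract ψ (S P Q) = S (E.contract ψ P) Q + (-1 : ℝ) ^ (p + 1) • S P (E.contract ψ Q) -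
    E.contract ψ P * E.contract φ Q + E.contract φ P * E.contract ψ Q

theorem contract_left_derivation (hS : E.IsSchoutenBracket S) (ψ : E.OneForm) {p : ℕ}
    {P : E.Multi} (hP : P ∈ E.degree p) :
    IsGradedDerivation ((-1) ^ p) (S (E.contract ψ P)) := by
  rcases p with _ | p
  · rw [contract_zero ψ hP]; intro a A B _; simp
  · exact hS.derivation (contract_mem ψ hP)

/-- Contraction is an antiderivation, so its graded commutator with the derivation ⟦P,·⟧ is again a
derivation. -/
theorem contract_commutator_derivation (hS : E.IsSchoutenBracket S) (ψ : E.OneForm) {p : ℕ}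
    {P : E.Multi} (hP : P ∈ E.degree p) :
    IsGradedDerivation ((-1) ^ p) (E.contract ψ ∘ₗ S P -
      (-1 : ℝ) ^ (p + 1) • S P ∘ₗ E.contract ψ) := by
  intro a A B hA
  have h1 := hS.derivation hP
  have h2 := contract_derivation ψ
  simp only [LinearMap.sub_apply, LinearMap.comp_apply, LinearMap.smul_apply, h2 a A _ hA,
    h1 a A B hA, map_add, map_smul, hS.derivation_apply (by norm_num) h2 hP hA,
    h1.contract_mul (neg_one_pow_sq _) ψ hA, h1 a A _ hA]
  simp only [sub_mul, mul_sub, smul_sub, smul_add, smul_mul_assoc, mul_smul_comm, smul_smul]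
  rcases neg_one_pow_eq_or ℝ p with hp | hp <;>
    rcases neg_one_pow_eq_or ℝ a with ha | ha <;>
    simp [pow_add, hp, ha] <;> abel

/-- Moving the term with i_ψQ inside the bracket to the left makes both sides derivations in Q of
the same sign; each correction term in φ is a derivation by itself. -/
theorem contractRule_of_generators (hE : E.IsLieAlgebroid) (hS : E.IsSchoutenBracket S)
    (φ ψ : E.OneForm) {p : ℕ} {P : E.Multi} (hP : P ∈ E.degree p)
    (hf : ∀ f, ContractRule S φ ψ p P (E.ofFun f))
    (hX : ∀ X, ContractRule S φ ψ p P (E.ofSec X)) (Q : E.Multi) : ContractRule S φ ψ p P Q := by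
  have hd : IsGradedDerivation ((-1) ^ p) (S (E.contract ψ P) -
      E.wedgeLeft (E.contract ψ P) ∘ₗ E.contract φ +
      E.wedgeLeft (E.contract φ P) ∘ₗ E.contract ψ) := by
    intro a A B hA
    simp only [LinearMap.sub_apply, LinearMap.add_apply,
      hS.contract_left_derivation ψ hP a A B hA, mul_contract_derivation φ ψ hP a A B hA,
      mul_contract_derivation ψ φ hP a A B hA, add_mul, sub_mul, mul_add, mul_sub, smul_add,
      smul_sub]
    abel
  have key : ∀ Q, ContractRule S φ ψ p P Q ↔ (E.contract ψ ∘ₗ S P -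
      (-1 : ℝ) ^ (p + 1) • S P ∘ₗ E.contract ψ) Q = (S (E.contract ψ P) -
      E.wedgeLeft (E.contract ψ P) ∘ₗ E.contract φ +
      E.wedgeLeft (E.contract φ P) ∘ₗ E.contract ψ) Q := by
    intro Q
    unfold ContractRule
    change _ ↔ E.contract ψ (S P Q) - (-1 : ℝ) ^ (p + 1) • S P (E.contract ψ Q) =
      S (E.contract ψ P) Q - E.contract ψ P * E.contract φ Q + E.contract φ P * E.contract ψ Q
    rw [sub_eq_iff_eq_add]
    refine Eq.congr_right ?_
    abel
  rw [key]
  exact hE.eq_of_derivation (hS.contract_commutator_derivation ψ hP) hd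
    (fun f => (key _).1 (hf f)) (fun X => (key _).1 (hX X)) Q

theorem ContractRule.swap (hS : E.IsSchoutenBracket S) {φ ψ : E.OneForm} {p q : ℕ}
    {P Q : E.Multi} (hP : P ∈ E.degree p) (hQ : Q ∈ E.degree q)
    (h : ContractRule S φ ψ p P Q) : ContractRule S φ ψ q Q P := by
  unfold ContractRule at h ⊢
  have h1 : ∀ {p q : ℕ} {P Q : E.Multi}, P ∈ E.degree p → Q ∈ E.degree q →
      S (E.contract ψ P) Q = -((-1 : ℝ) ^ (p * (q + 1)) • S Q (E.contract ψ P)) := by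
    intro p q P Q hP hQ
    rcases p with _ | p
    · rw [contract_zero ψ hP]; simp
    · exact hS.antisymm p q _ _ (contract_mem ψ hP) hQ
  have h2 : ∀ α β : E.OneForm, E.contract α P * E.contract β Q =
      (-1 : ℝ) ^ ((p + 1) * (q + 1)) • (E.contract β Q * E.contract α P) := by
    intro α β
    rcases p with _ | p
    · rw [contract_zero α hP]; simp
    rcases q with _ | q
    · rw [contract_zero β hQ]; simp
    rw [graded_comm (contract_mem α hP) (contract_mem β hQ)]
    congr 1
    rcases neg_one_pow_eq_or ℝ p with hp | hp <;> rcases neg_one_pow_eq_or ℝ q with hq | hq <;>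
      simp [pow_add, pow_mul, hp, hq]
  rw [hS.antisymm q p Q P hQ hP, map_neg, map_smul, h, h1 hP hQ, h1 hQ hP, h2 ψ φ, h2 φ ψ]
  simp only [smul_add, smul_sub, smul_neg, smul_smul]
  rcases neg_one_pow_eq_or ℝ p with hp | hp <;> rcases neg_one_pow_eq_or ℝ q with hq | hq <;>
    simp [pow_add, pow_mul, hp, hq] <;> abel

/-- Only the case of two sections has content, and there the rule is exactly twisted closedness of
ψ. If one argument is a function, every term vanishes. -/
theorem contractRule_gen (hE : E.IsLieAlgebroid) (hS : E.IsSchoutenBracket S) {φ ψ : E.OneForm}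
    (hψ : TwistedClosed φ ψ) {p q : ℕ} {P Q : E.Multi} (hP : Gen p P) (hQ : Gen q Q) :
    ContractRule S φ ψ p P Q := by
  have hXf : ∀ X f, ContractRule S φ ψ 1 (E.ofSec X) (E.ofFun f) := by
    intro X f
    obtain ⟨g, hg⟩ := hE.anchor_smooth X f
    obtain ⟨a, ha⟩ := ψ.2 X
    unfold ContractRule
    rw [hS.sec_fun_eq hg, contract_ofSec ha]
    simp [contract_ofFun, hS.fun_fun]
  rcases hP with ⟨rfl, f, rfl⟩ | ⟨rfl, X, rfl⟩ <;> rcases hQ with ⟨rfl, g, rfl⟩ | ⟨rfl, Y, rfl⟩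
  · unfold ContractRule
    simp [contract_ofFun, hS.fun_fun]
  · exact (hXf Y f).swap hS (ofSec_mem Y) (ofFun_mem f)
  · exact hXf X g
  · obtain ⟨f, hf⟩ := ψ.2 X
    obtain ⟨g, hg⟩ := ψ.2 Y
    obtain ⟨a, ha⟩ := φ.2 X
    obtain ⟨b, hb⟩ := φ.2 Y
    unfold ContractRule
    rw [hS.sec_sec, contract_ofSec hf, contract_ofSec hg, contract_ofSec ha, contract_ofSec hb,
      hS.antisymm 0 1 _ _ (ofFun_mem f) (ofSec_mem Y)]
    refine multi_ext fun m => ?_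
    simp only [contract_apply, ofSec_apply, contr_ι, sub_apply, add_apply, neg_apply, smul_apply,
      mul_apply, hS.sec_fun, ofFun_apply, hψ X Y f g hf hg m, ha, hb, ← map_mul, map_sub, map_add]
    norm_num
    rw [Algebra.commutes (b m)]
    abel

/-- The contraction with a twisted closed form acts on the Schouten bracket as a derivation, up to
twisting terms. -/
theorem contractRule (hE : E.IsLieAlgebroid) (hS : E.IsSchoutenBracket S) {φ ψ : E.OneForm}
    (hψ : TwistedClosed φ ψ) {p : ℕ} {P : E.Multi} (hP : P ∈ E.degree p) (Q : E.Multi) :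
    ContractRule S φ ψ p P Q := by
  have h1 : ∀ {q : ℕ} {R : E.Multi}, Gen q R → ∀ Q, ContractRule S φ ψ q R Q := fun hR Q =>
    hS.contractRule_of_generators hE φ ψ hR.mem
      (fun f => hS.contractRule_gen hE hψ hR (Or.inl ⟨rfl, f, rfl⟩))
      (fun X => hS.contractRule_gen hE hψ hR (Or.inr ⟨rfl, X, rfl⟩)) Q
  exact hS.contractRule_of_generators hE φ ψ hP
    (fun f => (h1 (Or.inl ⟨rfl, f, rfl⟩) P).swap hS (ofFun_mem f) hP)
    (fun X => (h1 (Or.inr ⟨rfl, X, rfl⟩) P).swap hS (ofSec_mem X) hP) Q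

section bivector

variable {φ : E.OneForm} {J : E.Multi}

theorem bracket_mul_contract (hS : E.IsSchoutenBracket S)
    (hJ : J ∈ E.degree 2) {k : ℕ} {R : E.Multi} (hR : R ∈ E.degree k) :
    S (J * E.contract φ J) R =
      J * S (E.contract φ J) R + E.contract φ J * S J R := by
  have hE1 := contract_mem φ hJ
  have h3 : S J R ∈ E.degree (k + 1) := hS.degree 2 k (k + 1) J R hJ hR (by ring)
  have h4 := hS.antisymm 3 k _ R (mul_mem_degree hJ hE1) hR
  -- The product stands in the first slot: it is moved to the second by antisymmetry, expanded
  -- there, and each resulting bracket is turned back.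
  rw [hS.leibniz k 2 R J _ hR hJ, hS.antisymm k 2 R J hR hJ, hS.antisymm k 1 R _ hR hE1,
    multi_neg_mul, smul_mul_assoc, graded_comm h3 hE1, multi_mul_neg, mul_smul_comm] at h4
  rw [h4]
  generalize E.contract φ J * S J R = a
  generalize J * S (E.contract φ J) R = b
  simp only [smul_add, smul_neg, smul_smul]
  rcases neg_one_pow_eq_or ℝ k with hk | hk <;>
    simp only [pow_add, pow_mul, hk] <;> norm_num

/-- The Schouten–Jacobi square `⟦J, J⟧ + 2 J ∧ i_φ J` of a bivector. -/
noncomputable def jacobiSquare (S : E.Multi →ₗ[ℝ] E.Multi →ₗ[ℝ] E.Multi) (φ : E.OneForm)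
    (J : E.Multi) : E.Multi := S J J + (2 : ℝ) • (J * E.contract φ J)

theorem jacobiSquare_mem (hS : E.IsSchoutenBracket S) (hJ : J ∈ E.degree 2) :
    jacobiSquare S φ J ∈ E.degree 3 :=
  add_mem (hS.degree 2 2 3 J J hJ hJ rfl)
    (Submodule.smul_mem _ _ (mul_mem_degree hJ (contract_mem φ hJ)))

theorem odd_sq {A : E.Multi} (hA : A ∈ E.degree 1) : A * A = 0 := by
  refine multi_ext fun m => ?_
  obtain ⟨v, hv⟩ := mem_one_iff.1 (hA m)
  rw [mul_apply, ← hv, ι_sq_zero, zero_apply]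

/-- The correction terms of the contraction rule cancel for ψ = φ, and the product term contributes
i_φJ ∧ i_φJ = 0; the two remaining brackets coincide by antisymmetry. -/
theorem contract_jacobiSquare (hE : E.IsLieAlgebroid) (hS : E.IsSchoutenBracket S)
    (hφ : TwistedClosed φ φ) (hJ : J ∈ E.degree 2) :
    E.contract φ (jacobiSquare S φ J) = (-2 : ℝ) • S J (E.contract φ J) := by
  have hE1 := contract_mem φ hJ
  have h1 := hS.contractRule hE hφ hJ J
  unfold ContractRule at h1
  rw [jacobiSquare, map_add, map_smul, h1, contract_derivation φ 2 J _ hJ, contract_self,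
    hS.antisymm 1 2 _ J hE1 hJ, odd_sq hE1]
  norm_num
  rw [two_smul]
  abel

/-- The differential defined by a bivector, a `1`-form and a parameter. -/
noncomputable def twistedDifferential (S : E.Multi →ₗ[ℝ] E.Multi →ₗ[ℝ] E.Multi) (φ : E.OneForm)
    (J : E.Multi) (c : ℝ) : E.Multi →ₗ[ℝ] E.Multi :=
  S J + (E.wedgeLeft J).comp (E.contract φ) + c • E.wedgeLeft (E.contract φ J)

theorem twistedDifferential_apply (c : ℝ) (R : E.Multi) : twistedDifferential S φ J c R =
    S J R + J * E.contract φ R + c • (E.contract φ J * R) := rfl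

theorem twistedDifferential_mem (hS : E.IsSchoutenBracket S) (hJ : J ∈ E.degree 2) (c : ℝ)
    {k : ℕ} {R : E.Multi} (hR : R ∈ E.degree k) :
    twistedDifferential S φ J c R ∈ E.degree (k + 1) := by
  rw [twistedDifferential_apply]
  refine add_mem (add_mem (hS.degree 2 k (k + 1) J R hJ hR (by ring)) ?_)
    (Submodule.smul_mem _ _ ?_)
  · rcases k with _ | k
    · rw [contract_zero φ hR, mul_zero]; exact zero_mem _
    · have := mul_mem_degree hJ (contract_mem φ hR)
      rwa [show 2 + k = k + 1 + 1 by ring] at this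
  · have := mul_mem_degree (contract_mem φ hJ) hR
    rwa [add_comm] at this

/-- The outer coefficient is c + 1 because the coefficient k − 1 + t grows by one with the degree.
This shift is what makes the mixed terms combine: double brackets become half of ⟦⟦J,J⟧,·⟧ by the
Jacobi identity, the contraction rule moves i_φ through ⟦J,·⟧, and terms with i_φJ twice as left
factors vanish. -/
theorem twistedDifferential_sq (hE : E.IsLieAlgebroid) (hS : E.IsSchoutenBracket S)
    (hφ : TwistedClosed φ φ) (hJ : J ∈ E.degree 2) (c : ℝ) {k : ℕ} {R : E.Multi}
    (hR : R ∈ E.degree k) :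
    (2 : ℝ) • twistedDifferential S φ J (c + 1) (twistedDifferential S φ J c R) =
      S (jacobiSquare S φ J) R + (2 : ℝ) • (jacobiSquare S φ J * E.contract φ R) -
        c • (E.contract φ (jacobiSquare S φ J) * R) := by
  have hE1 := contract_mem φ hJ
  have r1 : E.contract φ (S J R) = S (E.contract φ J) R - S J (E.contract φ R) := by
    have h := hS.contractRule hE hφ hJ R
    unfold ContractRule at h
    rw [h]; norm_num; abel
  have r2 := hS.derivation hJ 2 J (E.contract φ R) hJ
  have r3 := hS.derivation hJ 1 (E.contract φ J) R hE1
  have r4 := contract_derivation φ 2 J (E.contract φ R) hJ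
  have r5 := contract_derivation φ 1 (E.contract φ J) R hE1
  have r6 : E.contract φ J * J = J * E.contract φ J := by
    rw [graded_comm hE1 hJ]; norm_num
  have r7 : E.contract φ J * (E.contract φ J * R) = 0 := by rw [← mul_assoc, odd_sq hE1, zero_mul]
  have r8 : E.contract φ J * (J * E.contract φ R) = J * (E.contract φ J * E.contract φ R) := by
    rw [← mul_assoc, r6, mul_assoc]
  norm_num [contract_self] at r2 r3 r4 r5
  rw [contract_jacobiSquare hE hS hφ hJ]
  simp only [twistedDifferential_apply, map_add, map_smul, r1, r2, r3, r4, r5, mul_sub,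
    multi_mul_neg, r7, r8, smul_zero, add_zero, jacobiSquare, LinearMap.add_apply,
    LinearMap.smul_apply, hS.apply_apply hE hJ, hS.bracket_mul_contract hJ hR, add_mul,
    smul_mul_assoc, mul_assoc]
  module

end bivector

end IsSchoutenBracket

end

end LieAlgebroidData

/-! ### The trivector as Jacobiator and as obstruction to cohomology. -/

namespace LieAlgebroidData

section

variable {n : ℕ} {M : Type*} [TopologicalSpace M] [ChartedSpace (EuclideanSpace ℝ (Fin n)) M]
  {E : LieAlgebroidData.{_, v} n M}

open ExteriorAlgebra

namespace IsSchoutenBracket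

variable {S : E.Multi →ₗ[ℝ] E.Multi →ₗ[ℝ] E.Multi} {φ : E.OneForm} {J : E.Multi}

/-- The Jacobiator of the bracket defined by a bivector is the Schouten–Jacobi square. -/
theorem contract_contract_contract_jacobiSquare (hE : E.IsLieAlgebroid)
    (hS : E.IsSchoutenBracket S) (hJ : J ∈ E.degree 2) {α β γ : E.OneForm}
    (hα : TwistedClosed φ α) (hβ : TwistedClosed φ β) (hγ : TwistedClosed φ γ) :
    E.contract γ (E.contract β (E.contract α (jacobiSquare S φ J))) = (2 : ℝ) •
      ((S (E.contract α J) (E.contract γ (E.contract β J)) +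
        E.contract φ (E.contract α J) * E.contract γ (E.contract β J)) +
      (S (E.contract β J) (E.contract α (E.contract γ J)) +
        E.contract φ (E.contract β J) * E.contract α (E.contract γ J)) +
      (S (E.contract γ J) (E.contract β (E.contract α J)) +
        E.contract φ (E.contract γ J) * E.contract β (E.contract α J))) := by
  have dφ := contract_mem φ hJ
  have dα := contract_mem α hJ
  have dβ := contract_mem β hJ
  have dγ := contract_mem γ hJ
  have dβα := contract_mem β dα
  have dγα := contract_mem γ dα
  have dγβ := contract_mem γ dβ
  have eα := contract_mem φ dα
  have eβ := contract_mem φ dβ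
  have eγ := contract_mem φ dγ
  -- the first contraction
  have a1 := hS.contractRule hE hα hJ J
  unfold ContractRule at a1
  have a2 := contract_derivation α 2 J (E.contract φ J) hJ
  have a3 := graded_comm dφ dα
  have a4 := hS.antisymm 2 1 J _ hJ dα
  norm_num at a1 a2 a3 a4
  -- The two brackets coming from ⟦J,J⟧ agree by antisymmetry, which produces the factor 2; the
  -- corrections of the contraction rule cancel one of the two terms coming from 2 J ∧ i_φJ.
  have s1 : E.contract α (jacobiSquare S φ J) = (2 : ℝ) • S (E.contract α J) J -
      (2 : ℝ) • (E.contract φ (E.contract α J) * J) := by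
    have a5 := graded_comm eα hJ
    norm_num at a5
    rw [jacobiSquare, map_add, map_smul, a1, a2, a3, a4, contract_comm α φ, multi_mul_neg, a5]
    module
  -- the second contraction
  have b1 := hS.contractRule hE hβ dα J
  unfold ContractRule at b1
  have b2 := contract_derivation β 0 _ J eα
  rw [contract_zero β eα] at b2
  norm_num at b1 b2
  have s2 : E.contract β (E.contract α (jacobiSquare S φ J)) =
      (2 : ℝ) • S (E.contract β (E.contract α J)) J +
      (2 : ℝ) • S (E.contract α J) (E.contract β J) -
      (2 : ℝ) • (E.contract β (E.contract α J) * E.contract φ J) := by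
    rw [s1, map_sub, map_smul, map_smul, b1, b2]
    module
  -- the third contraction
  have c1 := hS.contractRule hE hγ dβα J
  have c2 := hS.contractRule hE hγ dα (E.contract β J)
  unfold ContractRule at c1 c2
  have c3 := contract_derivation γ 0 _ (E.contract φ J) dβα
  rw [contract_zero γ dβα, contract_zero φ dβα] at c1
  rw [contract_zero γ dβα, contract_comm γ φ, multi_mul_neg] at c3
  have c4 := hS.antisymm 0 1 _ _ dβα dγ
  have c5 := hS.antisymm 0 1 _ _ dγα dβ
  have c6 := graded_comm dγα eβ
  have c7 := graded_comm eγ dβα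
  norm_num at c1 c2 c3 c4 c5 c6 c7
  rw [s2, map_sub, map_add, map_smul, map_smul, map_smul, c1, c2, c3, c4, c5, c6, c7,
    contract_comm α γ, map_neg, multi_mul_neg]
  module

theorem _root_.LieAlgebroidData.IsLieAlgebroid.exists_differential (hE : E.IsLieAlgebroid)
    (f : C^∞⟮modelM n, M; ℝ⟯) : ∃ α : E.OneForm, ∀ m v, α.1 m v = E.anchor m v f := by
  refine ⟨⟨fun m =>
    { toFun := fun v => E.anchor m v f
      map_add' := fun v w => hE.anchor_add m v w f
      map_smul' := fun c v => hE.anchor_smul m c v f }, fun X => hE.anchor_smooth X f⟩,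
    fun m v => rfl⟩

/-- Both sides are antiderivations that kill functions and send a section X to −ρ(X)f. Thus
bracketing with functions amounts to contraction with their differentials. -/
theorem ofFun_bracket (hE : E.IsLieAlgebroid) (hS : E.IsSchoutenBracket S)
    {f : C^∞⟮modelM n, M; ℝ⟯} {α : E.OneForm} (hα : ∀ m v, α.1 m v = E.anchor m v f)
    (P : E.Multi) : S (E.ofFun f) P = -E.contract α P := by
  have h1 : IsGradedDerivation ((-1) ^ (0 + 1)) (-E.contract α) := by
    intro a A B hA
    have := contract_derivation α a A B hA
    rw [LinearMap.neg_apply, this, LinearMap.neg_apply, LinearMap.neg_apply, multi_neg_mul,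
      multi_mul_neg]
    norm_num
    abel
  refine hE.eq_of_derivation (hS.derivation (ofFun_mem f)) h1 (fun g => ?_) (fun X => ?_) P
  · rw [hS.fun_fun, LinearMap.neg_apply, contract_ofFun, neg_zero]
  · obtain ⟨g, hg⟩ := hE.anchor_smooth X f
    rw [hS.fun_sec, LinearMap.neg_apply, hS.sec_fun_eq hg,
      contract_ofSec (g := g) fun m => by rw [hα, hg]]

/-- Euler's formula recovers (p + 1)x from its contractions with the dual system. -/
theorem _root_.ExteriorAlgebra.eq_zero_of_contr {V : Type*} [AddCommGroup V] [Module ℝ V]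
    {κ : Type*} [Fintype κ] {e : κ → V} {θ : κ → Module.Dual ℝ V}
    (h : ∀ v, v = ∑ i, θ i v • e i) {p : ℕ} {x : ExteriorAlgebra ℝ V}
    (hx : x ∈ ⋀[ℝ]^(p + 1) V) (h0 : ∀ i, contr (θ i) x = 0) : x = 0 := by
  have h1 := sum_ι_mul_contr h hx
  simp only [h0, mul_zero, Finset.sum_const_zero] at h1
  have h2 : ((p + 1 : ℕ) : ℝ) ≠ 0 := by positivity
  exact (smul_eq_zero.1 h1.symm).resolve_left h2

theorem _root_.ExteriorAlgebra.eq_zero_of_contr_contr_contr {V : Type*} [AddCommGroup V]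
    [Module ℝ V] {κ : Type*} [Fintype κ] {e : κ → V} {θ : κ → Module.Dual ℝ V}
    (h : ∀ v, v = ∑ i, θ i v • e i) {x : ExteriorAlgebra ℝ V}
    (hx : x ∈ ⋀[ℝ]^3 V) (h0 : ∀ i j k, contr (θ i) (contr (θ j) (contr (θ k) x)) = 0) : x = 0 := by
  refine eq_zero_of_contr h hx fun k => eq_zero_of_contr h (contr_mem_succ _ hx) fun j =>
    eq_zero_of_contr (p := 0) h (contr_mem_succ _ (contr_mem_succ _ hx)) fun i => h0 i j k

/-- A trivector in the kernel of the anchor vanishes if the kernel has rank at most two. -/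
theorem eq_zero_of_bracket_fun (hE : E.IsLieAlgebroid) (hS : E.IsSchoutenBracket S) {T : E.Multi}
    (hT : T ∈ E.degree 3) (h : ∀ f, S T (E.ofFun f) = 0) : T = 0 := by
  refine multi_ext fun m => ?_
  -- The first n covectors of the frame are differentials of functions, so contraction with them
  -- kills T. Three indices among the remaining at most two covectors repeat, and repeated
  -- contractions vanish.
  obtain ⟨κ, _, e, θ, x, hκ, hx, hF⟩ := hE.frame m
  have h1 : ∀ i, contr ((θ (Sum.inl i)).1 m) (T.1 m) = 0 := by
    intro i
    have h2 := hS.antisymm 0 3 _ T (ofFun_mem (x i)) hT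
    rw [h, smul_zero, neg_zero, hS.ofFun_bracket hE (hx i)] at h2
    have h3 := congrArg (fun P : E.Multi => P.1 m) h2
    exact neg_eq_zero.1 h3
  refine eq_zero_of_contr_contr_contr hF.self_of_nhds (hT m) fun i j k => ?_
  rcases k with k | k
  · rw [h1, map_zero, map_zero]
  rcases j with j | j
  · rw [contr_comm ((θ (Sum.inl j)).1 m), h1, map_zero, neg_zero, map_zero]
  rcases i with i | i
  · rw [contr_comm ((θ (Sum.inl i)).1 m), contr_comm ((θ (Sum.inl i)).1 m), h1, map_zero, neg_zero,
      map_zero, neg_zero]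
  obtain ⟨a, b, hab, he⟩ := Fintype.exists_ne_map_eq_of_card_lt ![i, j, k]
    (by rw [Fintype.card_fin]; omega)
  have h3 : i = j ∨ j = k ∨ i = k := by
    fin_cases a <;> fin_cases b <;> simp_all
  rcases h3 with rfl | rfl | rfl
  · rw [contr_contr]
  · rw [contr_contr, map_zero]
  · rw [contr_comm, contr_contr, map_zero, neg_zero]

/-- The square of a bivector vanishes if and only if all its differentials square to zero. -/
theorem isCohomologyOperator_iff (hE : E.IsLieAlgebroid) (hS : E.IsSchoutenBracket S)
    (hφ : TwistedClosed φ φ) (hJ : J ∈ E.degree 2) :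
    (∀ t : ℝ, E.IsCohomologyOperator fun k => twistedDifferential S φ J ((k : ℝ) - 1 + t)) ↔
      jacobiSquare S φ J = 0 := by
  have key : ∀ (t : ℝ) (k : ℕ) (R : E.Multi), R ∈ E.degree k →
      (2 : ℝ) • twistedDifferential S φ J (((k + 1 : ℕ) : ℝ) - 1 + t)
        (twistedDifferential S φ J ((k : ℝ) - 1 + t) R) =
      S (jacobiSquare S φ J) R + (2 : ℝ) • (jacobiSquare S φ J * E.contract φ R) -
        ((k : ℝ) - 1 + t) • (E.contract φ (jacobiSquare S φ J) * R) := by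
    intro t k R hR
    rw [← hS.twistedDifferential_sq hE hφ hJ _ hR]
    congr 3
    push_cast; ring
  constructor
  · intro h
    have h1 : ∀ (t : ℝ) f, S (jacobiSquare S φ J) (E.ofFun f) -
        (-1 + t) • (E.contract φ (jacobiSquare S φ J) * E.ofFun f) = 0 := by
      intro t f
      have h2 := key t 0 _ (ofFun_mem f)
      rw [contract_ofFun, mul_zero, smul_zero, add_zero, (h t 0 _ (ofFun_mem f)).2,
        smul_zero] at h2
      rw [h2]; norm_num
    refine hS.eq_zero_of_bracket_fun hE (hS.jacobiSquare_mem hJ) fun f => ?_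
    -- For t = 1 the coefficient k − 1 + t vanishes in degree k = 0, which isolates the bracket of
    -- the trivector with f.
    have h3 := h1 1 f
    rwa [neg_add_cancel, zero_smul, sub_zero] at h3
  · intro h t k R hR
    refine ⟨hS.twistedDifferential_mem hJ _ hR, ?_⟩
    have h1 := key t k R hR
    rw [h] at h1
    simp only [map_zero, LinearMap.zero_apply, zero_mul, smul_zero, add_zero, sub_zero] at h1
    exact (smul_eq_zero.1 h1).resolve_left two_ne_zero

end IsSchoutenBracket

theorem coboundaries_le_cocycles {d : ℕ → E.Multi →ₗ[ℝ] E.Multi} (h : E.IsCohomologyOperator d)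
    (k : ℕ) : E.coboundaries d k ≤ E.cocycles d k := by
  rcases k with _ | k
  · exact bot_le
  · rintro _ ⟨P, hP, rfl⟩
    exact ⟨(h k P hP).1, (h k P hP).2⟩

end

end LieAlgebroidData

/-! ### Affine calculus: brackets of sections defined by a bivector. -/

namespace LieAlgebroidData

section

open ExteriorAlgebra

theorem _root_.ExteriorAlgebra.contr_add_left {V : Type*} [AddCommGroup V] [Module ℝ V]
    (d d' : Module.Dual ℝ V) (x : ExteriorAlgebra ℝ V) :
    contr (d + d') x = contr d x + contr d' x := by
  rw [contr, map_add]; rfl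

theorem _root_.ExteriorAlgebra.contr_smul_left {V : Type*} [AddCommGroup V] [Module ℝ V]
    (c : ℝ) (d : Module.Dual ℝ V) (x : ExteriorAlgebra ℝ V) :
    contr (c • d) x = c • contr d x := by
  rw [contr, map_smul]; rfl

theorem _root_.ExteriorAlgebra.contr_zero_left {V : Type*} [AddCommGroup V] [Module ℝ V]
    (x : ExteriorAlgebra ℝ V) : contr (0 : Module.Dual ℝ V) x = 0 := by
  rw [contr, map_zero]; rfl

/-- A trivector vanishes if its values on a separating family of covectors vanish. -/
theorem _root_.ExteriorAlgebra.eq_zero_of_separating {V : Type*} [AddCommGroup V] [Module ℝ V]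
    {κ : Type*} [Fintype κ] {e : κ → V} {θ : κ → Module.Dual ℝ V}
    (h : ∀ v, v = ∑ i, θ i v • e i) {ι : Type*} {ψ : ι → Module.Dual ℝ V}
    (hψ : ∀ v, (∀ i, ψ i v = 0) → v = 0) {x : ExteriorAlgebra ℝ V}
    (hx : x ∈ ⋀[ℝ]^3 V) (h0 : ∀ i j k, contr (ψ i) (contr (ψ j) (contr (ψ k) x)) = 0) : x = 0 := by
  have hfin : FiniteDimensional ℝ V := by
    refine Module.Finite.of_surjective (Fintype.linearCombination ℝ e) fun v => ⟨fun i => θ i v, ?_⟩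
    rw [Fintype.linearCombination_apply]; exact (h v).symm
  -- Separating means that the span has zero coannihilator; in finite dimension it is then the whole
  -- dual.
  have hspan : Submodule.span ℝ (Set.range ψ) = ⊤ := by
    rw [← Subspace.dualCoannihilator_dualAnnihilator_eq (W := Submodule.span ℝ (Set.range ψ))]
    have : (Submodule.span ℝ (Set.range ψ)).dualCoannihilator = ⊥ := by
      rw [eq_bot_iff]
      intro v hv
      rw [Submodule.mem_dualCoannihilator] at hv
      exact hψ v fun i => hv _ (Submodule.subset_span ⟨i, rfl⟩)
    rw [this, Submodule.dualAnnihilator_bot]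
  -- The triple contraction is linear in each covector, so its vanishing extends from ψ to arbitrary
  -- covectors one slot at a time.
  have extend : ∀ F : Module.Dual ℝ V →ₗ[ℝ] ExteriorAlgebra ℝ V, (∀ i, F (ψ i) = 0) → F = 0 := by
    intro F hF
    refine LinearMap.ext_on_range hspan fun i => ?_
    rw [hF]; rfl
  have h1 : ∀ i j d, contr (ψ i) (contr (ψ j) (contr d x)) = 0 := by
    intro i j d
    exact congrArg (fun F => F d) (extend ((contr (ψ i)).comp ((contr (ψ j)).comp
      ((CliffordAlgebra.contractLeft (Q := (0 : QuadraticForm ℝ V))).flip x))) (h0 i j))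
  have h2 : ∀ i d d', contr (ψ i) (contr d' (contr d x)) = 0 := by
    intro i d d'
    exact congrArg (fun F => F d') (extend ((contr (ψ i)).comp
      ((CliffordAlgebra.contractLeft (Q := (0 : QuadraticForm ℝ V))).flip (contr d x)))
      fun j => h1 i j d)
  have h3 : ∀ d d' d'', contr d'' (contr d' (contr d x)) = 0 := by
    intro d d' d''
    exact congrArg (fun F => F d'') (extend
      ((CliffordAlgebra.contractLeft (Q := (0 : QuadraticForm ℝ V))).flip (contr d' (contr d x)))
      fun i => h2 i d d')
  exact eq_zero_of_contr_contr_contr h hx fun i j k => h3 _ _ _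

end

section

variable {n : ℕ} {M : Type u} {Z : Type*} [TopologicalSpace M]
    [ChartedSpace (EuclideanSpace ℝ (Fin n)) M] [TopologicalSpace Z]
    [ChartedSpace (ModelProd (EuclideanSpace ℝ (Fin n)) ℝ) Z] [AddAction ℝ Z]
    {ζ : AVBundle n M Z} {E : LieAlgebroidData.{u, v} n M} {φ : E.OneForm}
    {ψ : ζ.Section → E.OneForm}

open ExteriorAlgebra

/-- The sections of `ζ` act as twisted closed `1`-forms on the Lie algebroid `E`; translating a
section by a function `f` adds the twisted differential of `f`. -/
structure IsAffineCalculus (ζ : AVBundle n M Z) (E : LieAlgebroidData.{u, v} n M) (φ : E.OneForm)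
    (ψ : ζ.Section → E.OneForm) : Prop where
  isLieAlgebroid : E.IsLieAlgebroid
  closed : TwistedClosed φ φ
  closed_section : ∀ σ, TwistedClosed φ (ψ σ)
  vadd : ∀ (f : C^∞⟮modelM n, M; ℝ⟯) σ m v,
    (ψ (f +ᵥ σ)).1 m v = (ψ σ).1 m v + (E.anchor m v f + f m * φ.1 m v)
  separating : ∀ m v, (∀ σ, (ψ σ).1 m v = 0) → v = 0
  anchor_tangent : ∀ m v, ∃ w : TangentSpace (modelM n) m, ∀ f : C^∞⟮modelM n, M; ℝ⟯,
    E.anchor m v f = mvfderiv (modelM n) f m w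

/-- The bracket of sections of an AV-bundle defined by a bivector. -/
def IsBivectorBracket (ψ : ζ.Section → E.OneForm) (J : E.Multi)
    (B : ζ.Section → ζ.Section → C^∞⟮modelM n, M; ℝ⟯) : Prop :=
  ∀ σ σ', E.ofFun (B σ σ') = E.contract (ψ σ') (E.contract (ψ σ) J)

theorem exists_isBivectorBracket (ψ : ζ.Section → E.OneForm) {J : E.Multi} (hJ : J ∈ E.degree 2) :
    ∃ B : ζ.Section → ζ.Section → C^∞⟮modelM n, M; ℝ⟯, IsBivectorBracket ψ J B := by
  choose B hB using fun σ σ' : ζ.Section =>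
    exists_eq_ofFun (contract_mem (ψ σ') (contract_mem (ψ σ) hJ))
  exact ⟨B, fun σ σ' => (hB σ σ').symm⟩

theorem isBivectorBracket_iff {J : E.Multi} (hJ : J ∈ E.degree 2)
    {B : ζ.Section → ζ.Section → C^∞⟮modelM n, M; ℝ⟯} : IsBivectorBracket ψ J B ↔
      ∀ σ σ' m, B σ σ' m = E.evalBivector (J.1 m) ((ψ σ).1 m) ((ψ σ').1 m) := by
  have key : ∀ B : ζ.Section → ζ.Section → C^∞⟮modelM n, M; ℝ⟯, IsBivectorBracket ψ J B →
      ∀ σ σ' m, B σ σ' m = E.evalBivector (J.1 m) ((ψ σ).1 m) ((ψ σ').1 m) := by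
    intro B h σ σ' m
    have h1 := congrArg (fun P : E.Multi => ExteriorAlgebra.algebraMapInv (P.1 m)) (h σ σ')
    exact (ExteriorAlgebra.algebraMap_leftInverse _ _).symm.trans h1
  refine ⟨key B, fun h => ?_⟩
  obtain ⟨B', h'⟩ := exists_isBivectorBracket ψ hJ
  have : B = B' := by
    ext σ σ' m
    rw [h, key B' h']
  rwa [this]

namespace IsBivectorBracket

variable {J : E.Multi} {B : ζ.Section → ζ.Section → C^∞⟮modelM n, M; ℝ⟯}
  {S : E.Multi →ₗ[ℝ] E.Multi →ₗ[ℝ] E.Multi}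

theorem skew (hB : IsBivectorBracket ψ J B) (σ σ' : ζ.Section) : B σ σ' = -B σ' σ := by
  refine ofFun_injective (E := E) ?_
  have h : E.ofFun (-B σ' σ) = -E.ofFun (B σ' σ) := by
    rw [← neg_one_smul ℝ (B σ' σ), ofFun_smul, neg_one_smul]
  rw [h, hB, hB, contract_comm]

theorem ofFun_vadd (hC : IsAffineCalculus ζ E φ ψ) (hB : IsBivectorBracket ψ J B)
    {f : C^∞⟮modelM n, M; ℝ⟯} {α : E.OneForm} (hα : ∀ m v, α.1 m v = E.anchor m v f)
    (σ σ' : ζ.Section) : E.ofFun (B σ (f +ᵥ σ')) = E.ofFun (B σ σ') +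
      (E.contract α (E.contract (ψ σ) J) + E.ofFun f * E.contract φ (E.contract (ψ σ) J)) := by
  rw [hB, hB]
  refine multi_ext fun m => ?_
  have h1 : (ψ (f +ᵥ σ')).1 m = (ψ σ').1 m + (α.1 m + f m • φ.1 m) := by
    ext v
    rw [hC.vadd, ← hα]; rfl
  rw [contract_apply, h1, contr_add_left, contr_add_left, contr_smul_left, Algebra.smul_def]
  rfl

/-- Translating σ' by f adds df + fφ to its form; contraction with df is a bracket with f. This
identifies the linear part of {σ,·} with the operator that appears in the Jacobiator formula. -/
theorem ofFun_vadd_eq (hC : IsAffineCalculus ζ E φ ψ) (hS : E.IsSchoutenBracket S)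
    (hJ : J ∈ E.degree 2) (hB : IsBivectorBracket ψ J B) (f : C^∞⟮modelM n, M; ℝ⟯)
    (σ σ' : ζ.Section) : E.ofFun (B σ (f +ᵥ σ')) = E.ofFun (B σ σ') +
      (S (E.contract (ψ σ) J) (E.ofFun f) + E.contract φ (E.contract (ψ σ) J) * E.ofFun f) := by
  obtain ⟨α, hα⟩ := hC.isLieAlgebroid.exists_differential f
  have h1 := hS.antisymm 1 0 _ _ (contract_mem (ψ σ) hJ) (ofFun_mem f)
  rw [hS.ofFun_bracket hC.isLieAlgebroid hα] at h1
  norm_num at h1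
  rw [hB.ofFun_vadd hC hα, h1, ofFun_comm]

theorem ofFun_sub (f g : C^∞⟮modelM n, M; ℝ⟯) : E.ofFun (f - g) = E.ofFun f - E.ofFun g := by
  rw [sub_eq_add_neg, ← neg_one_smul ℝ g, ofFun_add, ofFun_smul, neg_one_smul, sub_eq_add_neg]

theorem ofFun_linearPart (hC : IsAffineCalculus ζ E φ ψ) (hS : E.IsSchoutenBracket S)
    (hJ : J ∈ E.degree 2) (hB : IsBivectorBracket ψ J B) (f : C^∞⟮modelM n, M; ℝ⟯)
    (σ : ζ.Section) : E.ofFun (ζ.linearPart B σ f) =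
      S (E.contract (ψ σ) J) (E.ofFun f) + E.contract φ (E.contract (ψ σ) J) * E.ofFun f := by
  rw [AVBundle.linearPart, ofFun_sub, hB.ofFun_vadd_eq hC hS hJ, add_sub_cancel_left]

theorem isAffine (hC : IsAffineCalculus ζ E φ ψ) (hS : E.IsSchoutenBracket S)
    (hJ : J ∈ E.degree 2) (hB : IsBivectorBracket ψ J B) (σ : ζ.Section) : ζ.IsAffine (B σ) := by
  have h := hB.ofFun_linearPart hC hS hJ
  refine ⟨
    { toFun := ζ.linearPart B σ
      map_add' := fun f g => ofFun_injective (E := E) ?_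
      map_smul' := fun c f => ofFun_injective (E := E) ?_ }, fun f σ' => ofFun_injective (E := E) ?_⟩
  · simp only [h, ofFun_add, map_add, mul_add]; abel
  · simp only [h, ofFun_smul, map_smul, mul_smul_comm, RingHom.id_apply, smul_add]
  · change _ = E.ofFun (B σ σ' + ζ.linearPart B σ f)
    rw [ofFun_add, h, hB.ofFun_vadd_eq hC hS hJ]

/-- The contraction of J with ψ_σ at m is a vector v of the algebroid; its anchor gives the
derivative part and φ(v) the coefficient of order zero. -/
theorem exists_firstOrder (hC : IsAffineCalculus ζ E φ ψ) (hJ : J ∈ E.degree 2)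
    (hB : IsBivectorBracket ψ J B) (σ : ζ.Section) (m : M) :
    ∃ (w : TangentSpace (modelM n) m) (v : E.Fib m), ∀ (f : C^∞⟮modelM n, M; ℝ⟯) σ',
      B σ (f +ᵥ σ') m = B σ σ' m + (mvfderiv (modelM n) f m w + φ.1 m v * f m) := by
  obtain ⟨v, hv⟩ := mem_one_iff.1 (contract_mem (ψ σ) hJ m)
  obtain ⟨w, hw⟩ := hC.anchor_tangent m v
  refine ⟨w, v, fun f σ' => ?_⟩
  obtain ⟨α, hα⟩ := hC.isLieAlgebroid.exists_differential f
  have h1 := congrArg (fun P : E.Multi => ExteriorAlgebra.algebraMapInv (P.1 m))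
    (hB.ofFun_vadd hC hα σ σ')
  simp only [add_apply, mul_apply, ofFun_apply, contract_apply, ← hv, contr_ι, map_add, map_mul,
    ExteriorAlgebra.algebraMap_leftInverse _ _] at h1
  rw [h1, hα, hw, mul_comm (f m)]

/-- The bracket of sections defined by a bivector is an affine Lie bracket if and only if the
square of the bivector vanishes. -/
theorem isAffineLieBracket_iff (hC : IsAffineCalculus ζ E φ ψ) (hS : E.IsSchoutenBracket S)
    (hJ : J ∈ E.degree 2) (hB : IsBivectorBracket ψ J B) :
    ζ.IsAffineLieBracket B ↔ IsSchoutenBracket.jacobiSquare S φ J = 0 := by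
  have hE := hC.isLieAlgebroid
  have key : ∀ σ₁ σ₂ σ₃, E.contract (ψ σ₃) (E.contract (ψ σ₂) (E.contract (ψ σ₁)
      (IsSchoutenBracket.jacobiSquare S φ J))) = (2 : ℝ) •
      E.ofFun (ζ.linearPart B σ₁ (B σ₂ σ₃) + ζ.linearPart B σ₂ (B σ₃ σ₁) +
        ζ.linearPart B σ₃ (B σ₁ σ₂)) := by
    intro σ₁ σ₂ σ₃
    rw [hS.contract_contract_contract_jacobiSquare hE hJ (hC.closed_section σ₁)
      (hC.closed_section σ₂) (hC.closed_section σ₃)]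
    simp only [ofFun_add, hB.ofFun_linearPart hC hS hJ, ← hB _ _]
  have hz : E.ofFun 0 = 0 := multi_ext fun m => map_zero (algebraMap ℝ (ExteriorAlgebra ℝ (E.Fib m)))
  constructor
  · intro h
    refine multi_ext fun m => ?_
    obtain ⟨κ, _, e, θ, x, hκ, hx, hF⟩ := hE.frame m
    -- The Jacobi identity gives the vanishing of the trivector only on forms of sections; since
    -- they separate vectors, this determines it.
    refine eq_zero_of_separating hF.self_of_nhds (hC.separating m)
      (hS.jacobiSquare_mem hJ m) fun i j k => ?_
    have h1 := key k j i
    rw [h.jacobi, hz, smul_zero] at h1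
    exact congrArg (fun P : E.Multi => P.1 m) h1
  · intro h
    refine ⟨fun σ' => ?_, hB.isAffine hC hS hJ, hB.skew, fun σ₁ σ₂ σ₃ => ?_⟩
    · obtain ⟨L, hL⟩ := hB.isAffine hC hS hJ σ'
      refine ⟨-L, fun f σ => ?_⟩
      change B (f +ᵥ σ) σ' = B σ σ' + (-L) f
      rw [hB.skew _ σ', hB.skew σ σ', hL, LinearMap.neg_apply]; abel
    · have h1 := key σ₁ σ₂ σ₃
      rw [h, map_zero, map_zero, map_zero, eq_comm] at h1
      exact ofFun_injective (E := E) (((smul_eq_zero.1 h1).resolve_left two_ne_zero).trans hz.symm)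

end IsBivectorBracket

end

end LieAlgebroidData

/-! ### Bump functions, coordinates and coordinate fields on the base. -/

namespace AVBundle

section base

variable {n : ℕ} {M : Type*} [TopologicalSpace M] [T2Space M]
  [ChartedSpace (EuclideanSpace ℝ (Fin n)) M] [IsManifold (modelM n) ∞ M]

theorem exists_bump (m : M) {U : Set M} (hU : U ∈ 𝓝 m) : ∃ χ : C^∞⟮modelM n, M; ℝ⟯,
    (∀ᶠ x in 𝓝 m, χ x = 1) ∧ ∀ x ∉ U, χ x = 0 := by
  obtain ⟨f, -, hf⟩ := (SmoothBumpFunction.nhds_basis_tsupport (I := modelM n) m).mem_iff.1 hU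
  exact ⟨⟨f, f.contMDiff⟩, f.eventuallyEq_one, fun x hx =>
    image_eq_zero_of_notMem_tsupport fun h => hx (hf h)⟩

/-- Near every point there are global smooth functions that are local coordinates, and global
smooth vector fields that are the corresponding coordinate fields. -/
theorem exists_coordinates (m₀ : M) : ∃ (x : Fin n → C^∞⟮modelM n, M; ℝ⟯)
    (Y : Fin n → ∀ m : M, TangentSpace (modelM n) m),
    (∀ j, ContMDiff (modelM n) (modelM n).tangent ∞
      (fun m => (⟨m, Y j m⟩ : TangentBundle (modelM n) M))) ∧
    ∀ᶠ m in 𝓝 m₀, (∀ i j, mvfderiv (modelM n) (x i) m (Y j m) = if i = j then 1 else 0) ∧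
      ∀ w, (∀ i, mvfderiv (modelM n) (x i) m w = 0) → w = 0 := by
  have : IsManifold (modelM n) 1 M := .of_le (n := ∞) (by simp)
  have : IsManifold (modelM n) (∞ + 1) M := by simpa using ‹IsManifold (modelM n) ∞ M›
  obtain ⟨χ⟩ : Nonempty (SmoothBumpFunction (modelM n) m₀) := inferInstance
  let t := trivializationAt (EuclideanSpace ℝ (Fin n)) (TangentSpace (modelM n)) m₀
  let b := (EuclideanSpace.basisFun (Fin n) ℝ).toBasis
  have hcoord : ∀ i, ContMDiffOn (modelM n) 𝓘(ℝ, ℝ) ∞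
      (fun m => (extChartAt (modelM n) m₀ m) i) (chartAt (EuclideanSpace ℝ (Fin n)) m₀).source := by
    intro i
    exact (EuclideanSpace.proj i : EuclideanSpace ℝ (Fin n) →L[ℝ] ℝ).contMDiff.comp_contMDiffOn
      (contMDiffOn_extChartAt (I := modelM n) (n := ∞) (x := m₀))
  refine ⟨fun i => ⟨fun m => χ m • (extChartAt (modelM n) m₀ m) i, χ.contMDiff_smul (hcoord i)⟩,
    fun j => (χ : M → ℝ) • t.localFrame b j, fun j => ?_, ?_⟩
  · refine ContMDiffOn.smul_section_of_tsupport χ.contMDiff.contMDiffOn t.open_baseSet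
      χ.tsupport_subset_chartAt_source ?_
    exact t.contMDiffOn_localFrame_baseSet ∞ b j
  · filter_upwards [χ.eventuallyEq_one.eventually_nhds,
      (chartAt (EuclideanSpace ℝ (Fin n)) m₀).open_source.mem_nhds (mem_chart_source _ m₀)]
      with m h1 hm
    -- Where the cutoff equals 1, the differential of the i-th cut-off coordinate is the i-th
    -- component in the tangent trivialization, because the latter is the derivative of the chart.
    have hd : ∀ i (w : TangentSpace (modelM n) m), mvfderiv (modelM n)
        (fun m => χ m • (extChartAt (modelM n) m₀ m) i) m w =
        (t.continuousLinearMapAt ℝ m w : EuclideanSpace ℝ (Fin n)) i := by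
      intro i w
      have h2 : HasMFDerivAt (modelM n) 𝓘(ℝ, ℝ) (fun m => (extChartAt (modelM n) m₀ m) i) m
          ((EuclideanSpace.proj i : EuclideanSpace ℝ (Fin n) →L[ℝ] ℝ).comp
            (mfderiv (modelM n) 𝓘(ℝ, EuclideanSpace ℝ (Fin n)) (extChartAt (modelM n) m₀) m)) :=
        (EuclideanSpace.proj i : EuclideanSpace ℝ (Fin n) →L[ℝ] ℝ).hasMFDerivAt.comp m
          (mdifferentiableAt_extChartAt hm).hasMFDerivAt
      have h3 := (h2.congr_of_eventuallyEq (f₁ := fun m => χ m • (extChartAt (modelM n) m₀ m) i) (by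
        filter_upwards [h1] with x hx; rw [hx]; simp)).mfderiv
      have h4 := TangentBundle.continuousLinearMapAt_trivializationAt (I := modelM n) hm
      have h5 : t.continuousLinearMapAt ℝ m w = mfderiv (modelM n) 𝓘(ℝ, EuclideanSpace ℝ (Fin n))
        (extChartAt (modelM n) m₀) m w := congrArg (fun L => L w) h4
      rw [h5]
      exact congrArg (fun L => L w) h3
    refine ⟨fun i j => ?_, fun w hw => ?_⟩
    · refine (hd i _).trans ?_
      have h6 : ((χ : M → ℝ) • t.localFrame b j) m = t.basisAt b hm j := by
        rw [Pi.smul_apply', h1.self_of_nhds]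
        simp [t.localFrame_apply_of_mem_baseSet b (show m ∈ t.baseSet from hm)]
      rw [h6]
      have h7 : t.continuousLinearMapAt ℝ m (t.basisAt b hm j) = b j := by
        have hm' : m ∈ t.baseSet := hm
        refine (congrFun (t.coe_linearMapAt_of_mem (R := ℝ) hm') _).trans ?_
        exact (t.linearEquivAt ℝ m hm').apply_symm_apply (b j)
      rw [h7]
      simp [b]
    · have h8 : t.continuousLinearMapAt ℝ m w = 0 := by
        ext i
        exact (hd i w).symm.trans (hw i)
      have h9 := t.symmL_continuousLinearMapAt (R := ℝ) (show m ∈ t.baseSet from hm) w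
      rw [h8, map_zero] at h9
      exact h9.symm

end base

end AVBundle

/-! ### Fibres of the AV-bundle, affine functions of sections, existence of a global section. -/

namespace AVBundle

section fibres

variable {n : ℕ} {M Z : Type*} [TopologicalSpace M]
    [ChartedSpace (EuclideanSpace ℝ (Fin n)) M] [TopologicalSpace Z]
    [ChartedSpace (ModelProd (EuclideanSpace ℝ (Fin n)) ℝ) Z] [AddAction ℝ Z]
    (ζ : AVBundle n M Z)

theorem vadd_injective (ζ : AVBundle n M Z) (z : Z) : Function.Injective fun r : ℝ => r +ᵥ z := by
  intro r s h
  obtain ⟨U, e, -, hm, hs, -, -, h2, -⟩ := ζ.exists_triv (ζ.proj z)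
  have hz : z ∈ e.source := by rw [hs]; exact hm
  have h3 := congrArg (fun w => (e w).2) h
  simpa [h2 _ _ hz] using h3

/-- Smoothness of the projection is not part of the structure; it is read off from the first
coordinate of a local trivialization. -/
theorem contMDiff_proj : ContMDiff (modelZ n) (modelM n) ∞ ζ.proj := by
  intro z
  obtain ⟨U, e, -, hm, hs, -, h1, -, hc, -⟩ := ζ.exists_triv (ζ.proj z)
  have hz : z ∈ e.source := by rw [hs]; exact hm
  have hn := e.open_source.mem_nhds hz
  refine (contMDiffAt_fst.comp z ((hc z hz).contMDiffAt hn)).congr_of_eventuallyEq ?_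
  filter_upwards [hn] with w hw using (h1 w hw).symm

/-- The pullback of a function on `M` to `Z`. -/
noncomputable def pullback (f : C^∞⟮modelM n, M; ℝ⟯) (z : Z) : ℝ := f (ζ.proj z)

theorem contMDiff_pullback (f : C^∞⟮modelM n, M; ℝ⟯) :
    ContMDiff (modelZ n) 𝓘(ℝ, ℝ) ∞ (ζ.pullback f) := f.contMDiff.comp ζ.contMDiff_proj

/-- A function with constant slope along the fibres. -/
theorem fundField_apply_of_slope {g : Z → ℝ} (hg : ContMDiff (modelZ n) 𝓘(ℝ, ℝ) ∞ g) {c : ℝ}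
    (h : ∀ (r : ℝ) z, g (r +ᵥ z) = g z - c * r) : fieldApply ζ.fundField g = fun _ => c := by
  ext z
  have h1 := ζ.hasDerivAt_orbit (hg.mdifferentiableAt (x := z) (by simp))
  simp only [h] at h1
  have h2 : HasDerivAt (fun s : ℝ => g z - c * s) (-c) 0 := by
    simpa using ((hasDerivAt_id (0 : ℝ)).const_mul c).const_sub (g z)
  exact neg_injective (h1.unique h2)

theorem fundField_apply_of_const {g : Z → ℝ} (hg : ContMDiff (modelZ n) 𝓘(ℝ, ℝ) ∞ g)
    (h : ∀ (r : ℝ) z, g (r +ᵥ z) = g z) : fieldApply ζ.fundField g = 0 :=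
  ζ.fundField_apply_of_slope hg (c := 0) fun r z => by rw [h, zero_mul, sub_zero]

theorem fundField_pullback (f : C^∞⟮modelM n, M; ℝ⟯) :
    fieldApply ζ.fundField (ζ.pullback f) = 0 :=
  ζ.fundField_apply_of_const (ζ.contMDiff_pullback f) fun r z => by
    rw [pullback, ζ.proj_vadd]; rfl

variable {ζ}

namespace Section

variable (σ : ζ.Section)

theorem F_vadd_self (z : Z) : σ.F z +ᵥ z = σ.toFun (ζ.proj z) :=
  Classical.epsilon_spec (p := fun r : ℝ => r +ᵥ z = σ.toFun (ζ.proj z))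
    (ζ.exists_vadd_eq (σ.proj_toFun (ζ.proj z)).symm)

theorem F_eq {z : Z} {r : ℝ} (h : r +ᵥ z = σ.toFun (ζ.proj z)) : σ.F z = r :=
  ζ.vadd_injective z ((σ.F_vadd_self z).trans h.symm)

theorem F_vadd (r : ℝ) (z : Z) : σ.F (r +ᵥ z) = σ.F z - r := by
  apply σ.F_eq
  rw [vadd_vadd, sub_add_cancel, σ.F_vadd_self, ζ.proj_vadd]

theorem F_toFun (m : M) : σ.F (σ.toFun m) = 0 := by
  apply σ.F_eq
  rw [zero_vadd, σ.proj_toFun]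

theorem vadd_F (f : C^∞⟮modelM n, M; ℝ⟯) : (f +ᵥ σ).F = ζ.pullback f + σ.F := by
  ext z
  apply F_eq
  rw [Pi.add_apply, ← vadd_vadd, σ.F_vadd_self]; rfl

theorem contMDiff_F : ContMDiff (modelZ n) 𝓘(ℝ, ℝ) ∞ σ.F := by
  intro z
  obtain ⟨U, e, -, hm, hs, -, h1, h2, hc, -⟩ := ζ.exists_triv (ζ.proj z)
  have hz : z ∈ e.source := by rw [hs]; exact hm
  have hn := e.open_source.mem_nhds hz
  have h3 : ∀ w ∈ e.source, ContMDiffAt (modelZ n) 𝓘(ℝ, ℝ) ∞ (fun w => (e w).2) w := fun w hw =>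
    contMDiffAt_snd.comp w ((hc w hw).contMDiffAt (e.open_source.mem_nhds hw))
  have hσ : σ.toFun (ζ.proj z) ∈ e.source := by
    rw [hs]; change ζ.proj _ ∈ U; rwa [σ.proj_toFun]
  have h4 : ContMDiffAt (modelZ n) 𝓘(ℝ, ℝ) ∞ (fun w => (e (σ.toFun (ζ.proj w))).2) z :=
    ContMDiffAt.comp (f := fun w => σ.toFun (ζ.proj w)) z (h3 _ hσ) ((σ.smooth.comp ζ.contMDiff_proj) z)
  refine (h4.sub (h3 z hz)).congr_of_eventuallyEq ?_
  filter_upwards [hn] with w hw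
  rw [← σ.F_vadd_self, h2 _ w hw]; ring

theorem fundField_F : fieldApply ζ.fundField σ.F = fun _ => 1 :=
  ζ.fundField_apply_of_slope σ.contMDiff_F fun r z => by rw [σ.F_vadd, one_mul]

end Section

variable (ζ)

/-- The fibres are affine lines, so the zero sections of local trivializations can be averaged with
a partition of unity. -/
theorem nonempty_section [T2Space M] [SigmaCompactSpace M] [IsManifold (modelM n) ∞ M] :
    Nonempty ζ.Section := by
  choose U e hU hm hs ht h1 h2 hc hd using ζ.exists_triv
  obtain ⟨ρ, hρ⟩ := SmoothPartitionOfUnity.exists_isSubordinate (modelM n) isClosed_univ U hU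
    fun m _ => Set.mem_iUnion.2 ⟨m, hm m⟩
  have hsupp : ∀ {i m}, ρ i m ≠ 0 → m ∈ U i := fun {i m} h => hρ i (subset_tsupport _ h)
  -- The weighted mean of the displacements from z to the local zero sections. It drops by r when z
  -- is translated by r, so c(z) + z depends only on the fibre of z.
  let c : Z → ℝ := fun z => ∑ᶠ i, ρ i (ζ.proj z) • -(e i z).2
  have hcv : ∀ (r : ℝ) z, c (r +ᵥ z) = c z - r := by
    intro r z
    have hf : ∀ g : M → ℝ, (Function.support fun i => ρ i (ζ.proj z) • g i).Finite := fun g =>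
      (ρ.locallyFinite.point_finite (ζ.proj z)).subset fun i hi h0 => hi (by simp [h0])
    have h3 : ∀ i, ρ i (ζ.proj (r +ᵥ z)) • -(e i (r +ᵥ z)).2 =
        ρ i (ζ.proj z) • -(e i z).2 + ρ i (ζ.proj z) • -r := by
      intro i
      rw [ζ.proj_vadd]
      by_cases h0 : ρ i (ζ.proj z) = 0
      · simp [h0]
      · have hz : z ∈ (e i).source := by rw [hs]; exact hsupp h0
        rw [h2 i r z hz, ← smul_add]; congr 1; ring
    change ∑ᶠ i, _ = ∑ᶠ i, _ - r
    rw [finsum_congr h3, finsum_add_distrib (hf _) (hf _), sub_eq_add_neg]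
    congr 1
    have h4 : (∑ᶠ i, ρ i (ζ.proj z)) • -r = ∑ᶠ i, ρ i (ζ.proj z) • -r :=
      finsum_smul _ _
    rw [← h4, ρ.sum_eq_one (Set.mem_univ _), one_smul]
  choose s hsec using ζ.exists_over
  have hind : ∀ z, c z +ᵥ z = c (s (ζ.proj z)) +ᵥ s (ζ.proj z) := by
    intro z
    obtain ⟨r, hr⟩ := ζ.exists_vadd_eq (hsec (ζ.proj z)).symm
    rw [← hr, hcv, vadd_vadd, sub_add_cancel]
  refine ⟨⟨fun m => c (s m) +ᵥ s m, fun m => by rw [ζ.proj_vadd, hsec], fun m => ?_⟩⟩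
  have hmem : ∀ x ∈ U m, (x, (0 : ℝ)) ∈ (e m).target := fun x hx => by
    rw [ht]; exact ⟨hx, trivial⟩
  -- The chosen points s m need not vary smoothly; by `hind` they may be replaced by the zero
  -- section of the trivialization around m.
  have hs0 : ContMDiffAt (modelM n) (modelZ n) ∞ (fun x : M => (e m).symm (x, (0 : ℝ))) m :=
    ContMDiffAt.comp m
      ((hd m _ (hmem m (hm m))).contMDiffAt ((e m).open_target.mem_nhds (hmem m (hm m))))
      (contMDiffAt_id.prodMk contMDiffAt_const)
  have hp0 : ∀ x ∈ U m, ζ.proj ((e m).symm (x, (0 : ℝ))) = x := fun x hx => by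
    rw [← h1 m _ ((e m).map_target (hmem x hx)), (e m).right_inv (hmem x hx)]
  have hc0 : ContMDiffAt (modelM n) 𝓘(ℝ, ℝ) ∞
      (fun x => ∑ᶠ i, ρ i x • -(e i ((e m).symm (x, (0 : ℝ)))).2) m := by
    refine ρ.contMDiffAt_finsum fun i hi => ?_
    have hz : (e m).symm (m, (0 : ℝ)) ∈ (e i).source := by
      rw [hs]; change ζ.proj _ ∈ U i; rw [hp0 m (hm m)]; exact hρ i hi
    exact (contMDiffAt_snd.comp m (ContMDiffAt.comp m
      ((hc i _ hz).contMDiffAt ((e i).open_source.mem_nhds hz)) hs0)).neg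
  refine ((ζ.contMDiff_vadd _).comp m (hc0.prodMk hs0)).congr_of_eventuallyEq ?_
  filter_upwards [(hU m).mem_nhds (hm m)] with x hx
  have h5 := hind ((e m).symm (x, (0 : ℝ)))
  simp only [c, hp0 x hx] at h5
  exact h5.symm

end fibres

end AVBundle

/-! ### Vector fields on the total space: basic functions, horizontal lifts, commutators. -/

namespace AVBundle

section derivations

variable {n : ℕ} {Z : Type*} [TopologicalSpace Z]
    [ChartedSpace (ModelProd (EuclideanSpace ℝ (Fin n)) ℝ) Z]

theorem fieldApply_sub (X : ∀ z : Z, TangentSpace (modelZ n) z) {f g : Z → ℝ}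
    (hf : ContMDiff (modelZ n) 𝓘(ℝ, ℝ) ∞ f) (hg : ContMDiff (modelZ n) 𝓘(ℝ, ℝ) ∞ g) :
    fieldApply X (f - g) = fieldApply X f - fieldApply X g := by
  ext z
  have h := mvfderiv_sub (I := modelZ n) (hf.mdifferentiableAt (x := z) (by simp))
    (hg.mdifferentiableAt (x := z) (by simp))
  simp only [fieldApply, h, Pi.sub_apply]; rfl

theorem fieldApply_field_add (X Y : ∀ z : Z, TangentSpace (modelZ n) z) (f : Z → ℝ) :
    fieldApply (X + Y) f = fieldApply X f + fieldApply Y f := by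
  ext z; exact map_add (mvfderiv (modelZ n) f z) (X z) (Y z)

theorem operatorBracket_swap (D D' : (∀ z : Z, TangentSpace (modelZ n) z) × (Z → ℝ)) :
    operatorBracket D D' = -operatorBracket D' D :=
  Prod.ext mlieBracket_swap (neg_sub _ _).symm

end derivations

section fields

variable {n : ℕ} {M Z : Type*} [TopologicalSpace M]
    [ChartedSpace (EuclideanSpace ℝ (Fin n)) M] [TopologicalSpace Z]
    [ChartedSpace (ModelProd (EuclideanSpace ℝ (Fin n)) ℝ) Z] [AddAction ℝ Z]
    (ζ : AVBundle n M Z)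

theorem exists_pullback_eq {g : Z → ℝ} (hg : ContMDiff (modelZ n) 𝓘(ℝ, ℝ) ∞ g)
    (h0 : fieldApply ζ.fundField g = 0) : ∃ f : C^∞⟮modelM n, M; ℝ⟯, ζ.pullback f = g := by
  obtain ⟨f, hf⟩ := ζ.exists_descend hg (ζ.const_along_fibres hg fun z => congrFun h0 z)
  exact ⟨f, funext hf⟩

/-- The anchor, φ⁰ and the jets are defined by evaluation at one chosen point of a fibre; this
permits evaluation at any other point. -/
theorem eq_of_fundField_eq_zero {g : Z → ℝ} (hg : ContMDiff (modelZ n) 𝓘(ℝ, ℝ) ∞ g)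
    (h0 : fieldApply ζ.fundField g = 0) {m : M} {z z' : Z} (hz : ζ.proj z = m)
    (hz' : ζ.proj z' = m) : g z = g z' := by
  obtain ⟨f, rfl⟩ := ζ.exists_pullback_eq hg h0
  rw [pullback, pullback, hz, hz']

theorem pullback_eq_of_forall {g : Z → ℝ} {f : C^∞⟮modelM n, M; ℝ⟯}
    (h : ∀ m z, ζ.proj z = m → f m = g z) : ζ.pullback f = g :=
  funext fun z => h _ z rfl

theorem mvfderiv_pullback (f : C^∞⟮modelM n, M; ℝ⟯) (z : Z) (w : TangentSpace (modelZ n) z) :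
    mvfderiv (modelZ n) (ζ.pullback f) z w =
      mvfderiv (modelM n) f (ζ.proj z) (mfderiv (modelZ n) (modelM n) ζ.proj z w) :=
  mvfderiv_comp_apply z (f.contMDiff.mdifferentiableAt (by simp))
    (ζ.contMDiff_proj.mdifferentiableAt (by simp)) w

variable {ζ}

theorem Section.contMDiff_neg_vadd (σ : ζ.Section) :
    ContMDiff (𝓘(ℝ, ℝ).prod (modelM n)) (modelZ n) ∞
      (fun p : ℝ × M => -p.1 +ᵥ σ.toFun p.2) :=
  ζ.contMDiff_vadd.comp ((contMDiff_fst.neg).prodMk (σ.smooth.comp contMDiff_snd))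

theorem Section.neg_F_vadd (σ : ζ.Section) (z : Z) : -σ.F z +ᵥ σ.toFun (ζ.proj z) = z := by
  rw [← σ.F_vadd_self, vadd_vadd, neg_add_cancel, zero_vadd]

/-- Tangent vectors of `Z` are separated by the coordinates of `M` and one affine function. -/
theorem Section.eq_zero_of_coordinates (σ : ζ.Section) {z : Z} {x : Fin n → C^∞⟮modelM n, M; ℝ⟯}
    (hx : ∀ w, (∀ i, mvfderiv (modelM n) (x i) (ζ.proj z) w = 0) → w = 0)
    {w : TangentSpace (modelZ n) z} (h : ∀ i, mvfderiv (modelZ n) (ζ.pullback (x i)) z w = 0)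
    (h' : mvfderiv (modelZ n) σ.F z w = 0) : w = 0 := by
  have h1 := hx _ fun i => (ζ.mvfderiv_pullback (x i) z w).symm.trans (h i)
  have hF : HasMFDerivAt (modelZ n) 𝓘(ℝ, ℝ) σ.F z (mfderiv (modelZ n) 𝓘(ℝ, ℝ) σ.F z) :=
    (σ.contMDiff_F.mdifferentiableAt (by simp)).hasMFDerivAt
  have hp : HasMFDerivAt (modelZ n) (modelM n) ζ.proj z (mfderiv (modelZ n) (modelM n) ζ.proj z) :=
    (ζ.contMDiff_proj.mdifferentiableAt (by simp)).hasMFDerivAt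
  have hA := (σ.contMDiff_neg_vadd.mdifferentiableAt (x := (σ.F z, ζ.proj z)) (by simp)).hasMFDerivAt
  have h2 := HasMFDerivAt.comp (f := fun z => (σ.F z, ζ.proj z)) z hA (hF.prodMk hp)
  -- The map z ↦ (F_σ(z), ζ(z)) has a smooth left inverse, so a vector killed by its differential is
  -- zero.
  have h3 : (fun p : ℝ × M => -p.1 +ᵥ σ.toFun p.2) ∘ (fun z => (σ.F z, ζ.proj z)) = id :=
    funext σ.neg_F_vadd
  rw [h3] at h2
  have h4 := congrArg (fun L => L w) (hasMFDerivAt_unique h2 (hasMFDerivAt_id z))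
  refine h4.symm.trans ?_
  have h5 : (mfderiv (modelZ n) 𝓘(ℝ, ℝ) σ.F z w, mfderiv (modelZ n) (modelM n) ζ.proj z w) =
      ((0 : ℝ), (0 : EuclideanSpace ℝ (Fin n))) := Prod.ext h' h1
  refine Eq.trans ?_ (map_zero (mfderiv (𝓘(ℝ, ℝ).prod (modelM n)) (modelZ n)
    (fun p : ℝ × M => -p.1 +ᵥ σ.toFun p.2) (σ.F z, ζ.proj z)))
  exact congrArg (mfderiv (𝓘(ℝ, ℝ).prod (modelM n)) (modelZ n)
    (fun p : ℝ × M => -p.1 +ᵥ σ.toFun p.2) (σ.F z, ζ.proj z)) h5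

/-- The horizontal lift of a vector field on `M` for the flat connection defined by a section. -/
noncomputable def Section.lift (σ : ζ.Section) (Y : ∀ m : M, TangentSpace (modelM n) m) (z : Z) :
    TangentSpace (modelZ n) z :=
  (mfderiv (modelM n) (modelZ n) (fun m => -σ.F z +ᵥ σ.toFun m) (ζ.proj z) (Y (ζ.proj z)) :
    EuclideanSpace ℝ (Fin n) × ℝ)

theorem Section.lift_apply (σ : ζ.Section) (Y : ∀ m : M, TangentSpace (modelM n) m)
    {g : Z → ℝ} (hg : ContMDiff (modelZ n) 𝓘(ℝ, ℝ) ∞ g) (z : Z) :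
    fieldApply (σ.lift Y) g z = mvfderiv (modelM n) (fun m => g (-σ.F z +ᵥ σ.toFun m)) (ζ.proj z)
      (Y (ζ.proj z)) := by
  have hf : ContMDiff (modelM n) (modelZ n) ∞ (fun m => -σ.F z +ᵥ σ.toFun m) :=
    ζ.contMDiff_vadd.comp (contMDiff_const.prodMk σ.smooth)
  have h1 := mvfderiv_comp_apply (I := modelZ n) (ζ.proj z) (hg.mdifferentiableAt (by simp))
    (hf.mdifferentiableAt (x := ζ.proj z) (by simp)) (Y (ζ.proj z))
  refine Eq.trans ?_ h1.symm
  have aux : ∀ (w : Z) (v : EuclideanSpace ℝ (Fin n) × ℝ), w = z →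
      (mvfderiv (modelZ n) g z v : ℝ) = (mvfderiv (modelZ n) g w v : ℝ) := by
    rintro w v rfl; rfl
  exact aux _ _ (σ.neg_F_vadd z)

theorem Section.lift_pullback (σ : ζ.Section) (Y : ∀ m : M, TangentSpace (modelM n) m)
    (f : C^∞⟮modelM n, M; ℝ⟯) (z : Z) : fieldApply (σ.lift Y) (ζ.pullback f) z =
      mvfderiv (modelM n) f (ζ.proj z) (Y (ζ.proj z)) := by
  rw [σ.lift_apply Y (ζ.contMDiff_pullback f)]
  simp only [pullback, ζ.proj_vadd, σ.proj_toFun]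

theorem Section.lift_F (σ : ζ.Section) (Y : ∀ m : M, TangentSpace (modelM n) m) :
    fieldApply (σ.lift Y) σ.F = 0 := by
  ext z
  rw [σ.lift_apply Y σ.contMDiff_F]
  simp only [σ.F_vadd, σ.F_toFun]
  rw [mvfderiv_const]; rfl

variable [IsManifold (modelZ n) ∞ Z]

theorem Section.smooth_lift [IsManifold (modelM n) ∞ M] (σ : ζ.Section)
    {Y : ∀ m : M, TangentSpace (modelM n) m}
    (hY : ContMDiff (modelM n) (modelM n).tangent ∞
      (fun m => (⟨m, Y m⟩ : TangentBundle (modelM n) M))) : SmoothField (σ.lift Y) := by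
  have h0 : ContMDiff (modelZ n) (modelM n).tangent ∞
      (fun z : Z => (⟨ζ.proj z, Y (ζ.proj z)⟩ : TangentBundle (modelM n) M)) :=
    hY.comp ζ.contMDiff_proj
  have h1 : ContMDiff (modelZ n) (𝓘(ℝ, ℝ)).tangent ∞
      (fun z : Z => (⟨σ.F z, (0 : ℝ)⟩ : TangentBundle 𝓘(ℝ, ℝ) ℝ)) :=
    (Bundle.contMDiff_zeroSection ℝ (TangentSpace 𝓘(ℝ, ℝ) : ℝ → Type _)).comp σ.contMDiff_F
  have h2 := contMDiff_equivTangentBundleProd_symm (I := 𝓘(ℝ, ℝ)) (M := ℝ) (I' := modelM n)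
    (M' := M) (n := ∞)
  have h3 := ContMDiff.contMDiff_tangentMap (m := ∞) σ.contMDiff_neg_vadd (by simp)
  have h := (h3.comp h2).comp (h1.prodMk h0)
  unfold SmoothField
  refine h.congr fun z => ?_
  have hd : MDifferentiableAt (𝓘(ℝ, ℝ).prod (modelM n)) (modelZ n)
        (fun p : ℝ × M => -p.1 +ᵥ σ.toFun p.2) (σ.F z, ζ.proj z) :=
    σ.contMDiff_neg_vadd.mdifferentiableAt (by simp)
  have aux : ∀ (w : Z) (v v' : EuclideanSpace ℝ (Fin n) × ℝ), w = z → v' = v →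
      (⟨z, v⟩ : TangentBundle (modelZ n) Z) = ⟨w, v'⟩ := by
    rintro w v v' rfl rfl; rfl
  refine aux _ _ _ (σ.neg_F_vadd z) ?_
  refine (mfderiv_prod_eq_add_apply hd).trans ?_
  refine Eq.trans (congrArg₂ (· + ·) (map_zero _) rfl) (zero_add _)

/-- The bracket of vector fields is the commutator of derivations. -/
theorem fieldApply_bracket (ζ : AVBundle n M Z) {X Y : ∀ z : Z, TangentSpace (modelZ n) z} (hX : SmoothField X)
    (hY : SmoothField Y) {f : Z → ℝ} (hf : ContMDiff (modelZ n) 𝓘(ℝ, ℝ) ∞ f) :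
    fieldApply (mlieBracket (modelZ n) X Y) f =
      fieldApply X (fieldApply Y f) - fieldApply Y (fieldApply X f) := by
  have hV := ζ.smooth_fundField
  have hXf := hX.fieldApply hf
  have hYf := hY.fieldApply hf
  -- The Jacobi identity for X, Y and f X_Z is expanded by the Leibniz rule. All terms cancel except
  -- a multiple of X_Z, whose coefficient must vanish since X_Z is nowhere zero.
  have h := hX.jacobi hY (hV.smul hf)
  rw [hV.bracket_smul hf, hV.bracket_smul hf, hV.bracket_smul hf,
    (hV.smul hYf).bracket_add ((hY.bracket hV).smul hf),
    (hV.smul hXf).bracket_add ((hX.bracket hV).smul hf), hV.bracket_smul hYf,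
    hV.bracket_smul hXf, (hY.bracket hV).bracket_smul hf, (hX.bracket hV).bracket_smul hf,
    hX.jacobi hY hV] at h
  ext z
  have h1 := congrFun h z
  have h2 : (fieldApply (mlieBracket (modelZ n) X Y) f z -
      (fieldApply X (fieldApply Y f) z - fieldApply Y (fieldApply X f) z)) •
      ζ.fundField z = 0 := by
    simp only [Pi.add_apply, Pi.smul_apply', smul_add] at h1
    rw [sub_smul, sub_smul]
    rw [← sub_eq_zero] at h1
    rw [← neg_eq_zero, ← h1]
    abel
  exact sub_eq_zero.1 ((smul_eq_zero.1 h2).resolve_right (ζ.fundField_ne_zero z))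

end fields

end AVBundle

theorem eq_sum_of_dual {V κ : Type*} [AddCommGroup V] [Module ℝ V] [Fintype κ] [DecidableEq κ]
    {e : κ → V} {θ : κ → Module.Dual ℝ V} (h : ∀ i j, θ i (e j) = if i = j then 1 else 0)
    (h0 : ∀ v, (∀ i, θ i v = 0) → v = 0) (v : V) : v = ∑ i, θ i v • e i := by
  rw [← sub_eq_zero]
  refine h0 _ fun i => ?_
  simp [h]

/-! ### The operator algebroid: anchor, canonical form, jets, and basic operators. -/

namespace AVBundle

section operators

variable {n : ℕ} {M : Type u} {Z : Type v} [TopologicalSpace M]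
    [ChartedSpace (EuclideanSpace ℝ (Fin n)) M] [TopologicalSpace Z]
    [ChartedSpace (ModelProd (EuclideanSpace ℝ (Fin n)) ℝ) Z] [AddAction ℝ Z]
    [IsManifold (modelZ n) ∞ Z] (ζ : AVBundle n M Z)

variable {ζ}

theorem operator_ev_surjective {m : M} (v : ζ.operatorAlgebroid.Fib m) :
    ∃ D, ζ.operatorAlgebroid.ev m D = v := by
  obtain ⟨_, D, hD, rfl⟩ := v
  exact ⟨⟨D, hD⟩, rfl⟩

theorem operator_ext {m : M} {v w : ζ.operatorAlgebroid.Fib m}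
    (h : ∀ z : ζ.fibre m, v.1.1 z = w.1.1 z ∧ v.1.2 z = w.1.2 z) : v = w :=
  Subtype.ext (Prod.ext (funext fun z => (h z).1) (funext fun z => (h z).2))

theorem operator_anchor (D : ζ.operatorAlgebroid.Sec) (f : C^∞⟮modelM n, M; ℝ⟯) {m : M} {z : Z}
    (hz : ζ.proj z = m) : ζ.operatorAlgebroid.anchor m (ζ.operatorAlgebroid.ev m D) f =
      fieldApply D.1.1 (ζ.pullback f) z :=
  ζ.eq_of_fundField_eq_zero (D.2.1.fieldApply (ζ.contMDiff_pullback f))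
    (ζ.fundField_apply_apply D.2 (ζ.contMDiff_pullback f) (ζ.fundField_pullback f))
    (ζ.basePoint m).2 hz

theorem operator_phiZero (D : ζ.operatorAlgebroid.Sec) {m : M} {z : Z} (hz : ζ.proj z = m) :
    ζ.phiZero.1 m (ζ.operatorAlgebroid.ev m D) = D.1.2 z :=
  ζ.eq_of_fundField_eq_zero D.2.2.1 D.2.2.2.1 (ζ.basePoint m).2 hz

theorem contMDiff_operator_F (D : ζ.operatorAlgebroid.Sec) (σ : ζ.Section) :
    ContMDiff (modelZ n) 𝓘(ℝ, ℝ) ∞ (fieldApply D.1.1 σ.F + D.1.2 * σ.F) :=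
  (D.2.1.fieldApply σ.contMDiff_F).add (D.2.2.1.mul σ.contMDiff_F)

/-- Since X_Z(F_σ) = 1 is constant and [X, X_Z] = hX_Z, one has X_Z(X(F_σ)) = −h, while X_Z(hF_σ) =
h. -/
theorem fundField_operator_F (D : ζ.operatorAlgebroid.Sec) (σ : ζ.Section) :
    fieldApply ζ.fundField (fieldApply D.1.1 σ.F + D.1.2 * σ.F) = 0 := by
  obtain ⟨⟨X, h⟩, hX, hh, h0, hb⟩ := D
  have h1 := ζ.fieldApply_bracket hX ζ.smooth_fundField σ.contMDiff_F
  change fieldApply ζ.fundField h = 0 at h0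
  change mlieBracket (modelZ n) X ζ.fundField = h • ζ.fundField at hb
  rw [hb, fieldApply_smul, σ.fundField_F, fieldApply_const, zero_sub] at h1
  change fieldApply ζ.fundField (fieldApply X σ.F + h * σ.F) = 0
  rw [fieldApply_add _ (hX.fieldApply σ.contMDiff_F) (hh.mul σ.contMDiff_F),
    fieldApply_mul _ hh σ.contMDiff_F, σ.fundField_F, h0, mul_zero, add_zero]
  rw [← sub_eq_zero, sub_eq_add_neg, ← neg_eq_zero] at h1
  rw [add_comm, ← neg_neg (fieldApply ζ.fundField (fieldApply X σ.F)), ← neg_eq_zero]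
  rw [← h1]

theorem operator_jet (D : ζ.operatorAlgebroid.Sec) (σ : ζ.Section) {m : M} {z : Z}
    (hz : ζ.proj z = m) : σ.jet m (ζ.operatorAlgebroid.ev m D) =
      fieldApply D.1.1 σ.F z + D.1.2 z * σ.F z :=
  ζ.eq_of_fundField_eq_zero (contMDiff_operator_F D σ) (fundField_operator_F D σ) (σ.proj_toFun m) hz

/-- The `1`-form on `L̃Z` defined by a section. -/
noncomputable def Section.jetForm (σ : ζ.Section) : ζ.operatorAlgebroid.OneForm :=
  ⟨σ.jet, fun D => by
    obtain ⟨f, hf⟩ := ζ.exists_pullback_eq (contMDiff_operator_F D σ) (fundField_operator_F D σ)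
    refine ⟨f, fun m => ?_⟩
    obtain ⟨z, rfl⟩ := ζ.exists_over m
    rw [operator_jet D σ rfl]
    exact (congrFun hf z).symm⟩

theorem operator_exists_anchor (D : ζ.operatorAlgebroid.Sec) (f : C^∞⟮modelM n, M; ℝ⟯) :
    ∃ g : C^∞⟮modelM n, M; ℝ⟯, ∀ m,
      ζ.operatorAlgebroid.anchor m (ζ.operatorAlgebroid.ev m D) f = g m := by
  obtain ⟨g, hg⟩ := ζ.exists_pullback_eq (D.2.1.fieldApply (ζ.contMDiff_pullback f))
    (ζ.fundField_apply_apply D.2 (ζ.contMDiff_pullback f) (ζ.fundField_pullback f))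
  refine ⟨g, fun m => ?_⟩
  obtain ⟨z, rfl⟩ := ζ.exists_over m
  rw [operator_anchor D f rfl, ← hg]; rfl

variable (ζ) in
/-- The differential of a function as a `1`-form on `L̃Z`. -/
noncomputable def anchorForm (f : C^∞⟮modelM n, M; ℝ⟯) : ζ.operatorAlgebroid.OneForm :=
  ⟨fun m =>
    { toFun := fun v => ζ.operatorAlgebroid.anchor m v f
      map_add' := fun _ _ => map_add
        (mvfderiv (modelZ n) (fun z => f (ζ.proj z)) (ζ.basePoint m).1) _ _
      map_smul' := fun c _ => map_smul
        (mvfderiv (modelZ n) (fun z => f (ζ.proj z)) (ζ.basePoint m).1) c _ },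
    fun D => operator_exists_anchor D f⟩

/-- The form φ⁰ kills the order-zero part; the jet then reads X(F_σ), which with the coordinates of
M determines the vector part at every point of the fibre. -/
theorem operator_eq_zero (σ : ζ.Section) {m : M} {x : Fin n → C^∞⟮modelM n, M; ℝ⟯}
    (hx : ∀ w, (∀ i, mvfderiv (modelM n) (x i) m w = 0) → w = 0)
    {v : ζ.operatorAlgebroid.Fib m} (h : ∀ i, ζ.operatorAlgebroid.anchor m v (x i) = 0)
    (hσ : σ.jet m v = 0) (h0 : ζ.phiZero.1 m v = 0) : v = 0 := by
  obtain ⟨D, rfl⟩ := operator_ev_surjective v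
  refine operator_ext ?_
  rintro ⟨z, rfl⟩
  have h2 : D.1.2 z = 0 := (operator_phiZero D rfl).symm.trans h0
  refine ⟨σ.eq_zero_of_coordinates (x := x) hx (fun i => ?_) ?_, h2⟩
  · exact (operator_anchor D (x i) rfl).symm.trans (h i)
  · have h3 := (operator_jet D σ rfl).symm.trans hσ
    rwa [h2, zero_mul, add_zero] at h3

theorem operator_mem_smul_add {D D' : (∀ z : Z, TangentSpace (modelZ n) z) × (Z → ℝ)}
    (hD : D ∈ ζ.affineOperators) (hD' : D' ∈ ζ.affineOperators) (f : C^∞⟮modelM n, M; ℝ⟯) :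
    (D.1 + ζ.pullback f • D'.1, D.2 + ζ.pullback f * D'.2) ∈ ζ.affineOperators := by
  refine add_mem hD (?_ : (ζ.pullback f • D'.1, ζ.pullback f * D'.2) ∈ ζ.affineOperators)
  obtain ⟨hX, hh, h0, hb⟩ := hD'
  have hf := ζ.contMDiff_pullback f
  refine ⟨hX.smul hf, hf.mul hh, ?_, ?_⟩
  · change fieldApply ζ.fundField (ζ.pullback f * D'.2) = 0
    rw [fieldApply_mul _ hf hh, h0, ζ.fundField_pullback, mul_zero, mul_zero, add_zero]
  · change mlieBracket (modelZ n) (ζ.pullback f • D'.1) ζ.fundField =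
      (ζ.pullback f * D'.2) • ζ.fundField
    rw [mlieBracket_swap, hX.bracket_smul hf, ζ.fundField_pullback, zero_smul, zero_add,
      ← smul_neg, ← mlieBracket_swap, hb, smul_smul]

/-- The bracket of X_Z with the lift is tested on pullbacks of coordinates and on F_σ. The lift
preserves basic functions and kills F_σ, while X_Z kills the former and sends F_σ to a constant, so
every commutator vanishes. -/
theorem lift_mem [T2Space M] [IsManifold (modelM n) ∞ M] (σ : ζ.Section)
    {Y : ∀ m : M, TangentSpace (modelM n) m}
    (hY : ContMDiff (modelM n) (modelM n).tangent ∞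
      (fun m => (⟨m, Y m⟩ : TangentBundle (modelM n) M))) : σ.lift Y ∈ ζ.invariantFields := by
  have hL := σ.smooth_lift hY
  refine ⟨hL, funext fun z => ?_⟩
  obtain ⟨x, _, _, hx⟩ := exists_coordinates (n := n) (ζ.proj z)
  refine σ.eq_zero_of_coordinates hx.self_of_nhds.2 (fun i => ?_) ?_
  · have h1 : fieldApply ζ.fundField (fieldApply (σ.lift Y) (ζ.pullback (x i))) = 0 := by
      refine ζ.fundField_apply_of_const (hL.fieldApply (ζ.contMDiff_pullback _)) fun r z => ?_
      rw [σ.lift_pullback, σ.lift_pullback, ζ.proj_vadd]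
    have h2 := ζ.fieldApply_bracket ζ.smooth_fundField hL (ζ.contMDiff_pullback (x i))
    rw [h1, ζ.fundField_pullback] at h2
    have h3 : fieldApply (σ.lift Y) 0 = 0 := fieldApply_const _ 0
    rw [h3, sub_zero] at h2
    exact congrFun h2 z
  · have h2 := ζ.fieldApply_bracket ζ.smooth_fundField hL σ.contMDiff_F
    have h3 : fieldApply ζ.fundField 0 = 0 := fieldApply_const _ 0
    rw [σ.lift_F, σ.fundField_F, fieldApply_const, h3, sub_zero] at h2
    exact congrFun h2 z

theorem invariant_mem {X : ∀ z : Z, TangentSpace (modelZ n) z} (hX : X ∈ ζ.invariantFields) :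
    (X, (0 : Z → ℝ)) ∈ ζ.affineOperators := by
  refine ⟨hX.1, contMDiff_const, fieldApply_const _ 0, ?_⟩
  change mlieBracket (modelZ n) X ζ.fundField = (0 : Z → ℝ) • ζ.fundField
  rw [mlieBracket_swap, hX.2, zero_smul, neg_zero]

theorem fundField_mem : ζ.fundField ∈ ζ.invariantFields :=
  ⟨ζ.smooth_fundField, mlieBracket_self⟩

/-- This operator has order-zero part 1, annihilates F_σ and has zero anchor: it is the frame
element dual to φ⁰. -/
theorem euler_mem (σ : ζ.Section) :
    (-σ.F • ζ.fundField, (1 : Z → ℝ)) ∈ ζ.affineOperators := by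
  have hF : ContMDiff (modelZ n) 𝓘(ℝ, ℝ) ∞ (-σ.F) := σ.contMDiff_F.neg
  refine ⟨ζ.smooth_fundField.smul hF, contMDiff_const, fieldApply_const _ 1, ?_⟩
  change mlieBracket (modelZ n) (-σ.F • ζ.fundField) ζ.fundField = (1 : Z → ℝ) • ζ.fundField
  have h1 : fieldApply ζ.fundField (-σ.F) = fun _ => -1 :=
    ζ.fundField_apply_of_slope hF fun r z => by
      rw [Pi.neg_apply, σ.F_vadd, Pi.neg_apply]; ring
  rw [mlieBracket_swap, ζ.smooth_fundField.bracket_smul hF, h1, mlieBracket_self]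
  ext1 z
  simp

end operators

end AVBundle

/-! ### The operator algebroid: bracket identities, twisted closed forms, and a dual frame. -/

namespace AVBundle

section operators

variable {n : ℕ} {M : Type u} {Z : Type v} [TopologicalSpace M]
    [ChartedSpace (EuclideanSpace ℝ (Fin n)) M] [TopologicalSpace Z]
    [ChartedSpace (ModelProd (EuclideanSpace ℝ (Fin n)) ℝ) Z] [AddAction ℝ Z]
    [IsManifold (modelZ n) ∞ Z] {ζ : AVBundle n M Z}

open LieAlgebroidData

theorem operatorBracket_smul_add {D D' D'' : (∀ z : Z, TangentSpace (modelZ n) z) × (Z → ℝ)}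
    (hD' : D' ∈ ζ.affineOperators) (hD'' : D'' ∈ ζ.affineOperators)
    {f : Z → ℝ} (hf : ContMDiff (modelZ n) 𝓘(ℝ, ℝ) ∞ f) :
    operatorBracket D (D'.1 + f • D''.1, D'.2 + f * D''.2) =
      ((operatorBracket D D').1 + f • (operatorBracket D D'').1 + fieldApply D.1 f • D''.1,
        (operatorBracket D D').2 + f * (operatorBracket D D'').2 + fieldApply D.1 f * D''.2) := by
  refine Prod.ext ?_ ?_
  · change mlieBracket (modelZ n) D.1 (D'.1 + f • D''.1) = mlieBracket (modelZ n) D.1 D'.1 +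
      f • mlieBracket (modelZ n) D.1 D''.1 + fieldApply D.1 f • D''.1
    rw [hD'.1.bracket_add (hD''.1.smul hf), hD''.1.bracket_smul hf]
    abel
  · change fieldApply D.1 (D'.2 + f * D''.2) - fieldApply (D'.1 + f • D''.1) D.2 =
      fieldApply D.1 D'.2 - fieldApply D'.1 D.2 + f * (fieldApply D.1 D''.2 - fieldApply D''.1 D.2) +
        fieldApply D.1 f * D''.2
    rw [fieldApply_add _ hD'.2.1 (hf.mul hD''.2.1), fieldApply_mul _ hf hD''.2.1,
      fieldApply_field_add, fieldApply_smul]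
    ring

theorem operatorBracket_jacobi {D D' D'' : (∀ z : Z, TangentSpace (modelZ n) z) × (Z → ℝ)}
    (hD : D ∈ ζ.affineOperators) (hD' : D' ∈ ζ.affineOperators) (hD'' : D'' ∈ ζ.affineOperators) :
    operatorBracket D (operatorBracket D' D'') =
      operatorBracket (operatorBracket D D') D'' + operatorBracket D' (operatorBracket D D'') := by
  refine Prod.ext (hD.1.jacobi hD'.1 hD''.1) ?_
  change fieldApply D.1 (fieldApply D'.1 D''.2 - fieldApply D''.1 D'.2) -
      fieldApply (mlieBracket (modelZ n) D'.1 D''.1) D.2 =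
    fieldApply (mlieBracket (modelZ n) D.1 D'.1) D''.2 -
      fieldApply D''.1 (fieldApply D.1 D'.2 - fieldApply D'.1 D.2) +
    (fieldApply D'.1 (fieldApply D.1 D''.2 - fieldApply D''.1 D.2) -
      fieldApply (mlieBracket (modelZ n) D.1 D''.1) D'.2)
  have s : ∀ {A B : (∀ z : Z, TangentSpace (modelZ n) z) × (Z → ℝ)}, A ∈ ζ.affineOperators →
      B ∈ ζ.affineOperators → ContMDiff (modelZ n) 𝓘(ℝ, ℝ) ∞ (fieldApply A.1 B.2) :=
    fun hA hB => hA.1.fieldApply hB.2.1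
  rw [fieldApply_sub _ (s hD' hD'') (s hD'' hD'), fieldApply_sub _ (s hD hD') (s hD' hD),
    fieldApply_sub _ (s hD hD'') (s hD'' hD), ζ.fieldApply_bracket hD'.1 hD''.1 hD.2.1,
    ζ.fieldApply_bracket hD.1 hD'.1 hD''.2.1, ζ.fieldApply_bracket hD.1 hD''.1 hD'.2.1]
  abel

theorem operator_anchor_bracket (X Y : ζ.operatorAlgebroid.Sec) (f g h : C^∞⟮modelM n, M; ℝ⟯)
    (hg : ∀ m, ζ.operatorAlgebroid.anchor m (ζ.operatorAlgebroid.ev m X) f = g m)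
    (hh : ∀ m, ζ.operatorAlgebroid.anchor m (ζ.operatorAlgebroid.ev m Y) f = h m) (m : M) :
    ζ.operatorAlgebroid.anchor m (ζ.operatorAlgebroid.ev m (ζ.operatorAlgebroid.bracket X Y)) f =
      ζ.operatorAlgebroid.anchor m (ζ.operatorAlgebroid.ev m X) h -
        ζ.operatorAlgebroid.anchor m (ζ.operatorAlgebroid.ev m Y) g := by
  obtain ⟨z, rfl⟩ := ζ.exists_over m
  rw [operator_anchor _ f rfl, operator_anchor _ h rfl, operator_anchor _ g rfl,
    ζ.pullback_eq_of_forall fun m z hz => (hg m).symm.trans (operator_anchor X f hz),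
    ζ.pullback_eq_of_forall fun m z hz => (hh m).symm.trans (operator_anchor Y f hz)]
  exact congrFun (ζ.fieldApply_bracket X.2.1 Y.2.1 (ζ.contMDiff_pullback f)) z

/-- Twisting φ⁰ by itself adds the terms φ⁰(X)φ⁰(Y), which cancel, so ordinary closedness remains;
that is the order-zero part of the commutator. -/
theorem operator_closed : TwistedClosed ζ.phiZero ζ.phiZero := by
  intro X Y f g hf hg m
  obtain ⟨z, rfl⟩ := ζ.exists_over m
  rw [operator_anchor _ f rfl, operator_anchor _ g rfl,
    ζ.pullback_eq_of_forall fun m z hz => (hf m).symm.trans (operator_phiZero X hz),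
    ζ.pullback_eq_of_forall fun m z hz => (hg m).symm.trans (operator_phiZero Y hz), ← hf, ← hg,
    operator_phiZero _ rfl, operator_phiZero _ rfl, operator_phiZero _ rfl]
  change fieldApply X.1.1 Y.1.2 z - fieldApply Y.1.1 X.1.2 z = _
  ring

/-- This is the commutator identity [D,D'](F_σ) = D(D'(F_σ)) − D'(D(F_σ)): a section D acts on the
basic function D'(F_σ) as anchor plus multiplication by φ⁰(D). -/
theorem operator_closed_jetForm (σ : ζ.Section) : TwistedClosed ζ.phiZero σ.jetForm := by
  intro X Y f g hf hg m
  have ef := ζ.pullback_eq_of_forall (g := fieldApply X.1.1 σ.F + X.1.2 * σ.F)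
    fun m z hz => (hf m).symm.trans (operator_jet X σ hz)
  have eg := ζ.pullback_eq_of_forall (g := fieldApply Y.1.1 σ.F + Y.1.2 * σ.F)
    fun m z hz => (hg m).symm.trans (operator_jet Y σ hz)
  obtain ⟨z, rfl⟩ := ζ.exists_over m
  have hF := σ.contMDiff_F
  have h1 := congrFun (ζ.fieldApply_bracket X.2.1 Y.2.1 hF) z
  have h3 := operator_jet (ζ.operatorAlgebroid.bracket X Y) σ (z := z) rfl
  change _ = fieldApply (mlieBracket (modelZ n) X.1.1 Y.1.1) σ.F z +
    (fieldApply X.1.1 Y.1.2 z - fieldApply Y.1.1 X.1.2 z) * σ.F z at h3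
  refine h3.trans ?_
  have e1 : f (ζ.proj z) = fieldApply X.1.1 σ.F z + X.1.2 z * σ.F z := congrFun ef z
  have e2 : g (ζ.proj z) = fieldApply Y.1.1 σ.F z + Y.1.2 z * σ.F z := congrFun eg z
  rw [operator_anchor _ f rfl, operator_anchor _ g rfl, ef, eg, e1, e2,
    operator_phiZero _ rfl, operator_phiZero _ rfl,
    fieldApply_add _ (X.2.1.fieldApply hF) (X.2.2.1.mul hF),
    fieldApply_add _ (Y.2.1.fieldApply hF) (Y.2.2.1.mul hF),
    fieldApply_mul _ X.2.2.1 hF, fieldApply_mul _ Y.2.2.1 hF, h1]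
  simp only [Pi.add_apply, Pi.sub_apply, Pi.mul_apply]
  ring

theorem jet_vadd (f : C^∞⟮modelM n, M; ℝ⟯) (σ : ζ.Section) (m : M)
    (v : ζ.operatorAlgebroid.Fib m) : (f +ᵥ σ).jet m v =
      σ.jet m v + (ζ.operatorAlgebroid.anchor m v f + f m * ζ.phiZero.1 m v) := by
  obtain ⟨D, rfl⟩ := operator_ev_surjective v
  obtain ⟨z, rfl⟩ := ζ.exists_over m
  rw [operator_jet _ _ rfl, operator_jet _ _ rfl, operator_anchor _ _ rfl, operator_phiZero _ rfl,
    σ.vadd_F, fieldApply_add _ (ζ.contMDiff_pullback f) σ.contMDiff_F, Pi.add_apply, Pi.add_apply,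
    pullback]
  ring

variable (ζ) in
-- The index `true` carries −F_σX_Z + 1 with φ⁰, and `false` carries X_Z with jσ. The remaining
-- members are the horizontal lifts of coordinate fields. All members except `true` have zero
-- order-zero part, so they restrict to the tangent algebroid.
theorem operator_frame [T2Space M] [SigmaCompactSpace M] [IsManifold (modelM n) ∞ M]
    (m₀ : M) : ∃ (e : Fin n ⊕ Bool → ζ.operatorAlgebroid.Sec)
    (x : Fin n → C^∞⟮modelM n, M; ℝ⟯) (σ : ζ.Section), (∀ i, i ≠ Sum.inr true → (e i).1.2 = 0) ∧
    ∀ᶠ m in 𝓝 m₀, (∀ i j, (Sum.elim (fun i => ζ.anchorForm (x i))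
        (fun b : Bool => if b then ζ.phiZero else σ.jetForm) i).1 m (ζ.operatorAlgebroid.ev m (e j)) =
          if i = j then 1 else 0) ∧
      ∀ v : ζ.operatorAlgebroid.Fib m, (∀ i, (Sum.elim (fun i => ζ.anchorForm (x i))
        (fun b : Bool => if b then ζ.phiZero else σ.jetForm) i).1 m v = 0) → v = 0 := by
  obtain ⟨x, Y, hY, hx⟩ := exists_coordinates (n := n) m₀
  obtain ⟨σ⟩ := ζ.nonempty_section
  refine ⟨Sum.elim (fun j => ⟨(σ.lift (Y j), 0), invariant_mem (lift_mem σ (hY j))⟩)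
    (fun b : Bool => if b then ⟨(-σ.F • ζ.fundField, 1), euler_mem σ⟩ else
      ⟨(ζ.fundField, 0), invariant_mem fundField_mem⟩), x, σ, ?_, ?_⟩
  · rintro (i | _ | _) hi
    · rfl
    · rfl
    · exact absurd rfl hi
  filter_upwards [hx] with m hm
  obtain ⟨z, rfl⟩ := ζ.exists_over m
  refine ⟨?_, fun v hv => operator_eq_zero σ hm.2 (fun i => hv (Sum.inl i)) (hv (Sum.inr false))
    (hv (Sum.inr true))⟩
  rintro (i | _ | _) (j | _ | _)
  · refine (operator_anchor _ _ rfl).trans ((σ.lift_pullback (Y j) (x i) z).trans ?_)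
    simp [hm.1]
  · refine (operator_anchor _ _ rfl).trans ((congrFun (ζ.fundField_pullback (x i)) z).trans ?_)
    simp
  · refine (operator_anchor _ _ rfl).trans ?_
    change fieldApply (-σ.F • ζ.fundField) (ζ.pullback (x i)) z = _
    rw [fieldApply_smul, ζ.fundField_pullback]
    simp
  · refine (operator_jet _ σ rfl).trans ?_
    change fieldApply (σ.lift (Y j)) σ.F z + 0 * σ.F z = _
    rw [σ.lift_F]
    simp
  · refine (operator_jet _ σ rfl).trans ?_
    change fieldApply ζ.fundField σ.F z + 0 * σ.F z = _
    rw [σ.fundField_F]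
    simp
  · refine (operator_jet _ σ rfl).trans ?_
    change fieldApply (-σ.F • ζ.fundField) σ.F z + 1 * σ.F z = _
    rw [fieldApply_smul, σ.fundField_F]
    simp
  · refine (operator_phiZero _ rfl).trans ?_
    change (0 : ℝ) = _
    simp
  · refine (operator_phiZero _ rfl).trans ?_
    change (0 : ℝ) = _
    simp
  · refine (operator_phiZero _ rfl).trans ?_
    change (1 : ℝ) = _
    simp

end operators

end AVBundle

/-! ### The tangent algebroid as the kernel of φ⁰ in the operator algebroid. -/

namespace AVBundle

section inclusion

variable {n : ℕ} {M : Type u} {Z : Type v} [TopologicalSpace M]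
    [ChartedSpace (EuclideanSpace ℝ (Fin n)) M] [TopologicalSpace Z]
    [ChartedSpace (ModelProd (EuclideanSpace ℝ (Fin n)) ℝ) Z] [AddAction ℝ Z]
    [IsManifold (modelZ n) ∞ Z] (ζ : AVBundle n M Z)

open LieAlgebroidData

/-- The inclusion of `T̃Z` in `L̃Z`. -/
noncomputable def inclusion (m : M) : ζ.tangentAlgebroid.Fib m →ₗ[ℝ] ζ.operatorAlgebroid.Fib m where
  toFun v := ⟨(v.1, 0), by
    obtain ⟨X, hX, h⟩ := v.2
    exact ⟨(X, 0), invariant_mem hX, Prod.ext h rfl⟩⟩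
  map_add' v w := Subtype.ext (Prod.ext rfl (add_zero _).symm)
  map_smul' c v := Subtype.ext (Prod.ext rfl (smul_zero c).symm)

theorem inclusion_injective (m : M) : Function.Injective (ζ.inclusion m) := fun _ _ h =>
  Subtype.ext (congrArg (fun v => v.1.1) h)

/-- An invariant vector field as a differential operator. -/
noncomputable def operatorOfField (X : ζ.tangentAlgebroid.Sec) : ζ.operatorAlgebroid.Sec :=
  ⟨(X.1, 0), invariant_mem X.2⟩

variable {ζ}

theorem inclusion_ev (X : ζ.tangentAlgebroid.Sec) (m : M) :
    ζ.inclusion m (ζ.tangentAlgebroid.ev m X) =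
      ζ.operatorAlgebroid.ev m (ζ.operatorOfField X) := rfl

theorem operatorOfField_bracket (X Y : ζ.tangentAlgebroid.Sec) :
    ζ.operatorOfField (ζ.tangentAlgebroid.bracket X Y) =
      ζ.operatorAlgebroid.bracket (ζ.operatorOfField X) (ζ.operatorOfField Y) := by
  refine Subtype.ext (Prod.ext rfl ?_)
  change (0 : Z → ℝ) = fieldApply X.1 0 - fieldApply Y.1 0
  have h : ∀ X : ∀ z : Z, TangentSpace (modelZ n) z, fieldApply X 0 = 0 :=
    fun X => fieldApply_const X 0
  rw [h, h, sub_zero]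

theorem exists_operatorOfField {D : ζ.operatorAlgebroid.Sec} (hD : D.1.2 = 0) :
    ∃ X, ζ.operatorOfField X = D := by
  obtain ⟨⟨X, h⟩, hX, hh, h0, hb⟩ := D
  obtain rfl : h = 0 := hD
  refine ⟨⟨X, hX, ?_⟩, rfl⟩
  change mlieBracket (modelZ n) X ζ.fundField = (0 : Z → ℝ) • ζ.fundField at hb
  rw [mlieBracket_swap, hb, zero_smul, neg_zero]

theorem inclusion_anchor (m : M) (v : ζ.tangentAlgebroid.Fib m) (f : C^∞⟮modelM n, M; ℝ⟯) :
    ζ.operatorAlgebroid.anchor m (ζ.inclusion m v) f = ζ.tangentAlgebroid.anchor m v f := rfl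

theorem inclusion_phiZero (m : M) (v : ζ.tangentAlgebroid.Fib m) :
    ζ.phiZero.1 m (ζ.inclusion m v) = 0 := rfl

/-- The restriction of a `1`-form on `L̃Z` to `T̃Z`. -/
noncomputable def restrictForm (φ : ζ.operatorAlgebroid.OneForm) : ζ.tangentAlgebroid.OneForm :=
  ⟨fun m => (φ.1 m).comp (ζ.inclusion m), fun X => φ.2 (ζ.operatorOfField X)⟩

/-- The form `dσ` on `T̃Z` defined by a section. -/
noncomputable def Section.differentialForm (σ : ζ.Section) : ζ.tangentAlgebroid.OneForm :=
  restrictForm σ.jetForm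

theorem Section.differentialForm_apply (σ : ζ.Section) (m : M) :
    σ.differentialForm.1 m = σ.differential m := by
  ext v
  change _ + 0 * σ.F (σ.toFun m) = _
  rw [zero_mul, add_zero]; rfl

theorem restrictForm_closed {ψ : ζ.operatorAlgebroid.OneForm} (h : TwistedClosed ζ.phiZero ψ) :
    TwistedClosed (restrictForm ζ.phiZero) (restrictForm ψ) := by
  intro X Y f g hf hg m
  refine Eq.trans ?_ (h (ζ.operatorOfField X) (ζ.operatorOfField Y) f g hf hg m)
  rw [← operatorOfField_bracket]; rfl

end inclusion

/-! ### Verification of the affine calculus and the two equivalences. -/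

section calculus

variable {n : ℕ} {M : Type u} {Z : Type v} [TopologicalSpace M] [T2Space M] [SigmaCompactSpace M]
    [ChartedSpace (EuclideanSpace ℝ (Fin n)) M] [IsManifold (modelM n) ∞ M] [TopologicalSpace Z]
    [ChartedSpace (ModelProd (EuclideanSpace ℝ (Fin n)) ℝ) Z] [AddAction ℝ Z]
    [IsManifold (modelZ n) ∞ Z] (ζ : AVBundle n M Z)

open LieAlgebroidData

theorem isLieAlgebroid_operatorAlgebroid : ζ.operatorAlgebroid.IsLieAlgebroid where
  bump m U hU := exists_bump m hU
  exists_add_smul X Y f := by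
    refine ⟨⟨_, operator_mem_smul_add X.2 Y.2 f⟩, fun m => operator_ext ?_⟩
    rintro ⟨z, rfl⟩
    exact ⟨rfl, rfl⟩
  anchor_add m v w f := map_add ((ζ.anchorForm f).1 m) v w
  anchor_smul m c v f := map_smul ((ζ.anchorForm f).1 m) c v
  anchor_fun_add m v f g := by
    obtain ⟨D, rfl⟩ := operator_ev_surjective v
    obtain ⟨z, rfl⟩ := ζ.exists_over m
    simp only [operator_anchor D _ rfl]
    exact congrFun (fieldApply_add _ (ζ.contMDiff_pullback f) (ζ.contMDiff_pullback g)) z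
  anchor_fun_smul m v c f := by
    obtain ⟨D, rfl⟩ := operator_ev_surjective v
    obtain ⟨z, rfl⟩ := ζ.exists_over m
    simp only [operator_anchor D _ rfl]
    exact congrFun (fieldApply_const_smul _ (ζ.contMDiff_pullback f) c) z
  anchor_fun_mul m v f g := by
    obtain ⟨D, rfl⟩ := operator_ev_surjective v
    obtain ⟨z, rfl⟩ := ζ.exists_over m
    simp only [operator_anchor D _ rfl]
    exact congrFun (fieldApply_mul _ (ζ.contMDiff_pullback f) (ζ.contMDiff_pullback g)) z
  anchor_smooth X f := operator_exists_anchor X f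
  bracket_swap X Y m := by
    refine operator_ext fun z => ?_
    have h := operatorBracket_swap X.1 Y.1
    exact ⟨congrFun (congrArg Prod.fst h) z.1, congrFun (congrArg Prod.snd h) z.1⟩
  bracket_leibniz X Y W V f h m := by
    have hV : V.1 = (Y.1.1 + ζ.pullback f • W.1.1, Y.1.2 + ζ.pullback f * W.1.2) := by
      refine Prod.ext (funext fun z => ?_) (funext fun z => ?_)
      · exact congrFun (congrArg (fun v => v.1.1) (h (ζ.proj z))) ⟨z, rfl⟩
      · exact congrFun (congrArg (fun v => v.1.2) (h (ζ.proj z))) ⟨z, rfl⟩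
    have h1 := operatorBracket_smul_add (D := X.1) Y.2 W.2 (ζ.contMDiff_pullback f)
    rw [← hV] at h1
    refine operator_ext ?_
    rintro ⟨z, rfl⟩
    rw [operator_anchor X f rfl]
    exact ⟨congrFun (congrArg Prod.fst h1) z, congrFun (congrArg Prod.snd h1) z⟩
  jacobi X Y W m := by
    refine operator_ext fun z => ?_
    have h := operatorBracket_jacobi X.2 Y.2 W.2
    exact ⟨congrFun (congrArg Prod.fst h) z.1, congrFun (congrArg Prod.snd h) z.1⟩
  anchor_bracket := operator_anchor_bracket
  frame m₀ := by
    obtain ⟨e, x, σ, -, h⟩ := ζ.operator_frame m₀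
    refine ⟨Bool, inferInstance, e, Sum.elim (fun i => ζ.anchorForm (x i))
      (fun b : Bool => if b then ζ.phiZero else σ.jetForm), x, le_rfl, fun _ _ _ => rfl, h.mono fun m hm => ?_⟩
    exact eq_sum_of_dual hm.1 hm.2

theorem isAffineCalculus_operatorAlgebroid :
    IsAffineCalculus ζ ζ.operatorAlgebroid ζ.phiZero Section.jetForm where
  isLieAlgebroid := ζ.isLieAlgebroid_operatorAlgebroid
  closed := operator_closed
  closed_section := operator_closed_jetForm
  vadd := jet_vadd
  separating m v h := by
    obtain ⟨σ⟩ := ζ.nonempty_section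
    -- Comparing the jets of σ and of its translates gives this for every f; f = 1 isolates φ⁰, and
    -- coordinate functions then isolate the anchor.
    have h1 : ∀ f, ζ.operatorAlgebroid.anchor m v f + f m * ζ.phiZero.1 m v = 0 := by
      intro f
      have h2 := (jet_vadd f σ m v).symm.trans (h (f +ᵥ σ))
      rwa [show σ.jet m v = 0 from h σ, zero_add] at h2
    have h2 : ζ.phiZero.1 m v = 0 := by
      have h3 := h1 1
      rwa [ζ.isLieAlgebroid_operatorAlgebroid.anchor_one, zero_add, ContMDiffMap.coe_one,
        Pi.one_apply, one_mul] at h3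
    obtain ⟨x, _, _, hx⟩ := exists_coordinates (n := n) m
    refine operator_eq_zero σ hx.self_of_nhds.2 (fun i => ?_) (h σ) h2
    have h3 := h1 (x i)
    rwa [h2, mul_zero, add_zero] at h3
  anchor_tangent m v := by
    obtain ⟨D, rfl⟩ := operator_ev_surjective v
    obtain ⟨z, rfl⟩ := ζ.exists_over m
    exact ⟨_, fun f => (operator_anchor D f rfl).trans (ζ.mvfderiv_pullback f z _)⟩

/-- The inclusion into the operator algebroid is injective and respects bracket and anchor, so
identities are inherited. Existence statements need in addition that the result lies in the kernel
of φ⁰. -/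
theorem isLieAlgebroid_tangentAlgebroid : ζ.tangentAlgebroid.IsLieAlgebroid := by
  have hL := ζ.isLieAlgebroid_operatorAlgebroid
  exact
  { bump := fun m U hU => exists_bump m hU
    exists_add_smul := fun X Y f => by
      obtain ⟨W, hW⟩ := hL.exists_add_smul (ζ.operatorOfField X) (ζ.operatorOfField Y) f
      have h0 : W.1.2 = 0 := funext fun z => by
        have h1 := congrArg (ζ.phiZero.1 (ζ.proj z)) (hW (ζ.proj z))
        rw [← inclusion_ev, ← inclusion_ev, ← map_smul, ← map_add, inclusion_phiZero,
          operator_phiZero W rfl] at h1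
        exact h1
      obtain ⟨V, rfl⟩ := exists_operatorOfField h0
      refine ⟨V, fun m => ζ.inclusion_injective m ?_⟩
      rw [map_add, map_smul]
      exact hW m
    anchor_add := fun m v w f => map_add ((restrictForm (ζ.anchorForm f)).1 m) v w
    anchor_smul := fun m c v f => map_smul ((restrictForm (ζ.anchorForm f)).1 m) c v
    anchor_fun_add := fun m v f g => hL.anchor_fun_add m (ζ.inclusion m v) f g
    anchor_fun_smul := fun m v c f => hL.anchor_fun_smul m (ζ.inclusion m v) c f
    anchor_fun_mul := fun m v f g => hL.anchor_fun_mul m (ζ.inclusion m v) f g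
    anchor_smooth := fun X f => hL.anchor_smooth (ζ.operatorOfField X) f
    bracket_swap := fun X Y m => ζ.inclusion_injective m <| by
      rw [map_neg, inclusion_ev, inclusion_ev, operatorOfField_bracket, operatorOfField_bracket]
      exact hL.bracket_swap _ _ m
    bracket_leibniz := fun X Y W V f h m => ζ.inclusion_injective m <| by
      simp only [map_add, map_smul, inclusion_ev, operatorOfField_bracket]
      refine hL.bracket_leibniz _ _ _ _ f (fun m => ?_) m
      have h1 := congrArg (ζ.inclusion m) (h m)
      rwa [map_add, map_smul] at h1
    jacobi := fun X Y W m => ζ.inclusion_injective m <| by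
      simp only [map_add, inclusion_ev, operatorOfField_bracket]
      exact hL.jacobi _ _ _ m
    anchor_bracket := fun X Y f g h hg hh m => by
      rw [← inclusion_anchor, inclusion_ev, operatorOfField_bracket]
      exact hL.anchor_bracket (ζ.operatorOfField X) (ζ.operatorOfField Y) f g h hg hh m
    frame := fun m₀ => by
      obtain ⟨e, x, σ, he, h⟩ := ζ.operator_frame m₀
      -- The operator −F_σX_Z + 1 is dropped from the frame. Its dual φ⁰ vanishes on the tangent
      -- algebroid, so the remaining covectors still separate.
      choose e' he' using fun i : Fin n ⊕ Unit => exists_operatorOfField (he (Sum.map id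
        (fun _ => false) i) (by rcases i with i | i <;> simp))
      refine ⟨Unit, inferInstance, e', fun i => restrictForm (Sum.elim
        (fun i => ζ.anchorForm (x i)) (fun b : Bool => if b then ζ.phiZero else σ.jetForm)
        (Sum.map id (fun _ => false) i)), x, by simp, fun _ _ _ => rfl, h.mono fun m hm => ?_⟩
      refine eq_sum_of_dual (fun i j => ?_) fun v hv => ?_
      · have h1 := hm.1 (Sum.map id (fun _ => false) i) (Sum.map id (fun _ => false) j)
        rw [← he'] at h1
        refine h1.trans ?_
        rcases i with i | i <;> rcases j with j | j <;> simp
      · refine ζ.inclusion_injective m ((hm.2 _ ?_).trans (map_zero _).symm)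
        rintro (i | _ | _)
        · exact hv (Sum.inl i)
        · exact hv (Sum.inr ())
        · rfl }

theorem isAffineCalculus_tangentAlgebroid :
    IsAffineCalculus ζ ζ.tangentAlgebroid (restrictForm ζ.phiZero) Section.differentialForm := by
  have hL := ζ.isAffineCalculus_operatorAlgebroid
  exact
  { isLieAlgebroid := ζ.isLieAlgebroid_tangentAlgebroid
    closed := restrictForm_closed hL.closed
    closed_section := fun σ => restrictForm_closed (hL.closed_section σ)
    vadd := fun f σ m v => hL.vadd f σ m (ζ.inclusion m v)
    separating := fun m v h => ζ.inclusion_injective m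
      ((hL.separating m (ζ.inclusion m v) h).trans (map_zero _).symm)
    anchor_tangent := fun m v => hL.anchor_tangent m (ζ.inclusion m v) }

theorem representsAffJacobi_iff {J : ζ.operatorAlgebroid.Multi}
    (hJ : J ∈ ζ.operatorAlgebroid.degree 2) : ζ.RepresentsAffJacobi J ↔
      ∀ t : ℝ, ζ.operatorAlgebroid.IsCohomologyOperator (ζ.jacobiDifferential J t) := by
  have hC := ζ.isAffineCalculus_operatorAlgebroid
  have hS := hC.isLieAlgebroid.isSchoutenBracket_schouten
  -- For p = 2 the coefficient of J ∧ i_φR is 1, and that of i_φJ ∧ R is −(−1)³(k − 1) + t = k − 1 +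
  -- t.
  have h1 : ∀ t, ζ.jacobiDifferential J t = fun k : ℕ => IsSchoutenBracket.twistedDifferential
      ζ.operatorAlgebroid.schouten ζ.phiZero J ((k : ℝ) - 1 + t) := by
    intro t
    funext k
    refine LinearMap.ext fun R => ?_
    rw [IsSchoutenBracket.twistedDifferential_apply]
    change ζ.operatorAlgebroid.schouten J R + (((2 : ℕ) : ℝ) - 1) • (J * _) -
      ((-1 : ℝ) ^ (2 + 1) * ((k : ℝ) - 1)) • (_ * R) + t • (_ * R) = _
    norm_num
    module
  simp only [h1]
  rw [hS.isCohomologyOperator_iff hC.isLieAlgebroid hC.closed hJ]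
  constructor
  · rintro ⟨B, hB, hA⟩
    have hB' := (isBivectorBracket_iff (ψ := Section.jetForm) hJ).2 hB
    exact (hB'.isAffineLieBracket_iff hC hS hJ).1 hA.1
  · intro h
    obtain ⟨B, hB⟩ := exists_isBivectorBracket (ζ := ζ) Section.jetForm hJ
    have hB' := (isBivectorBracket_iff (ψ := Section.jetForm) hJ).1 hB
    refine ⟨B, hB', (hB.isAffineLieBracket_iff hC hS hJ).2 h,
      fun σ => ?_⟩
    choose w v hw using hB.exists_firstOrder hC hJ σ
    exact ⟨w, _, fun f σ' m => hw m f σ'⟩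

theorem representsAffPoisson_iff {Λ : ζ.tangentAlgebroid.Multi}
    (hΛ : Λ ∈ ζ.tangentAlgebroid.degree 2) : ζ.RepresentsAffPoisson Λ ↔
      ζ.tangentAlgebroid.IsCohomologyOperator (ζ.poissonDifferential Λ) := by
  have hC := ζ.isAffineCalculus_tangentAlgebroid
  have hS := hC.isLieAlgebroid.isSchoutenBracket_schouten
  have h0 : ∀ P, ζ.tangentAlgebroid.contract (restrictForm ζ.phiZero) P = 0 := fun P =>
    multi_ext fun m => ExteriorAlgebra.contr_zero_left _
  -- Since φ⁰ restricts to zero, the twisted differential is the plain Schouten bracket for every c,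
  -- and the quantifier over t in the general criterion becomes vacuous.
  have h1 : ∀ c, IsSchoutenBracket.twistedDifferential ζ.tangentAlgebroid.schouten
      (restrictForm ζ.phiZero) Λ c = ζ.tangentAlgebroid.schouten Λ := by
    intro c
    refine LinearMap.ext fun R => ?_
    rw [IsSchoutenBracket.twistedDifferential_apply, h0, h0, mul_zero, zero_mul, smul_zero,
      add_zero, add_zero]
  have h2 := hS.isCohomologyOperator_iff hC.isLieAlgebroid hC.closed hΛ
  simp only [h1, forall_const] at h2
  have h3 : ζ.poissonDifferential Λ = fun _ => ζ.tangentAlgebroid.schouten Λ := rfl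
  rw [h3, h2]
  have hd : ∀ σ : ζ.Section, ∀ m, σ.differentialForm.1 m = σ.differential m :=
    Section.differentialForm_apply
  constructor
  · rintro ⟨B, hB, hA⟩
    simp only [← hd] at hB
    exact (((isBivectorBracket_iff hΛ).2 hB).isAffineLieBracket_iff hC hS hΛ).1 hA.1
  · intro h
    obtain ⟨B, hB⟩ := exists_isBivectorBracket (ζ := ζ) Section.differentialForm hΛ
    refine ⟨B, ?_, (hB.isAffineLieBracket_iff hC hS hΛ).2 h, fun σ => ?_⟩
    · simp only [← hd]
      exact (isBivectorBracket_iff hΛ).1 hB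
    · choose w v hw using hB.exists_firstOrder hC hΛ σ
      refine ⟨w, fun f σ' m => (hw m f σ').trans ?_⟩
      change _ + (_ + 0 * f m) = _
      rw [zero_mul, add_zero]

end calculus

end AVBundle

theorem mainTheorem4 {n : ℕ} {M : Type*} {Z : Type*} [TopologicalSpace M] [T2Space M]
    [SigmaCompactSpace M] [ChartedSpace (EuclideanSpace ℝ (Fin n)) M] [IsManifold (modelM n) ∞ M]
    [TopologicalSpace Z] [ChartedSpace (ModelProd (EuclideanSpace ℝ (Fin n)) ℝ) Z]
    [IsManifold (modelZ n) ∞ Z] [AddAction ℝ Z] (ζ : AVBundle n M Z) :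
    ((∃! S, ζ.tangentAlgebroid.IsSchoutenBracket S) ∧
      (∃! S, ζ.operatorAlgebroid.IsSchoutenBracket S)) ∧
    (∀ Λ ∈ ζ.tangentAlgebroid.degree 2,
      (ζ.RepresentsAffPoisson Λ ↔
        ζ.tangentAlgebroid.IsCohomologyOperator (ζ.poissonDifferential Λ)) ∧
      (ζ.RepresentsAffPoisson Λ → ∀ k,
        ζ.tangentAlgebroid.coboundaries (ζ.poissonDifferential Λ) k ≤
          ζ.tangentAlgebroid.cocycles (ζ.poissonDifferential Λ) k)) ∧
    (∀ J ∈ ζ.operatorAlgebroid.degree 2,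
      (ζ.RepresentsAffJacobi J ↔
        ∀ t : ℝ, ζ.operatorAlgebroid.IsCohomologyOperator (ζ.jacobiDifferential J t)) ∧
      (ζ.RepresentsAffJacobi J → ∀ t : ℝ, ∀ k,
        ζ.operatorAlgebroid.coboundaries (ζ.jacobiDifferential J t) k ≤
          ζ.operatorAlgebroid.cocycles (ζ.jacobiDifferential J t) k)) := by
  refine ⟨⟨ζ.isLieAlgebroid_tangentAlgebroid.existsUnique_schouten,
    ζ.isLieAlgebroid_operatorAlgebroid.existsUnique_schouten⟩, fun Λ hΛ => ?_, fun J hJ => ?_⟩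
  · have h := ζ.representsAffPoisson_iff hΛ
    exact ⟨h, fun hR => LieAlgebroidData.coboundaries_le_cocycles (h.1 hR)⟩
  · have h := ζ.representsAffJacobi_iff hJ
    exact ⟨h, fun hR t => LieAlgebroidData.coboundaries_le_cocycles (h.1 hR t)⟩
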